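/- **Setting.** Let $X\in\mathbb R^n$ have density $f(x;\theta)$, $\theta\in\mathbb R^d$, let $Y=g(X;\theta)\in\mathbb R^r$ have density $p(y|\theta)$, and let $Y_1,\dots,Y_T$ be data; $p(y|\theta)=\prod_tp(Y_t|\theta)$. Let $p(\theta)$ be a prior density and $\{q_\lambda\}_{\lambda\in\Lambda}$ a family of densities on $\mathbb R^d$, where $\Lambda\subset\mathbb R^l$ is convex with non-empty interior, re-parameterized as $\theta(u;\lambda)\sim q_\lambda$ for $u\in\mathbb R^s$ with density $p_0$. The ELBO is $$L(\lambda)=\mathbb E_{q_\lambda(\theta)}[\log p(y|\theta)+\log p(\theta)-\log q_\lambda(\theta)],$$ and $\hat L_M(\lambda)=\frac1M\sum_{m=1}^M\big(\log p(y|\theta)+\log p(\theta)-\log q_\lambda(\theta)\big)\big|_{\theta=\theta(u_m;\lambda)}$ for i.i.d. $u_1,\dots,u_M\sim p_0$. Put $A_u(\lambda)=\nabla_\lambda\theta(u;\lambda)$ (the $l\times d$ transposed Jacobian), $B_u(\lambda)=\nabla_\theta\log p(\theta)|_{\theta=\theta(u;\lambda)}$, $C_u(\lambda)=\nabla_\theta\log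 q_\lambda(\theta)|_{\theta=\theta(u;\lambda)}$ and $h(u;\lambda)=A_u(\lambda)\big(\sum_t\nabla_\theta\log p(Y_t|\theta(u;\lambda))+B_u(\lambda)-C_u(\lambda)\big)$. It is taken for granted that these objects are measurable, that $L$ and the gradients of the log densities at the sampled points exist, that $\nabla_\lambda$ and $\mathbb E_u$ may be interchanged in $L(\lambda)=\mathbb E_u[\cdots]$, and that $\mathbb E_{q_\lambda}[\nabla_\lambda\log q_\lambda(\theta)]=0$. All derivatives in $\lambda$ are relative to $\Lambda$. **Algorithm (NMTS).** Draw $u_1,\dots,u_M$ i.i.d. from $p_0$; start at $\lambda_0\in\Lambda$ and $D_{0,m}=(D_{0,m,t})_{t\le T}$, $D_{0,m,t}\in\mathbb R^d$, $\|D_{0,m,t}\|\le R$. For $k\ge0$ put $\theta_{k,m}=\theta(u_m;\lambda_k)$; for each $m$ draw, conditionally on $\sigma(u,\lambda_0,D_0,\dots,\lambda_k,D_k)$, an i.i.d. batch $X_1,\dots,X_N$ with density $f(\cdot;\theta_{k,m})$ (batches of different $m$ may be shared or dependent), let $\bar G_{i}(Y_t,\theta_{k,m})=\frac1N\sum_{j\le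 N}G_i(X_j,Y_t,\theta_{k,m})$, $i=1,2$, and $$D_{k+1,m,t}=D_{k,m,t}+\alpha_k\big(\bar G_1(Y_t,\theta_{k,m})-\bar G_2(Y_t,\theta_{k,m})D_{k,m,t}\big),$$ $$\lambda_{k+1}=\Pi_\Lambda\Big(\lambda_k+\beta_k\frac1M\sum_{m=1}^MA_{u_m}(\lambda_k)\Big(\sum_tD_{k,m,t}+B_{u_m}(\lambda_k)-C_{u_m}(\lambda_k)\Big)\Big),$$ with $\Pi_\Lambda$ the Euclidean projection. Write $\lambda_k^M=\lambda_k$. **Assumptions** (for $p_0$-almost every $u$ where $u$ occurs). 1. $\Lambda$ is compact; $\|h(u;\lambda_1)-h(u;\lambda_2)\|\le m(u)\|\lambda_1-\lambda_2\|$ on $\Lambda$ with $\int m^2p_0<\infty$. 2. There are $C_1,C_2,\varepsilon>0$ such that for all $\lambda\in\Lambda$ and $X\sim f(\cdot;\theta(u;\lambda))$: $\mathbb E\sum_t\|G_1(X,Y_t,\theta(u;\lambda))\|^2\le C_1$, $\mathbb E\,G_2(X,Y_t,\theta(u;\lambda))\ge\varepsilon$ for every $t$, $\mathbb E\sum_t|G_2(X,Y_t,\theta(u;\lambda))|^2\le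 C_2$. For all $\theta,t$ and $X\sim f(\cdot;\theta)$: $\mathbb E\,G_1(X,Y_t,\theta)=\nabla_\theta p(Y_t|\theta)$ and $\mathbb E\,G_2(X,Y_t,\theta)=p(Y_t|\theta)$. 3. $p(Y_t|\cdot)$ is positive and $C^2$ on $\mathbb R^d$; $\theta(u;\cdot)$ is differentiable and $A_u,B_u,C_u$ are $C^1$ on $\Lambda$; and there is $\kappa$ with $\int\kappa^4p_0<\infty$ such that on $\Lambda$: $\|A_u(\lambda)\|\le\kappa(u)$, $\|A_u(\lambda)(B_u(\lambda)-C_u(\lambda))\|\le\kappa(u)$, and each $\lambda\mapsto\nabla_\theta\log p(Y_t|\theta(u;\lambda))$ is $\kappa(u)$-Lipschitz. 4. $L$ and, for every $M$ almost surely, $\hat L_M$ are $C^2$ on $\Lambda$; $\nabla^2L(\lambda)$ is invertible for $\lambda\in\Lambda$. 5. There is $K_L>0$ such that for every $M$, almost surely, the largest eigenvalue of $\nabla^2\hat L_M(\lambda)$ is less than $-K_L$ for all $\lambda\in\Lambda$. 6. $\alpha_k,\beta_k>0$, and $\alpha_k=\alpha_0k^{-a}$, $\beta_k=\beta_0k^{-b}$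 for $k\ge1$, with $\alpha_0,\beta_0>0$ and $\frac12<a<b\le1$ (here $\alpha_0,\beta_0$ denote these constants; the step sizes at $k=0$ are arbitrary positive numbers); if $b=1$, then $\beta_0K_L>1-a$. **Theorem.** Let $\bar\lambda\in\Lambda$ maximize the ELBO $L$ over $\Lambda$. Then there is a constant $C$, depending neither on $k$, $M$, $N$ nor on the run of the algorithm (it may depend on the model, $\Lambda$, the step sizes and $R$), such that for all $M,N\ge1$, every run and all $k\ge0$, $$\mathbb E\|\lambda_k^M-\bar\lambda\|\le C\Big(\frac{\beta_k}{\alpha_k}+\sqrt{\frac{\alpha_k}{N}}+\sqrt{\frac1M}\Big).$$ That is, $\mathbb E\|\lambda_k^M-\bar\lambda\|=O(\beta_k/\alpha_k)+O(\sqrt{\alpha_k/N})+O(M^{-1/2})$. -/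

import Mathlib

open MeasureTheory ProbabilityTheory

noncomputable section

namespace NMTS

/-- Euclidean space `ℝⁿ`. -/
abbrev E (n : ℕ) : Type := EuclideanSpace ℝ (Fin n)

/-- The (Lebesgue) measure with density `f`. -/
def densityLaw {n : ℕ} (f : E n → ℝ) : Measure (E n) :=
  volume.withDensity (fun x => ENNReal.ofReal (f x))

/-- The Euclidean projection of `x` onto `S` (the nearest point, unique for `S` closed convex
and nonempty). -/
def proj {n : ℕ} (S : Set (E n)) (x : E n) : E n :=
  Classical.epsilon (fun y => y ∈ S ∧ dist x y = Metric.infDist x S)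

/-- The Hessian of `F` on the set `S`, as a linear map. -/
def hessianOn {n : ℕ} (S : Set (E n)) (F : E n → ℝ) (x : E n) : E n →L[ℝ] E n :=
  fderivWithin ℝ (gradientWithin F S) S x

/-- The data of a likelihood-free posterior density estimation problem:
`X` has density `f(·; θ)`, the observable is `Y = g(X; θ)`, its density is `p(· | θ)`;
`Y 0, …, Y (T-1)` are the observed data; `prior` is the prior density of `θ`;
`Λ` is the feasible set of the variational parameter; `q lam` is the variational density;
`p0` is the density of the outer variable `u` and `θ u lam` the re-parameterization;
`G1 x y ϑ`, `G2 x y ϑ` are the single-run estimators of `∇_θ p(y | ϑ)` and `p(y | ϑ)`. -/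
structure Model (l d n r s T : ℕ) where
  f : E n → E d → ℝ
  g : E n → E d → E r
  p : E r → E d → ℝ
  Y : Fin T → E r
  prior : E d → ℝ
  Λ : Set (E l)
  q : E l → E d → ℝ
  p0 : E s → ℝ
  θ : E s → E l → E d
  G1 : E n → E r → E d → E d
  G2 : E n → E r → E d → ℝ

namespace Model

variable {l d n r s T : ℕ} (mdl : Model l d n r s T)

/-- The law of the latent variable `X` at the parameter `ϑ`. -/
def lawX (ϑ : E d) : Measure (E n) := densityLaw (fun x => mdl.f x ϑ)

/-- The law of the outer variable `u`. -/
def lawU : Measure (E s) := densityLaw mdl.p0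

/-- The variational distribution. -/
def lawQ (lam : E l) : Measure (E d) := densityLaw (mdl.q lam)

/-- `∇_θ log p(Y_t | ϑ) = ∇_θ p(Y_t | ϑ) / p(Y_t | ϑ)`. -/
def score (t : Fin T) (ϑ : E d) : E d :=
  (mdl.p (mdl.Y t) ϑ)⁻¹ • gradient (mdl.p (mdl.Y t)) ϑ

/-- `A_u(lam) = ∇_lam θ(u; lam)`, the `l × d` matrix that is the transpose of the derivative. -/
def A (u : E s) (lam : E l) : E d →L[ℝ] E l :=
  ContinuousLinearMap.adjoint (fderivWithin ℝ (mdl.θ u) mdl.Λ lam)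

/-- `B_u(lam) = ∇_θ log p(θ)` at `θ = θ(u; lam)`. -/
def B (u : E s) (lam : E l) : E d :=
  gradient (fun ϑ => Real.log (mdl.prior ϑ)) (mdl.θ u lam)

/-- `C_u(lam) = ∇_θ log q_lam(θ)` at `θ = θ(u; lam)`. -/
def C (u : E s) (lam : E l) : E d :=
  gradient (fun ϑ => Real.log (mdl.q lam ϑ)) (mdl.θ u lam)

/-- The outer-sample gradient
`h(u; lam) = ∇_lam θ (∑_t ∇_θ p(Y_t|θ)/p(Y_t|θ) + ∇_θ log p(θ) - ∇_θ log q_lam(θ))`,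
at `θ = θ(u; lam)`. -/
def h (u : E s) (lam : E l) : E l :=
  mdl.A u lam ((∑ t, mdl.score t (mdl.θ u lam)) + mdl.B u lam - mdl.C u lam)

/-- `log p(y|θ) + log p(θ) - log q_lam(θ)`, where `p(y|θ) = ∏_t p(Y_t|θ)`. -/
def logRatio (lam : E l) (ϑ : E d) : ℝ :=
  (∑ t, Real.log (mdl.p (mdl.Y t) ϑ)) + Real.log (mdl.prior ϑ) - Real.log (mdl.q lam ϑ)

/-- The ELBO `L(lam) = E_{q_lam}[log p(y|θ) + log p(θ) - log q_lam(θ)]`. -/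
def elbo (lam : E l) : ℝ := ∫ ϑ, mdl.logRatio lam ϑ ∂(mdl.lawQ lam)

/-- The sample average approximation of the ELBO with outer samples `u_1, …, u_M`. -/
def saaElbo {M : ℕ} (u : Fin M → E s) (lam : E l) : ℝ :=
  (M : ℝ)⁻¹ * ∑ m, mdl.logRatio lam (mdl.θ (u m) lam)

/-- The estimator of `∇_θ p(Y_t | ϑ)` with batch `x_1, …, x_N`. -/
def G1bar {N : ℕ} (x : Fin N → E n) (t : Fin T) (ϑ : E d) : E d :=
  (N : ℝ)⁻¹ • ∑ i, mdl.G1 (x i) (mdl.Y t) ϑ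

/-- The estimator of `p(Y_t | ϑ)` with batch `x_1, …, x_N`. -/
def G2bar {N : ℕ} (x : Fin N → E n) (t : Fin T) (ϑ : E d) : ℝ :=
  (N : ℝ)⁻¹ * ∑ i, mdl.G2 (x i) (mdl.Y t) ϑ

/-- The search direction
`S = (1/M) ∑_m ∇_lam θ(u_m; lam) (∑_t D_{m,t} + ∇_θ log p(θ_m) - ∇_θ log q_lam(θ_m))`. -/
def direction {M : ℕ} (u : Fin M → E s) (lam : E l) (D : Fin M → Fin T → E d) : E l :=
  (M : ℝ)⁻¹ • ∑ m, mdl.A (u m) lam ((∑ t, D m t) + mdl.B (u m) lam - mdl.C (u m) lam)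

/-- One NMTS iteration with step sizes `αk`, `βk`, from the state `(lam, D)`; the vector
`D_m ∈ ℝ^{T d}` is stored through its blocks `D m t ∈ ℝ^d`, and the batch `x m` is used
in the block `m`. -/
def step {M N : ℕ} (αk βk : ℝ) (u : Fin M → E s) (x : Fin M → Fin N → E n)
    (z : E l × (Fin M → Fin T → E d)) : E l × (Fin M → Fin T → E d) :=
  (proj mdl.Λ (z.1 + βk • mdl.direction u z.1 z.2),
    fun m t => z.2 m t + αk • (mdl.G1bar (x m) t (mdl.θ (u m) z.1)
      - mdl.G2bar (x m) t (mdl.θ (u m) z.1) • z.2 m t))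

/-- The NMTS iterates `(lam_k, D_k)`, from the outer samples `u`, the inner samples `x` and the
initial state `z0`. -/
def iterates {M N : ℕ} (α β : ℕ → ℝ) (u : Fin M → E s) (x : ℕ → Fin M → Fin N → E n)
    (z0 : E l × (Fin M → Fin T → E d)) : ℕ → E l × (Fin M → Fin T → E d)
  | 0 => z0
  | k + 1 => mdl.step (α k) (β k) u (x k) (iterates α β u x z0 k)

/-- The standing conventions: the functions above are the densities they are meant to be, all
objects are measurable, the ELBO exists, the gradients of the log densities exist at the sampled
points, and differentiation (in `lam`) and expectation may be interchanged. -/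
structure WellPosed : Prop where
  convex : Convex ℝ mdl.Λ
  interior_nonempty : (interior mdl.Λ).Nonempty
  f_nonneg : ∀ x ϑ, 0 ≤ mdl.f x ϑ
  f_measurable : Measurable (fun z : E n × E d => mdl.f z.1 z.2)
  f_prob : ∀ ϑ, IsProbabilityMeasure (mdl.lawX ϑ)
  g_measurable : ∀ ϑ, Measurable (fun x => mdl.g x ϑ)
  p_nonneg : ∀ y ϑ, 0 ≤ mdl.p y ϑ
  p_measurable : ∀ ϑ, Measurable (fun y => mdl.p y ϑ)
  /-- `p(· | ϑ)` is the density of `Y = g(X; ϑ)`. -/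
  p_density : ∀ ϑ, (mdl.lawX ϑ).map (fun x => mdl.g x ϑ) = densityLaw (fun y => mdl.p y ϑ)
  prior_nonneg : ∀ ϑ, 0 ≤ mdl.prior ϑ
  prior_measurable : Measurable mdl.prior
  prior_prob : IsProbabilityMeasure (densityLaw mdl.prior)
  p0_nonneg : ∀ u, 0 ≤ mdl.p0 u
  p0_measurable : Measurable mdl.p0
  p0_prob : IsProbabilityMeasure mdl.lawU
  q_nonneg : ∀ lam ∈ mdl.Λ, ∀ ϑ, 0 ≤ mdl.q lam ϑ
  q_measurable : ∀ lam ∈ mdl.Λ, Measurable (mdl.q lam)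
  θ_measurable : Measurable (fun z : E s × E l => mdl.θ z.1 z.2)
  /-- `θ(u; lam)` has density `q_lam`. -/
  q_density : ∀ lam ∈ mdl.Λ, mdl.lawU.map (fun u => mdl.θ u lam) = mdl.lawQ lam
  prior_pos : ∀ᵐ u ∂mdl.lawU, ∀ lam ∈ mdl.Λ, 0 < mdl.prior (mdl.θ u lam) ∧
    DifferentiableAt ℝ mdl.prior (mdl.θ u lam)
  q_pos : ∀ᵐ u ∂mdl.lawU, ∀ lam ∈ mdl.Λ, 0 < mdl.q lam (mdl.θ u lam) ∧
    DifferentiableWithinAt ℝ (fun z : E l × E d => mdl.q z.1 z.2) (mdl.Λ ×ˢ Set.univ)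
      (lam, mdl.θ u lam)
  A_measurable : Measurable (fun z : E s × E l => mdl.A z.1 z.2)
  B_measurable : Measurable (fun z : E s × E l => mdl.B z.1 z.2)
  C_measurable : Measurable (fun z : E s × E l => mdl.C z.1 z.2)
  G1_measurable : ∀ t, Measurable (fun z : E n × E d => mdl.G1 z.1 (mdl.Y t) z.2)
  G2_measurable : ∀ t, Measurable (fun z : E n × E d => mdl.G2 z.1 (mdl.Y t) z.2)
  elbo_integrable : ∀ lam ∈ mdl.Λ, Integrable (mdl.logRatio lam) (mdl.lawQ lam)
  /-- `∇_lam E_u[F(u, lam)] = E_u[∇_lam F(u, lam)]` for the re-parameterized ELBO integrand. -/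
  interchange : ∀ lam ∈ mdl.Λ,
    Integrable (fun u => gradientWithin (fun v => mdl.logRatio v (mdl.θ u v)) mdl.Λ lam)
      mdl.lawU ∧
    gradientWithin mdl.elbo mdl.Λ lam =
      ∫ u, gradientWithin (fun v => mdl.logRatio v (mdl.θ u v)) mdl.Λ lam ∂mdl.lawU
  /-- `E_{q_lam}[∇_lam log q_lam(θ)] = 0`. -/
  q_score_mean : ∀ lam ∈ mdl.Λ,
    Integrable (fun ϑ => gradientWithin (fun v => Real.log (mdl.q v ϑ)) mdl.Λ lam)
      (mdl.lawQ lam) ∧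
    ∫ ϑ, gradientWithin (fun v => Real.log (mdl.q v ϑ)) mdl.Λ lam ∂(mdl.lawQ lam) = 0

/-- `Λ` is compact and `h(u; ·)` is Lipschitz on `Λ` with a square-integrable constant. -/
structure LipschitzGradient : Prop where
  compact : IsCompact mdl.Λ
  lipschitz : ∃ mfun : E s → ℝ, Measurable mfun ∧ Integrable (fun u => mfun u ^ 2) mdl.lawU ∧
    ∀ᵐ u ∂mdl.lawU, ∀ lam₁ ∈ mdl.Λ, ∀ lam₂ ∈ mdl.Λ,
      ‖mdl.h u lam₁ - mdl.h u lam₂‖ ≤ mfun u * ‖lam₁ - lam₂‖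

/-- Conditions on the estimators, and smoothness. -/
structure Regularity : Prop where
  G1_bound : ∃ C₁ : ℝ, 0 < C₁ ∧ ∀ᵐ u ∂mdl.lawU, ∀ lam ∈ mdl.Λ,
    ∫⁻ x, ∑ t, ‖mdl.G1 x (mdl.Y t) (mdl.θ u lam)‖ₑ ^ 2 ∂(mdl.lawX (mdl.θ u lam))
      ≤ ENNReal.ofReal C₁
  G2_lower : ∃ ε : ℝ, 0 < ε ∧ ∀ᵐ u ∂mdl.lawU, ∀ lam ∈ mdl.Λ, ∀ t,
    ε ≤ ∫ x, mdl.G2 x (mdl.Y t) (mdl.θ u lam) ∂(mdl.lawX (mdl.θ u lam))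
  G2_bound : ∃ C₂ : ℝ, 0 < C₂ ∧ ∀ᵐ u ∂mdl.lawU, ∀ lam ∈ mdl.Λ,
    ∫⁻ x, ∑ t, ‖mdl.G2 x (mdl.Y t) (mdl.θ u lam)‖ₑ ^ 2 ∂(mdl.lawX (mdl.θ u lam))
      ≤ ENNReal.ofReal C₂
  G1_unbiased : ∀ t ϑ, Integrable (fun x => mdl.G1 x (mdl.Y t) ϑ) (mdl.lawX ϑ) ∧
    ∫ x, mdl.G1 x (mdl.Y t) ϑ ∂(mdl.lawX ϑ) = gradient (mdl.p (mdl.Y t)) ϑ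
  G2_unbiased : ∀ t ϑ, Integrable (fun x => mdl.G2 x (mdl.Y t) ϑ) (mdl.lawX ϑ) ∧
    ∫ x, mdl.G2 x (mdl.Y t) ϑ ∂(mdl.lawX ϑ) = mdl.p (mdl.Y t) ϑ
  p_pos : ∀ t ϑ, 0 < mdl.p (mdl.Y t) ϑ
  p_smooth : ∀ t, ContDiff ℝ 2 (mdl.p (mdl.Y t))
  θ_smooth : ∀ᵐ u ∂mdl.lawU, DifferentiableOn ℝ (mdl.θ u) mdl.Λ
  A_smooth : ∀ᵐ u ∂mdl.lawU, ContDiffOn ℝ 1 (mdl.A u) mdl.Λ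
  B_smooth : ∀ᵐ u ∂mdl.lawU, ContDiffOn ℝ 1 (mdl.B u) mdl.Λ
  C_smooth : ∀ᵐ u ∂mdl.lawU, ContDiffOn ℝ 1 (mdl.C u) mdl.Λ
  /-- On the compact set `Λ` the quantities `A_u`, `A_u (B_u - C_u)` are bounded, and the scores
  are Lipschitz, with a constant `κ(u)` that has a fourth moment. -/
  envelope : ∃ κ : E s → ℝ, Measurable κ ∧ Integrable (fun u => κ u ^ 4) mdl.lawU ∧
    ∀ᵐ u ∂mdl.lawU, ∀ lam ∈ mdl.Λ,
      ‖mdl.A u lam‖ ≤ κ u ∧ ‖mdl.A u lam (mdl.B u lam - mdl.C u lam)‖ ≤ κ u ∧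
      ∀ lam' ∈ mdl.Λ, ∀ t, ‖mdl.score t (mdl.θ u lam) - mdl.score t (mdl.θ u lam')‖
        ≤ κ u * ‖lam - lam'‖
  saa_smooth : ∀ M : ℕ, 1 ≤ M → ∀ᵐ u ∂(Measure.pi fun _ : Fin M => mdl.lawU),
    ContDiffOn ℝ 2 (mdl.saaElbo u) mdl.Λ
  elbo_smooth : ContDiffOn ℝ 2 mdl.elbo mdl.Λ
  elbo_hessian : ∀ lam ∈ mdl.Λ, IsUnit (hessianOn mdl.Λ mdl.elbo lam)

/-- For every `M`, almost surely and for all `lam ∈ Λ`, the largest eigenvalue of the Hessian of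
the sample average approximation of the ELBO is less than `-KL`. -/
def StronglyConcaveSAA (KL : ℝ) : Prop :=
  ∀ M : ℕ, 1 ≤ M → ∀ᵐ u ∂(Measure.pi fun _ : Fin M => mdl.lawU), ∀ lam ∈ mdl.Λ,
    ∀ μ : ℝ, Module.End.HasEigenvalue
      (hessianOn mdl.Λ (mdl.saaElbo u) lam : E l →ₗ[ℝ] E l) μ → μ < -KL

end Model

/-- `α_k = α₀ / k^a`, `β_k = β₀ / k^b` for `k ≥ 1` with `1/2 < a < b ≤ 1`; these imply
`∑ α_k = ∑ β_k = ∞`, `∑ α_k² < ∞`, `∑ β_k² < ∞` and `β_k = o(α_k)`. -/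
structure StepSizes (α β : ℕ → ℝ) (a b α₀ β₀ : ℝ) : Prop where
  half_lt : 1 / 2 < a
  a_lt_b : a < b
  b_le : b ≤ 1
  α₀_pos : 0 < α₀
  β₀_pos : 0 < β₀
  α_pos : ∀ k, 0 < α k
  β_pos : ∀ k, 0 < β k
  α_eq : ∀ k : ℕ, 1 ≤ k → α k = α₀ / (k : ℝ) ^ a
  β_eq : ∀ k : ℕ, 1 ≤ k → β k = β₀ / (k : ℝ) ^ b

/-- A run of the NMTS algorithm with `M` outer samples, batch size `N`, and initial values
`lam0 ∈ Λ` and `D0` with blocks of norm at most `R`. -/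
structure Run {l d n r s T : ℕ} (mdl : Model l d n r s T) (M N : ℕ) (α β : ℕ → ℝ) (R : ℝ)
    {Ω : Type*} [MeasurableSpace Ω] (P : Measure Ω) where
  u : Fin M → Ω → E s
  X : ℕ → Fin M → Fin N → Ω → E n
  lam0 : Ω → E l
  D0 : Fin M → Fin T → Ω → E d
  u_measurable : ∀ m, Measurable (u m)
  X_measurable : ∀ k m i, Measurable (X k m i)
  lam0_measurable : Measurable lam0
  D0_measurable : ∀ m t, Measurable (D0 m t)
  lam0_mem : ∀ ω, lam0 ω ∈ mdl.Λ
  D0_bound : ∀ m t ω, ‖D0 m t ω‖ ≤ R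
  u_indep : iIndepFun u P
  u_law : ∀ m, P.map (u m) = mdl.lawU
  /-- Given the history `σ(u, lam_0, D_0, …, lam_k, D_k)`, the batch used at the `k`-th iteration
  in the block `m` is i.i.d. with density `f(·; θ(u_m; lam_k))`. No condition is put on the joint
  law over different blocks, so that these may share the same samples. -/
  X_law : ∀ (k : ℕ) (m : Fin M) (S : Set (Fin N → E n)), MeasurableSet S →
    P⟦(fun ω i => X k m i ω) ⁻¹' S |
      MeasurableSpace.comap
        (fun ω => ((fun m' => u m' ω), fun j : Fin (k + 1) =>
          mdl.iterates α β (fun m' => u m' ω) (fun k' m' i => X k' m' i ω)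
            (lam0 ω, fun m' t => D0 m' t ω) j)) inferInstance⟧
      =ᵐ[P] fun ω => (Measure.pi fun _ : Fin N =>
        mdl.lawX (mdl.θ (u m ω) (mdl.iterates α β (fun m' => u m' ω)
          (fun k' m' i => X k' m' i ω) (lam0 ω, fun m' t => D0 m' t ω) k).1)).real S

/-- The sequence `lam_k^M` generated by a run. -/
def Run.lam {l d n r s T : ℕ} {mdl : Model l d n r s T} {M N : ℕ} {α β : ℕ → ℝ} {R : ℝ}
    {Ω : Type*} [MeasurableSpace Ω] {P : Measure Ω} (ρ : Run mdl M N α β R P) (k : ℕ) (ω : Ω) :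
    E l :=
  (mdl.iterates α β (fun m => ρ.u m ω) (fun k' m i => ρ.X k' m i ω)
    (ρ.lam0 ω, fun m t => ρ.D0 m t ω) k).1

end NMTS

end

noncomputable section
namespace NMTS

/-! ### A maximal inequality for sums of independent vectors -/

/-! The algorithm runs on two time scales. On each of them a mean error satisfies a scalar linear
recursion with contraction factor about `1 - μ η_k` and a small forcing, and `exists_rate_bound`
turns such a recursion into a rate.

Fast scale. Given the history, the mean update of a block `D_{k,m,t}` multiplies its distance to the
score by `1 - α_k p(Y_t|θ)` with `p ≥ ε`; the batch adds a variance of order `α_k² / N`; and the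
target drifts, because `λ_k` moves by at most `β_k` times the norm of the direction. Young's
inequality spends half of the contraction and gives `E‖err_{k+1}‖² ≤ (1 - ε α_k) E‖err_k‖² + O(β_k²
/ α_k) + O(α_k² / N)` for large `k`, hence `E‖err_k‖² = O((β_k / α_k + √(α_k / N))²)`
(`exists_err_sq_bound`). The drift involves `κ(u_m)² κ(u_m')² ‖D_{m'}‖²`, so second moments of the
blocks weighted by functions of the outer samples are bounded beforehand
(`exists_block_moment_bound`); this is where the fourth moment of `κ` enters.

Slow scale. The pathwise gradient of the ELBO integrand differs from `h` by `∇_λ log q_λ`, whose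
mean is zero, so `∇L` is the mean of `h` and inherits a Lipschitz bound. The concavity hypothesis
with `M = 1` concerns the integrand itself; integrated over `u` it makes `∇L` strongly monotone with
constant `K_L`. The maximizer is a fixed point of the exact projected gradient step and projections
do not expand distances, so one step shrinks the distance to the maximizer by a factor about `1 -
β_k K_L`, up to `β_k` times the error of the direction (`Model.norm_nextLam_sub_le`). That error is
the tracking error plus the deviation of the sample average of `h` from `∇L`.

Sampling error. The outer samples are drawn once and `λ_k` depends on them, so the deviation has to
be controlled uniformly over `Λ`, with mean of order `M^{-1/2}`. This is
`exists_uniform_deviation_bound`: chaining along dyadic nets, where the maximum over each finite set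
of links is replaced by log-sum-exp. That argument asks only for square-integrable envelopes.

Rates. The comparison works when the target rate decays more slowly than the recursion contracts.
For `b = 1` the condition `1 - a < β₀ K_L` guarantees this for `β_k / α_k`; if `√(α_k / N)` decays
too fast for the recursion, it is itself dominated by `β_k / α_k` (`StepSizes.exists_slow_bound`).
-/

theorem exp_le_add_exp_sq (x : ℝ) : Real.exp x ≤ x + Real.exp (x ^ 2) := by
  have h2 := Real.add_one_le_exp (x ^ 2)
  rcases le_or_gt |x| 1 with h | h
  · have h1 := (abs_le.1 (Real.abs_exp_sub_one_sub_id_le h)).2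
    linarith
  · rcases lt_abs.1 h with h | h
    · have : Real.exp x ≤ Real.exp (x ^ 2) := Real.exp_le_exp.2 (by nlinarith)
      linarith
    · have : Real.exp x ≤ 1 := Real.exp_le_one_iff.2 (by linarith)
      nlinarith

/-- Log-sum-exp is a smooth maximum whose gradient at `a` is the vector of softmax weights. Centring
`y` at its softmax mean `m` kills the linear term of `exp x ≤ x + exp (x ^ 2)`, and `|y c - m| ≤ 2
B` leaves the remainder `4 B ^ 2`. -/
theorem log_sum_exp_add_le {J : Type*} [Fintype J] [Nonempty J] (a y : J → ℝ) {B : ℝ}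
    (hy : ∀ c, |y c| ≤ B) :
    Real.log (∑ c, Real.exp (a c + y c)) ≤ Real.log (∑ c, Real.exp (a c)) +
      ∑ c, Real.exp (a c) / (∑ c', Real.exp (a c')) * y c + 4 * B ^ 2 := by
  set S := ∑ c, Real.exp (a c) with hS
  have hSpos : 0 < S := Finset.sum_pos (fun c _ => Real.exp_pos _) Finset.univ_nonempty
  have hw : ∑ c, Real.exp (a c) / S = 1 := by
    rw [← Finset.sum_div, div_self hSpos.ne']
  have hw0 : ∀ c, 0 ≤ Real.exp (a c) / S := fun c => by positivity
  set m := ∑ c, Real.exp (a c) / S * y c with hm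
  have hmB : |m| ≤ B := by
    calc |m| ≤ ∑ c, |Real.exp (a c) / S * y c| := Finset.abs_sum_le_sum_abs _ _
      _ ≤ ∑ c, Real.exp (a c) / S * B := Finset.sum_le_sum fun c _ => by
          rw [abs_mul, abs_of_nonneg (hw0 c)]
          exact mul_le_mul_of_nonneg_left (hy c) (hw0 c)
      _ = B := by rw [← Finset.sum_mul, hw, one_mul]
  have key : ∑ c, Real.exp (a c) / S * Real.exp (y c - m) ≤ Real.exp (4 * B ^ 2) := by
    calc ∑ c, Real.exp (a c) / S * Real.exp (y c - m)
        ≤ ∑ c, Real.exp (a c) / S * ((y c - m) + Real.exp (4 * B ^ 2)) := by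
          refine Finset.sum_le_sum fun c _ => mul_le_mul_of_nonneg_left ?_ (hw0 c)
          refine (exp_le_add_exp_sq _).trans ?_
          have h1 : (y c - m) ^ 2 ≤ 4 * B ^ 2 := by
            have := abs_le.1 (hy c)
            have := abs_le.1 hmB
            nlinarith
          linarith [Real.exp_le_exp.2 h1]
      _ = Real.exp (4 * B ^ 2) := by
          simp only [mul_add, mul_sub, Finset.sum_add_distrib, Finset.sum_sub_distrib,
            ← Finset.sum_mul, hw, ← hm]
          ring
  have hsplit : ∑ c, Real.exp (a c + y c) =
      S * (Real.exp m * ∑ c, Real.exp (a c) / S * Real.exp (y c - m)) := by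
    rw [Finset.mul_sum, Finset.mul_sum]
    refine Finset.sum_congr rfl fun c _ => ?_
    rw [Real.exp_add, Real.exp_sub]
    field_simp
  have hpos : 0 < ∑ c, Real.exp (a c) / S * Real.exp (y c - m) :=
    Finset.sum_pos (fun c _ => by positivity) Finset.univ_nonempty
  rw [hsplit, Real.log_mul hSpos.ne' (by positivity), Real.log_mul (by positivity) hpos.ne',
    Real.log_exp]
  have := Real.log_le_log hpos key
  rw [Real.log_exp] at this
  linarith

theorem le_log_sum_exp {J : Type*} [Fintype J] (a : J → ℝ) (c : J) :
    a c ≤ Real.log (∑ c, Real.exp (a c)) := by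
  rw [Real.le_log_iff_exp_le (Finset.sum_pos (fun c _ => Real.exp_pos _) ⟨c, Finset.mem_univ c⟩)]
  exact Finset.single_le_sum (f := fun c => Real.exp (a c)) (fun _ _ => (Real.exp_pos _).le)
    (Finset.mem_univ c)

/-- A crude domination, needed only for integrability. -/
theorem abs_log_sum_exp_le {J : Type*} [Fintype J] [Nonempty J] (a : J → ℝ) :
    |Real.log (∑ c, Real.exp (a c))| ≤ Real.log (Fintype.card J) + ∑ c, |a c| := by
  have hcard : (0 : ℝ) < Fintype.card J := by exact_mod_cast Fintype.card_pos
  have hlog : 0 ≤ Real.log (Fintype.card J) := Real.log_natCast_nonneg _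
  have hle : ∀ c, |a c| ≤ ∑ c, |a c| := fun c =>
    Finset.single_le_sum (f := fun c => |a c|) (fun _ _ => abs_nonneg _) (Finset.mem_univ c)
  rw [abs_le]
  constructor
  · obtain ⟨c⟩ := ‹Nonempty J›
    have := le_log_sum_exp a c
    linarith [hle c, neg_abs_le (a c)]
  · rw [← Real.log_exp (∑ c, |a c|), ← Real.log_mul hcard.ne' (Real.exp_pos _).ne']
    refine Real.log_le_log (Finset.sum_pos (fun c _ => Real.exp_pos _) Finset.univ_nonempty) ?_
    calc ∑ c, Real.exp (a c) ≤ ∑ _c : J, Real.exp (∑ c, |a c|) :=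
          Finset.sum_le_sum fun c _ => Real.exp_le_exp.2 ((le_abs_self _).trans (hle c))
      _ = _ := by simp

/-- The summands are inserted one at a time. The first-order term of an insertion weights the
centred `X j` by softmax weights of the earlier sum, which is independent of it, so its mean
vanishes and only `4 E (b j)²` is paid. The pointwise inequality is used with `B = b j ω` for each
`ω`; hence second moments of the envelopes suffice and no exponential moment is needed. -/
theorem integral_log_sum_exp_le {Ω ι J : Type*} [MeasurableSpace Ω] {P : Measure Ω}
    [IsProbabilityMeasure P] [Fintype J] [Nonempty J] {X : ι → Ω → J → ℝ} {b : ι → Ω → ℝ}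
    (hX : ∀ i, Measurable (X i)) (hb : ∀ i, Integrable (fun ω => b i ω ^ 2) P)
    (hXb : ∀ i, ∀ᵐ ω ∂P, ∀ c, |X i ω c| ≤ b i ω)
    (hmean : ∀ i c, ∫ ω, X i ω c ∂P = 0) (hind : iIndepFun X P) (s : Finset ι) :
    Integrable (fun ω => Real.log (∑ c, Real.exp (∑ i ∈ s, X i ω c))) P ∧
    ∫ ω, Real.log (∑ c, Real.exp (∑ i ∈ s, X i ω c)) ∂P ≤
      Real.log (Fintype.card J) + 4 * ∑ i ∈ s, ∫ ω, b i ω ^ 2 ∂P := by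
  classical
  have hXc : ∀ i c, Measurable fun ω => X i ω c := fun i c => (measurable_pi_apply c).comp (hX i)
  have hXint : ∀ i c, Integrable (fun ω => X i ω c) P := by
    intro i c
    refine MemLp.integrable one_le_two ((memLp_two_iff_integrable_sq
      (hXc i c).aestronglyMeasurable).2 ?_)
    refine (hb i).mono' ((hXc i c).pow_const 2).aestronglyMeasurable ?_
    filter_upwards [hXb i] with ω h
    rw [Real.norm_eq_abs, abs_of_nonneg (sq_nonneg _), ← sq_abs]
    exact pow_le_pow_left₀ (abs_nonneg _) (h c) 2
  have hSmeas : ∀ (s : Finset ι) c, Measurable fun ω => ∑ i ∈ s, X i ω c := fun s c =>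
    Finset.measurable_sum s fun i _ => hXc i c
  have hLint : ∀ s : Finset ι,
      Integrable (fun ω => Real.log (∑ c, Real.exp (∑ i ∈ s, X i ω c))) P := by
    intro s
    have hdom : Integrable (fun ω => Real.log (Fintype.card J) + ∑ c, |∑ i ∈ s, X i ω c|) P :=
      (integrable_const _).add (integrable_finsetSum _ fun c _ =>
        (integrable_finsetSum _ fun i _ => hXint i c).abs)
    refine hdom.mono' ?_ (Filter.Eventually.of_forall fun ω => abs_log_sum_exp_le _)
    exact (Real.measurable_log.comp (Finset.measurable_sum _ fun c _ =>
      Real.measurable_exp.comp (hSmeas s c))).aestronglyMeasurable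
  refine ⟨hLint s, ?_⟩
  induction s using Finset.induction_on with
  | empty => simp
  | insert j s hj ih =>
    let w : J → (J → ℝ) → ℝ := fun c v => Real.exp (v c) / ∑ c', Real.exp (v c')
    have hw : ∀ c, Measurable (w c) := fun c => by fun_prop
    have hw1 : ∀ c v, |w c v| ≤ 1 := by
      intro c v
      have : 0 < ∑ c', Real.exp (v c') :=
        Finset.sum_pos (fun c _ => Real.exp_pos _) Finset.univ_nonempty
      rw [abs_of_nonneg (by positivity), div_le_one this]
      exact Finset.single_le_sum (f := fun c => Real.exp (v c)) (fun _ _ => (Real.exp_pos _).le)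
        (Finset.mem_univ c)
    have hS : Measurable (∑ i ∈ s, X i) := by
      rw [show (∑ i ∈ s, X i) = fun ω => ∑ i ∈ s, X i ω from by ext; simp]
      exact Finset.measurable_sum s fun i _ => hX i
    have hcross : ∀ c, Integrable (fun ω => w c (∑ i ∈ s, X i ω) * X j ω c) P ∧
        ∫ ω, w c (∑ i ∈ s, X i ω) * X j ω c ∂P = 0 := by
      intro c
      have hI : IndepFun (fun ω => w c ((∑ i ∈ s, X i) ω)) (fun ω => X j ω c) P :=
        (hind.indepFun_finsetSum_of_notMem hX hj).comp (hw c) (measurable_pi_apply c)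
      simp only [Finset.sum_apply] at hI
      constructor
      · refine (hXint j c).bdd_mul (c := 1) ?_ (Filter.Eventually.of_forall fun ω => ?_)
        · have := ((hw c).comp hS).aestronglyMeasurable (μ := P)
          simpa [Function.comp_def, Finset.sum_apply] using this
        · simpa using hw1 c _
      · have := hI.integral_fun_mul_eq_mul_integral (by
          have := ((hw c).comp hS).aestronglyMeasurable (μ := P)
          simpa [Function.comp_def, Finset.sum_apply] using this) (hXint j c).aestronglyMeasurable
        rw [this, hmean, mul_zero]
    have hstep : ∀ᵐ ω ∂P, Real.log (∑ c, Real.exp (∑ i ∈ insert j s, X i ω c)) ≤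
        Real.log (∑ c, Real.exp (∑ i ∈ s, X i ω c)) +
          ∑ c, w c (∑ i ∈ s, X i ω) * X j ω c + 4 * b j ω ^ 2 := by
      filter_upwards [hXb j] with ω h
      have := log_sum_exp_add_le (fun c => ∑ i ∈ s, X i ω c) (X j ω) h
      simp only [Finset.sum_insert hj, w, Finset.sum_apply]
      simpa only [add_comm (X j ω _)] using this
    have hsumint : Integrable (fun ω => ∑ c, w c (∑ i ∈ s, X i ω) * X j ω c) P :=
      integrable_finsetSum _ fun c _ => (hcross c).1
    refine (integral_mono_ae (hLint _) (((hLint s).add hsumint).add ((hb j).const_mul 4))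
      hstep).trans ?_
    rw [integral_add' ((hLint s).add hsumint) ((hb j).const_mul 4), integral_add' (hLint s) hsumint,
      integral_finsetSum _ fun c _ => (hcross c).1, integral_const_mul, Finset.sum_insert hj]
    simp only [(hcross _).2, Finset.sum_const_zero]
    linarith

/-- Doubling the index set by signs turns absolute values into a plain maximum, and the scale `r = q
/ √M` makes the sum of the squared envelopes `q² ∫ b²`. The free parameter `q` balances the entropy
term against the variance term; in the chaining it grows with the level. The explicit majorant `V`
avoids any question about the measurability of a supremum. -/
theorem exists_max_abs_average_le {Ω U J : Type*} [MeasurableSpace Ω] [MeasurableSpace U]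
    {P : Measure Ω} [IsProbabilityMeasure P] {μ : Measure U} [Fintype J] [Nonempty J] {M : ℕ}
    (hM : 1 ≤ M) {u : Fin M → Ω → U} (hu : ∀ m, Measurable (u m)) (hind : iIndepFun u P)
    (hlaw : ∀ m, P.map (u m) = μ) {φ : U → J → ℝ} {b : U → ℝ} (hφ : Measurable φ)
    (hb : Integrable (fun v => b v ^ 2) μ) (hφb : ∀ᵐ v ∂μ, ∀ c, |φ v c| ≤ b v)
    (hmean : ∀ c, ∫ v, φ v c ∂μ = 0) {q : ℝ} (hq : 0 < q) :
    ∃ V : Ω → ENNReal, AEMeasurable V P ∧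
      (∀ ω c, ENNReal.ofReal |(M : ℝ)⁻¹ * ∑ m, φ (u m ω) c| ≤ V ω) ∧
      ∫⁻ ω, V ω ∂P ≤ ENNReal.ofReal
        ((Real.log (2 * Fintype.card J) / q + 4 * q * ∫ v, b v ^ 2 ∂μ) / Real.sqrt M) := by
  have hM0 : (0 : ℝ) < M := by exact_mod_cast hM
  have hsM : 0 < Real.sqrt M := Real.sqrt_pos.2 hM0
  have hsq : Real.sqrt M ^ 2 = M := Real.sq_sqrt hM0.le
  let sg : Bool → ℝ := fun σ => if σ then 1 else -1
  have hsg : ∀ σ, |sg σ| = 1 := by intro σ; cases σ <;> simp [sg]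
  let r := q / Real.sqrt M
  have hr : 0 < r := by positivity
  let ψ : U → J × Bool → ℝ := fun v c => sg c.2 * (r * φ v c.1)
  have hφc : ∀ c, Measurable fun v => φ v c := fun c => (measurable_pi_apply c).comp hφ
  have hψ : Measurable ψ := measurable_pi_lambda _ fun c => ((hφc c.1).const_mul _).const_mul _
  have hmp : ∀ m, MeasurePreserving (u m) P μ := fun m => ⟨hu m, hlaw m⟩
  have hbsq : Integrable (fun v => (r * b v) ^ 2) μ := by
    simp_rw [mul_pow]; exact hb.const_mul _
  obtain ⟨hint, hle⟩ := integral_log_sum_exp_le (P := P) (X := fun m ω => ψ (u m ω))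
    (b := fun m ω => r * b (u m ω)) (fun m => hψ.comp (hu m))
    (fun m => (hmp m).integrable_comp_of_integrable hbsq)
    (fun m => by
      filter_upwards [(hmp m).quasiMeasurePreserving.ae hφb] with ω h c
      simp only [ψ, abs_mul, hsg, one_mul, abs_of_pos hr]
      exact mul_le_mul_of_nonneg_left (h c.1) hr.le)
    (fun m c => by
      have h1 : ∫ v, ψ v c ∂(P.map (u m)) = ∫ ω, ψ (u m ω) c ∂P :=
        integral_map (hu m).aemeasurable
          ((measurable_pi_apply c).comp hψ).aestronglyMeasurable
      rw [← h1, hlaw m]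
      simp only [ψ, integral_const_mul, hmean, mul_zero])
    (hind.comp (fun _ => ψ) fun _ => hψ) Finset.univ
  set F : Ω → ℝ := fun ω => Real.log (∑ c, Real.exp (∑ m, ψ (u m ω) c)) with hF
  have hsumψ : ∀ ω c, ∑ m, ψ (u m ω) c = sg c.2 * (r * ∑ m, φ (u m ω) c.1) := by
    intro ω c; simp only [ψ, Finset.mul_sum]
  have habs : ∀ ω c, r * |∑ m, φ (u m ω) c| ≤ F ω := by
    intro ω c
    have h1 := le_log_sum_exp (fun c => ∑ m, ψ (u m ω) c) (c, true)
    have h2 := le_log_sum_exp (fun c => ∑ m, ψ (u m ω) c) (c, false)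
    simp only [hsumψ, sg] at h1 h2
    rw [← abs_of_pos hr, ← abs_mul]
    refine abs_le'.2 ⟨?_, ?_⟩
    · simpa [hF, hsumψ, sg] using h1
    · simpa [hF, hsumψ, sg] using h2
  have hF0 : ∀ ω, 0 ≤ F ω := fun ω => by
    obtain ⟨c⟩ := ‹Nonempty J›
    exact (by positivity : (0 : ℝ) ≤ r * |∑ m, φ (u m ω) c|).trans (habs ω c)
  refine ⟨fun ω => ENNReal.ofReal ((q * Real.sqrt M)⁻¹ * F ω),
    (hint.aemeasurable.const_mul _).ennreal_ofReal, fun ω c => ENNReal.ofReal_le_ofReal ?_, ?_⟩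
  · rw [abs_mul, abs_of_pos (inv_pos.2 hM0)]
    calc (M : ℝ)⁻¹ * |∑ m, φ (u m ω) c|
        = (q * Real.sqrt M)⁻¹ * (r * |∑ m, φ (u m ω) c|) := by
          have h1 : (q * Real.sqrt M)⁻¹ * r = (Real.sqrt M ^ 2)⁻¹ := by
            simp only [r]; field_simp
          rw [← mul_assoc, h1, hsq]
      _ ≤ _ := mul_le_mul_of_nonneg_left (habs ω c) (by positivity)
  · rw [← ofReal_integral_eq_lintegral_ofReal (hint.const_mul _)
      (Filter.Eventually.of_forall fun ω => mul_nonneg (by positivity) (hF0 ω)),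
      integral_const_mul]
    refine ENNReal.ofReal_le_ofReal ?_
    have hbi : ∀ m, ∫ ω, (r * b (u m ω)) ^ 2 ∂P = r ^ 2 * ∫ v, b v ^ 2 ∂μ := by
      intro m
      have h1 : ∫ v, (r * b v) ^ 2 ∂(P.map (u m)) = ∫ ω, (r * b (u m ω)) ^ 2 ∂P :=
        integral_map (hu m).aemeasurable (by rw [hlaw m]; exact hbsq.aestronglyMeasurable)
      rw [← h1, hlaw m]
      simp_rw [mul_pow]
      rw [integral_const_mul]
    simp only [hbi, Finset.sum_const, Finset.card_univ, Fintype.card_fin, nsmul_eq_mul,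
      Fintype.card_prod, Fintype.card_bool, Nat.cast_mul, Nat.cast_ofNat] at hle
    calc (q * Real.sqrt M)⁻¹ * ∫ ω, F ω ∂P
        ≤ (q * Real.sqrt M)⁻¹ * (Real.log (Fintype.card J * 2) +
            4 * (M * (r ^ 2 * ∫ v, b v ^ 2 ∂μ))) :=
          mul_le_mul_of_nonneg_left hle (by positivity)
      _ = _ := by
          rw [mul_comm (Fintype.card J : ℝ) 2]
          nth_rewrite 2 [← hsq]
          simp only [r]; field_simp

/-! ### Nets and chaining -/

/-- A cover of the unit ball by `A` balls of half the radius, rescaled and iterated, multiplies the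
number of points by `A` at each halving. The points are finally moved into `S`, the only place where
the random functions are controlled; this doubles the radius. -/
theorem exists_finset_nets {F : Type*} [NormedAddCommGroup F] [NormedSpace ℝ F]
    [FiniteDimensional ℝ F] {S : Set F} (hS : Bornology.IsBounded S) :
    ∃ A : ℕ, 1 ≤ A ∧ ∃ ρ : ℝ, 0 < ρ ∧ ∃ s : ℕ → Finset F, ∀ j, (s j : Set F) ⊆ S ∧
      (s j).card ≤ A ^ j ∧ ∀ x ∈ S, ∃ p ∈ s j, ‖x - p‖ ≤ ρ * (1 / 2) ^ j := by
  classical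
  obtain ⟨r, hr0, hr⟩ := hS.subset_closedBall_lt 0 (0 : F)
  obtain ⟨t, -, ht, htc⟩ := (isCompact_closedBall (0 : F) 1).finite_cover_balls
    (e := (1 / 2 : ℝ)) (by norm_num)
  lift t to Finset F using ht
  have h1 : ∀ y : F, ‖y‖ ≤ 1 → ∃ c ∈ t, ‖y - c‖ ≤ 1 / 2 := by
    intro y hy
    have := htc (show y ∈ Metric.closedBall (0 : F) 1 by simpa using hy)
    simp only [Set.mem_iUnion, Metric.mem_ball, dist_eq_norm] at this
    obtain ⟨c, hc, h⟩ := this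
    exact ⟨c, hc, h.le⟩
  have hT : ∀ j : ℕ, ∃ T : Finset F, T.card ≤ t.card ^ j ∧
      ∀ x ∈ S, ∃ p ∈ T, ‖x - p‖ ≤ r * (1 / 2) ^ j := by
    intro j
    induction j with
    | zero => exact ⟨{0}, by simp, fun x hx => ⟨0, by simp, by simpa using hr hx⟩⟩
    | succ j ih =>
      obtain ⟨T, hTc, hTn⟩ := ih
      have hpos : 0 < r * (1 / 2) ^ j := by positivity
      refine ⟨(T ×ˢ t).image fun z => z.1 + (r * (1 / 2) ^ j) • z.2, ?_, fun x hx => ?_⟩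
      · refine Finset.card_image_le.trans ?_
        rw [Finset.card_product, pow_succ]
        exact Nat.mul_le_mul_right _ hTc
      · obtain ⟨p, hp, hxp⟩ := hTn x hx
        obtain ⟨c, hc, h⟩ := h1 ((r * (1 / 2) ^ j)⁻¹ • (x - p)) (by
          rw [norm_smul, norm_inv, Real.norm_of_nonneg hpos.le, inv_mul_le_iff₀ hpos]
          simpa using hxp)
        refine ⟨_, Finset.mem_image_of_mem _ (Finset.mk_mem_product hp hc), ?_⟩
        have : x - (p + (r * (1 / 2) ^ j) • c) =
            (r * (1 / 2) ^ j) • ((r * (1 / 2) ^ j)⁻¹ • (x - p) - c) := by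
          rw [smul_sub, smul_smul, mul_inv_cancel₀ hpos.ne', one_smul]; abel
        simp only
        rw [this, norm_smul, Real.norm_of_nonneg hpos.le, pow_succ, ← mul_assoc]
        exact mul_le_mul_of_nonneg_left h hpos.le
  choose T hTc hTn using hT
  have htpos : 1 ≤ t.card := by
    obtain ⟨c, hc, -⟩ := h1 0 (by simp)
    exact Finset.card_pos.2 ⟨c, hc⟩
  let near : ℕ → F → Prop := fun j p => ∃ x ∈ S, ‖x - p‖ ≤ r * (1 / 2) ^ j
  let pick : ℕ → F → F := fun j p => if h : near j p then h.choose else 0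
  refine ⟨t.card, htpos, 2 * r, by positivity,
    fun j => ((T j).filter (near j)).image (pick j), fun j => ⟨?_, ?_, ?_⟩⟩
  · intro y hy
    obtain ⟨p, hp, rfl⟩ := Finset.mem_image.1 (Finset.mem_coe.1 hy)
    have hn := (Finset.mem_filter.1 hp).2
    simp only [pick, dif_pos hn]
    exact hn.choose_spec.1
  · exact Finset.card_image_le.trans ((Finset.card_filter_le _ _).trans (hTc j))
  · intro x hx
    obtain ⟨p, hp, hxp⟩ := hTn j x hx
    have hn : near j p := ⟨x, hx, hxp⟩
    refine ⟨pick j p, Finset.mem_image_of_mem _ (Finset.mem_filter.2 ⟨hp, hn⟩), ?_⟩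
    have h2 : ‖pick j p - p‖ ≤ r * (1 / 2) ^ j := by
      simp only [pick, dif_pos hn]
      exact hn.choose_spec.2
    calc ‖x - pick j p‖ = ‖(x - p) - (pick j p - p)‖ := by congr 1; abel
      _ ≤ ‖x - p‖ + ‖pick j p - p‖ := norm_sub_le _ _
      _ ≤ 2 * r * (1 / 2) ^ j := by linarith


theorem summable_chaining (a c : ℝ) :
    Summable fun j : ℕ => (a * (2 * j + 4) + c) * (1 / 2 : ℝ) ^ j := by
  have h1 : Summable fun j : ℕ => (j : ℝ) ^ 1 * (1 / 2 : ℝ) ^ j :=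
    summable_pow_mul_geometric_of_norm_lt_one 1 (by norm_num)
  have h2 : Summable fun j : ℕ => (1 / 2 : ℝ) ^ j :=
    summable_geometric_of_lt_one (by norm_num) (by norm_num)
  refine ((h1.mul_left (2 * a)).add (h2.mul_left (4 * a + c))).congr fun j => ?_
  ring

/-- The uniform deviation of the average of `M` i.i.d. copies of a random Lipschitz function on a
bounded subset of a finite-dimensional space is of order `M^{-1/2}` in mean. -/
theorem exists_uniform_deviation_bound.{v} {U F : Type*} [MeasurableSpace U] {μ : Measure U}
    [IsProbabilityMeasure μ] [NormedAddCommGroup F] [NormedSpace ℝ F] [FiniteDimensional ℝ F]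
    {S : Set F} (hS : Bornology.IsBounded S) {g : U → F → ℝ} {lip b₀ : U → ℝ}
    (hg : ∀ x ∈ S, Measurable fun v => g v x)
    (hlipm : Measurable lip) (hlip2 : Integrable (fun v => lip v ^ 2) μ)
    (hb2 : Integrable (fun v => b₀ v ^ 2) μ)
    (hlip : ∀ᵐ v ∂μ, ∀ x ∈ S, ∀ y ∈ S, |g v x - g v y| ≤ lip v * ‖x - y‖)
    (hbd : ∀ᵐ v ∂μ, ∀ x ∈ S, |g v x| ≤ b₀ v) :
    ∃ C : ℝ, 0 ≤ C ∧ ∀ (Ω : Type v) [MeasurableSpace Ω] (P : Measure Ω) [IsProbabilityMeasure P]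
      (M : ℕ) (u : Fin M → Ω → U), 1 ≤ M → (∀ m, Measurable (u m)) → iIndepFun u P →
      (∀ m, P.map (u m) = μ) → ∃ W : Ω → ENNReal, AEMeasurable W P ∧
        (∀ᵐ ω ∂P, ∀ x ∈ S,
          ENNReal.ofReal |(M : ℝ)⁻¹ * ∑ m, g (u m ω) x - ∫ v, g v x ∂μ| ≤ W ω) ∧
        ∫⁻ ω, W ω ∂P ≤ ENNReal.ofReal (C / Real.sqrt M) := by
  classical
  rcases S.eq_empty_or_nonempty with rfl | hSne
  · exact ⟨0, le_rfl, fun Ω _ P _ M u _ _ _ _ => ⟨0, aemeasurable_const, by simp, by simp⟩⟩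
  obtain ⟨A, hA, ρ, hρ, s, hs⟩ := exists_finset_nets hS
  have hsne : ∀ j, Nonempty (s j) := fun j => by
    obtain ⟨x, hx⟩ := hSne
    obtain ⟨p, hp, -⟩ := (hs j).2.2 x hx
    exact ⟨⟨p, hp⟩⟩
  have hgint : ∀ x ∈ S, Integrable (fun v => g v x) μ := by
    intro x hx
    refine MemLp.integrable one_le_two ((memLp_two_iff_integrable_sq
      (hg x hx).aestronglyMeasurable).2 ?_)
    refine hb2.mono' ((hg x hx).pow_const 2).aestronglyMeasurable ?_
    filter_upwards [hbd] with v h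
    rw [Real.norm_eq_abs, abs_of_nonneg (sq_nonneg _), ← sq_abs]
    exact pow_le_pow_left₀ (abs_nonneg _) (h x hx) 2
  have hb1 : ∀ {c : U → ℝ}, Integrable (fun v => c v ^ 2) μ → ∀ k : ℝ,
      Integrable (fun v => 2 * c v ^ 2 + 2 * k ^ 2) μ := fun h k =>
    (h.const_mul 2).add (integrable_const _)
  have hlipint : Integrable lip μ := MemLp.integrable one_le_two
    ((memLp_two_iff_integrable_sq hlipm.aestronglyMeasurable).2 hlip2)
  let G : U → F → ℝ := fun v x => g v x - ∫ v, g v x ∂μ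
  have hGm : ∀ x ∈ S, Measurable fun v => G v x := fun x hx => (hg x hx).sub_const _
  have hGint : ∀ x ∈ S, Integrable (fun v => G v x) μ := fun x hx =>
    (hgint x hx).sub (integrable_const _)
  have hG0 : ∀ x ∈ S, ∫ v, G v x ∂μ = 0 := fun x hx => by
    simp only [G]
    rw [integral_sub (hgint x hx) (integrable_const _)]
    simp
  let Lm := ∫ v, lip v ∂μ
  have hEg : ∀ x ∈ S, ∀ y ∈ S, |∫ v, g v x ∂μ - ∫ v, g v y ∂μ| ≤ Lm * ‖x - y‖ := by
    intro x hx y hy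
    rw [← integral_sub (hgint x hx) (hgint y hy), ← integral_mul_const, ← Real.norm_eq_abs]
    refine norm_integral_le_of_norm_le (hlipint.mul_const _) ?_
    filter_upwards [hlip] with v h using h x hx y hy
  let bL : U → ℝ := fun v => lip v + Lm
  have hGlip : ∀ᵐ v ∂μ, ∀ x ∈ S, ∀ y ∈ S, |G v x - G v y| ≤ bL v * ‖x - y‖ := by
    filter_upwards [hlip] with v h x hx y hy
    have h1 := h x hx y hy
    have h2 := hEg x hx y hy
    calc |G v x - G v y|
        = |(g v x - g v y) - (∫ v, g v x ∂μ - ∫ v, g v y ∂μ)| := by simp only [G]; congr 1; ring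
      _ ≤ _ := abs_sub _ _
      _ ≤ bL v * ‖x - y‖ := by simp only [bL]; linarith
  have hbL2 : Integrable (fun v => bL v ^ 2) μ :=
    (hlip2.add (hlipint.const_mul (2 * Lm))).add (integrable_const (Lm ^ 2)) |>.congr
      (Filter.Eventually.of_forall fun v => by simp only [bL, Pi.add_apply]; ring)
  let B2 := ∫ v, bL v ^ 2 ∂μ
  have hB2 : 0 ≤ B2 := integral_nonneg fun v => sq_nonneg _
  -- the base level
  let φ₀ : U → s 0 → ℝ := fun v p => G v p
  -- The base net is finite and fixed, so the sum of the absolute values is a good enough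
  -- square-integrable envelope.
  let b₁ : U → ℝ := fun v => ∑ p : s 0, |G v p|
  have hmem : ∀ {j} (p : s j), (p : F) ∈ S := fun {j} p => (hs j).1 (Finset.mem_coe.2 p.2)
  have hGsq : ∀ x ∈ S, Integrable (fun v => G v x ^ 2) μ := by
    intro x hx
    refine (hb1 hb2 (∫ v, g v x ∂μ)).mono' ((hGm x hx).pow_const 2).aestronglyMeasurable ?_
    filter_upwards [hbd] with v h
    have h1 := abs_le.1 (h x hx)
    rw [Real.norm_eq_abs, abs_of_nonneg (sq_nonneg _)]
    simp only [G]
    nlinarith [sq_nonneg (g v x + ∫ v, g v x ∂μ)]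
  have hb₁ : Integrable (fun v => b₁ v ^ 2) μ := by
    have hL : MemLp b₁ 2 μ := memLp_finsetSum _ fun p _ => by
      have : MemLp (fun v => G v p) 2 μ := (memLp_two_iff_integrable_sq
        (hGm p (hmem p)).aestronglyMeasurable).2 (hGsq p (hmem p))
      exact this.abs
    exact hL.integrable_sq
  -- the links
  let φ : (j : ℕ) → U → s j × s (j + 1) → ℝ := fun j v c =>
    -- Pairs further apart are never consecutive points of a chain. The value `0` for them keeps the
    -- whole product as index set, while the envelope retains the factor `2^{-j}`.
    if ‖(c.2 : F) - c.1‖ ≤ 2 * ρ * (1 / 2) ^ j then G v c.2 - G v c.1 else 0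
  have hφm : ∀ j, Measurable (φ j) := fun j => measurable_pi_lambda _ fun c => by
    simp only [φ]
    split_ifs
    · exact (hGm _ (hmem _)).sub (hGm _ (hmem _))
    · exact measurable_const
  have hφ0 : ∀ j c, ∫ v, φ j v c ∂μ = 0 := by
    intro j c
    simp only [φ]
    split_ifs
    · rw [integral_sub (hGint _ (hmem _)) (hGint _ (hmem _)), hG0 _ (hmem _), hG0 _ (hmem _),
        sub_zero]
    · simp
  have hφb : ∀ j, ∀ᵐ v ∂μ, ∀ c, |φ j v c| ≤ 2 * ρ * (1 / 2) ^ j * |bL v| := by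
    intro j
    filter_upwards [hGlip] with v h c
    simp only [φ]
    split_ifs with hc
    · refine (h _ (hmem _) _ (hmem _)).trans ?_
      rw [mul_comm]
      exact (mul_le_mul_of_nonneg_left (le_abs_self _) (norm_nonneg _)).trans
        (mul_le_mul_of_nonneg_right hc (abs_nonneg _))
    · simp; positivity
  have hbj : ∀ j : ℕ, ∀ v, (2 * ρ * (1 / 2) ^ j * |bL v|) ^ 2 =
      (2 * ρ * (1 / 2) ^ j) ^ 2 * bL v ^ 2 := fun j v => by rw [mul_pow, sq_abs]
  let c₀ : ℝ := Real.log (2 * Fintype.card (s 0)) / 1 + 4 * 1 * ∫ v, b₁ v ^ 2 ∂μ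
  -- The cost of level `j` for `q = 2 ^ j`: the entropy is linear in `j` and is divided by `2 ^ j`,
  -- and the variance term is `4 · 2^j · (2ρ 2^{-j})² B2 = 16 ρ² B2 2^{-j}`.
  let e : ℕ → ℝ := fun j => (Real.log (2 * A) * (2 * j + 4) + 16 * ρ ^ 2 * B2) * (1 / 2) ^ j
  have hlogA : 0 ≤ Real.log (2 * A) := Real.log_nonneg (by
    have : (1 : ℝ) ≤ A := by exact_mod_cast hA
    linarith)
  have he0 : ∀ j, 0 ≤ e j := fun j => by positivity
  have he : Summable e := summable_chaining _ _
  have hcard : ∀ j, Real.log (2 * (Fintype.card (s j × s (j + 1)) : ℕ)) ≤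
      Real.log (2 * A) * (2 * j + 4) := by
    intro j
    have h1 : Fintype.card (s j × s (j + 1)) ≤ A ^ j * A ^ (j + 1) := by
      rw [Fintype.card_prod, Fintype.card_coe, Fintype.card_coe]
      exact Nat.mul_le_mul (hs j).2.1 (hs (j + 1)).2.1
    have h0 : 0 < Fintype.card (s j × s (j + 1)) := Fintype.card_pos
    have h2 : 2 * Fintype.card (s j × s (j + 1)) ≤ (2 * A) ^ (2 * j + 4) := by
      calc 2 * Fintype.card (s j × s (j + 1)) ≤ 2 ^ (2 * j + 4) * A ^ (2 * j + 4) := by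
            refine Nat.mul_le_mul (Nat.le_self_pow (by omega) 2) (h1.trans ?_)
            rw [← pow_add]
            exact Nat.pow_le_pow_right hA (by omega)
        _ = _ := (mul_pow _ _ _).symm
    calc Real.log (2 * (Fintype.card (s j × s (j + 1)) : ℕ))
        ≤ Real.log ((2 * A : ℝ) ^ (2 * j + 4)) := by
          refine Real.log_le_log (by positivity) ?_
          exact_mod_cast h2
      _ = _ := by rw [Real.log_pow]; push_cast; ring
  refine ⟨|c₀| + ∑' j, e j, add_nonneg (abs_nonneg _) (tsum_nonneg he0), ?_⟩
  intro Ω _ P _ M u hM hu hind hlaw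
  have hM0 : (0 : ℝ) < M := by exact_mod_cast hM
  have hsM : 0 < Real.sqrt M := Real.sqrt_pos.2 hM0
  obtain ⟨V₀, hV₀m, hV₀, hV₀i⟩ := exists_max_abs_average_le hM hu hind hlaw (φ := φ₀) (b := b₁)
    (measurable_pi_lambda _ fun p => hGm p (hmem p)) hb₁
    (Filter.Eventually.of_forall fun v p =>
      Finset.single_le_sum (f := fun p : s 0 => |G v p|) (fun _ _ => abs_nonneg _)
        (Finset.mem_univ p))
    (fun p => hG0 p (hmem p)) one_pos
  have hlev := fun j : ℕ => exists_max_abs_average_le hM hu hind hlaw (φ := φ j)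
    (b := fun v => 2 * ρ * (1 / 2) ^ j * |bL v|) (hφm j)
    (by simp only [hbj]; exact hbL2.const_mul _) (hφb j) (hφ0 j) (q := 2 ^ j) (by positivity)
  choose V hVm hV hVi using hlev
  have hVi' : ∀ j, ∫⁻ ω, V j ω ∂P ≤ ENNReal.ofReal (e j / Real.sqrt M) := by
    intro j
    refine (hVi j).trans (ENNReal.ofReal_le_ofReal ?_)
    refine div_le_div_of_nonneg_right ?_ hsM.le
    simp only [hbj, integral_const_mul]
    have h2 : (1 / 2 : ℝ) ^ j = (2 ^ j)⁻¹ := by rw [one_div, inv_pow]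
    have h3 : (0 : ℝ) < 2 ^ j := by positivity
    calc Real.log (2 * (Fintype.card (s j × s (j + 1)) : ℕ)) / 2 ^ j +
          4 * 2 ^ j * ((2 * ρ * (1 / 2) ^ j) ^ 2 * B2)
        ≤ Real.log (2 * A) * (2 * j + 4) / 2 ^ j +
          4 * 2 ^ j * ((2 * ρ * (1 / 2) ^ j) ^ 2 * B2) := by
          gcongr
          exact hcard j
      _ = e j := by
          simp only [e, h2]
          field_simp
          ring
  refine ⟨fun ω => V₀ ω + ∑' j, V j ω, hV₀m.add (AEMeasurable.tsum hVm), ?_, ?_⟩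
  · have hmp : ∀ m, MeasurePreserving (u m) P μ := fun m => ⟨hu m, hlaw m⟩
    have hall : ∀ᵐ ω ∂P, ∀ m, ∀ x ∈ S, ∀ y ∈ S,
        |G (u m ω) x - G (u m ω) y| ≤ bL (u m ω) * ‖x - y‖ :=
      ae_all_iff.2 fun m => (hmp m).quasiMeasurePreserving.ae hGlip
    filter_upwards [hall] with ω hω x hx
    let Z : F → ℝ := fun y => (M : ℝ)⁻¹ * ∑ m, G (u m ω) y
    have hZ : (M : ℝ)⁻¹ * ∑ m, g (u m ω) x - ∫ v, g v x ∂μ = Z x := by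
      simp only [Z, G, Finset.sum_sub_distrib, Finset.sum_const, Finset.card_univ,
        Fintype.card_fin, nsmul_eq_mul, mul_sub]
      rw [inv_mul_cancel_left₀ hM0.ne']
    rw [hZ]
    have hnet := fun j => (hs j).2.2 x hx
    choose p hp hxp using hnet
    have hpS : ∀ j, p j ∈ S := fun j => (hs j).1 (Finset.mem_coe.2 (hp j))
    have hstep : ∀ n, ENNReal.ofReal |Z (p n)| ≤ V₀ ω + ∑ j ∈ Finset.range n, V j ω := by
      intro n
      induction n with
      | zero =>
        simp only [Finset.range_zero, Finset.sum_empty, add_zero]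
        exact hV₀ ω ⟨p 0, hp 0⟩
      | succ n ih =>
        rw [Finset.sum_range_succ, ← add_assoc]
        have h1 := hV n ω (⟨p n, hp n⟩, ⟨p (n + 1), hp (n + 1)⟩)
        have h2 : ‖p (n + 1) - p n‖ ≤ 2 * ρ * (1 / 2) ^ n := by
          calc ‖p (n + 1) - p n‖ = ‖(x - p n) - (x - p (n + 1))‖ := by congr 1; abel
            _ ≤ ‖x - p n‖ + ‖x - p (n + 1)‖ := norm_sub_le _ _
            _ ≤ ρ * (1 / 2) ^ n + ρ * (1 / 2) ^ (n + 1) := add_le_add (hxp n) (hxp (n + 1))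
            _ ≤ _ := by
              rw [pow_succ]
              have : 0 ≤ ρ * (1 / 2) ^ n := by positivity
              linarith
        simp only [φ, if_pos h2] at h1
        have h3 : (M : ℝ)⁻¹ * ∑ m, (G (u m ω) (p (n + 1)) - G (u m ω) (p n)) =
            Z (p (n + 1)) - Z (p n) := by
          simp only [Z, Finset.sum_sub_distrib, mul_sub]
        rw [h3] at h1
        calc ENNReal.ofReal |Z (p (n + 1))|
            ≤ ENNReal.ofReal (|Z (p n)| + |Z (p (n + 1)) - Z (p n)|) := by
              refine ENNReal.ofReal_le_ofReal ?_
              have := abs_add_le (Z (p n)) (Z (p (n + 1)) - Z (p n))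
              rwa [add_sub_cancel] at this
          _ ≤ _ := by
              rw [ENNReal.ofReal_add (abs_nonneg _) (abs_nonneg _)]
              exact add_le_add ih h1
    have hle : ∀ n, ENNReal.ofReal |Z (p n)| ≤ V₀ ω + ∑' j, V j ω := fun n =>
      (hstep n).trans (add_le_add le_rfl (ENNReal.sum_le_tsum _))
    -- The chain reaches `x` only in the limit. For fixed `ω` the centred average is Lipschitz with
    -- this random constant, which is enough: no bound on `K` is needed.
    let K := (M : ℝ)⁻¹ * ∑ m, bL (u m ω)
    have hZlip : ∀ n, |Z (p n) - Z x| ≤ |K| * (ρ * (1 / 2) ^ n) := by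
      intro n
      have h1 : Z (p n) - Z x = (M : ℝ)⁻¹ * ∑ m, (G (u m ω) (p n) - G (u m ω) x) := by
        simp only [Z, Finset.sum_sub_distrib, mul_sub]
      calc |Z (p n) - Z x| ≤ (M : ℝ)⁻¹ * ∑ m, bL (u m ω) * ‖p n - x‖ := by
            rw [h1, abs_mul, abs_of_pos (inv_pos.2 hM0)]
            refine mul_le_mul_of_nonneg_left ((Finset.abs_sum_le_sum_abs _ _).trans
              (Finset.sum_le_sum fun m _ => hω m _ (hpS n) _ hx)) (inv_pos.2 hM0).le
        _ = K * ‖p n - x‖ := by rw [← Finset.sum_mul]; simp only [K]; ring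
        _ ≤ |K| * (ρ * (1 / 2) ^ n) := by
            rw [norm_sub_rev]
            exact mul_le_mul (le_abs_self _) (hxp n) (norm_nonneg _) (abs_nonneg _)
    have hlim : Filter.Tendsto (fun n => Z (p n)) Filter.atTop (nhds (Z x)) := by
      rw [tendsto_iff_dist_tendsto_zero]
      refine squeeze_zero (fun _ => dist_nonneg) (fun n => hZlip n) ?_
      have := (tendsto_pow_atTop_nhds_zero_of_lt_one (r := (1 / 2 : ℝ)) (by norm_num)
        (by norm_num)).const_mul ρ |>.const_mul |K|
      simpa using this
    exact le_of_tendsto (ENNReal.tendsto_ofReal hlim.abs) (Filter.Eventually.of_forall hle)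
  · rw [lintegral_add_left' hV₀m, lintegral_tsum hVm, add_div,
      ENNReal.ofReal_add (by positivity) (div_nonneg (tsum_nonneg he0) hsM.le)]
    refine add_le_add (hV₀i.trans (ENNReal.ofReal_le_ofReal
      (div_le_div_of_nonneg_right (le_abs_self _) hsM.le))) ?_
    rw [← tsum_div_const, ENNReal.ofReal_tsum_of_nonneg (fun j => div_nonneg (he0 j) hsM.le)
      (he.div_const _)]
    exact ENNReal.tsum_le_tsum hVi'


/-! ### The Euclidean projection -/

section Proj

variable {n : ℕ} {S : Set (E n)}

/-- Compactness provides a nearest point, so the choice in the definition of `proj` is a genuine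
one. -/
theorem proj_spec (hS : IsCompact S) (hne : S.Nonempty) (x : E n) :
    proj S x ∈ S ∧ dist x (proj S x) = Metric.infDist x S := by
  obtain ⟨y, hy, h⟩ := hS.exists_infDist_eq_dist hne x
  exact Classical.epsilon_spec (p := fun y => y ∈ S ∧ dist x y = Metric.infDist x S) ⟨y, hy, h.symm⟩

theorem inner_sub_proj_le (hS : IsCompact S) (hne : S.Nonempty) (hconv : Convex ℝ S) (x : E n)
    {w : E n} (hw : w ∈ S) : inner ℝ (x - proj S x) (w - proj S x) ≤ 0 := by
  obtain ⟨h1, h2⟩ := proj_spec hS hne x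
  refine (norm_eq_iInf_iff_real_inner_le_zero hconv h1).1 ?_ w hw
  rw [← dist_eq_norm, h2, Metric.infDist_eq_iInf]
  simp only [dist_eq_norm]

theorem norm_proj_sub_proj_le (hS : IsCompact S) (hne : S.Nonempty) (hconv : Convex ℝ S)
    (x y : E n) : ‖proj S x - proj S y‖ ≤ ‖x - y‖ := by
  have h1 := inner_sub_proj_le hS hne hconv x (proj_spec hS hne y).1
  have h2 := inner_sub_proj_le hS hne hconv y (proj_spec hS hne x).1
  set a := proj S x
  set b := proj S y
  have h3 : ‖a - b‖ ^ 2 ≤ inner ℝ (x - y) (a - b) := by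
    rw [← real_inner_self_eq_norm_sq]
    have e1 : inner ℝ (x - a) (b - a) = -inner ℝ x (a - b) + inner ℝ a (a - b) := by
      rw [← neg_sub a b, inner_neg_right, inner_sub_left]; ring
    rw [e1] at h1
    rw [inner_sub_left] at h2
    rw [inner_sub_left, inner_sub_left]
    linarith
  have h4 := real_inner_le_norm (x - y) (a - b)
  rcases eq_or_lt_of_le (norm_nonneg (a - b)) with h | h
  · rw [← h]; exact norm_nonneg _
  · nlinarith

/-- Adding the obtuse-angle inequalities of two candidates bounds the square of their distance by
`0`. In this form the maximizer is recognised as a fixed point of the projected gradient step. -/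
theorem proj_eq_of_inner_le (hS : IsCompact S) (hconv : Convex ℝ S) {x y : E n} (hy : y ∈ S)
    (h : ∀ w ∈ S, inner ℝ (x - y) (w - y) ≤ 0) : proj S x = y := by
  have hne : S.Nonempty := ⟨y, hy⟩
  have h1 := inner_sub_proj_le hS hne hconv x hy
  have h2 := h _ (proj_spec hS hne x).1
  set a := proj S x
  have h3 : inner ℝ (a - y) (a - y) ≤ 0 := by
    have e1 : inner ℝ (x - a) (y - a) = -inner ℝ x (a - y) + inner ℝ a (a - y) := by
      rw [← neg_sub a y, inner_neg_right, inner_sub_left]; ring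
    rw [e1] at h1
    rw [inner_sub_left] at h2 ⊢
    linarith
  rw [real_inner_self_eq_norm_sq] at h3
  have : ‖a - y‖ = 0 := by nlinarith [norm_nonneg (a - y)]
  exact sub_eq_zero.1 (norm_eq_zero.1 this)

theorem proj_of_mem (hS : IsCompact S) (hconv : Convex ℝ S) {x : E n} (hx : x ∈ S) :
    proj S x = x :=
  proj_eq_of_inner_le hS hconv hx fun w _ => by simp

theorem continuous_proj (hS : IsCompact S) (hne : S.Nonempty) (hconv : Convex ℝ S) :
    Continuous (proj S) :=
  (LipschitzWith.of_dist_le_mul (K := 1) fun x y => by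
    simpa [dist_eq_norm] using norm_proj_sub_proj_le hS hne hconv x y).continuous

end Proj

/-! ### Strong concavity from the Hessian -/

section Hessian

variable {n : ℕ} {S : Set (E n)} {F : E n → ℝ}

/-- The inverse of the Riesz map, as a real-linear map. -/
def rieszInv (n : ℕ) : (E n →L[ℝ] ℝ) →L[ℝ] E n where
  toFun := (InnerProductSpace.toDual ℝ (E n)).symm
  map_add' := map_add _
  map_smul' c x := by simp
  cont := (InnerProductSpace.toDual ℝ (E n)).symm.continuous

theorem inner_gradientWithin (x w : E n) :
    inner ℝ (gradientWithin F S x) w = fderivWithin ℝ F S x w := by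
  rw [gradientWithin, InnerProductSpace.toDual_symm_apply]

theorem inner_gradient (x w : E n) : inner ℝ (gradient F x) w = fderiv ℝ F x w := by
  rw [gradient, InnerProductSpace.toDual_symm_apply]

theorem hasFDerivWithinAt_gradientWithin (hS : UniqueDiffOn ℝ S) (hF : ContDiffOn ℝ 2 F S)
    {x : E n} (hx : x ∈ S) : HasFDerivWithinAt (gradientWithin F S)
      ((rieszInv n).comp (fderivWithin ℝ (fderivWithin ℝ F S) S x)) S x := by
  have h1 : ContDiffOn ℝ 1 (fderivWithin ℝ F S) S := hF.fderivWithin hS (by norm_num)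
  have h2 := ((h1.differentiableOn (by norm_num)) x hx).hasFDerivWithinAt
  exact (rieszInv n).hasFDerivAt.comp_hasFDerivWithinAt x h2

theorem inner_hessianOn (hS : UniqueDiffOn ℝ S) (hF : ContDiffOn ℝ 2 F S)
    {x : E n} (hx : x ∈ S) (v w : E n) :
    inner ℝ (hessianOn S F x v) w = fderivWithin ℝ (fderivWithin ℝ F S) S x v w := by
  rw [hessianOn, (hasFDerivWithinAt_gradientWithin hS hF hx).fderivWithin (hS x hx)]
  exact InnerProductSpace.toDual_symm_apply

/-- For a symmetric operator the supremum of the Rayleigh quotient is an eigenvalue, so a bound on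
the eigenvalues is a bound on the quadratic form. Symmetry of the second derivative extends to
boundary points because a convex set with non-empty interior lies in the closure of that interior.
-/
theorem inner_hessianOn_le (hconv : Convex ℝ S) (hint : (interior S).Nonempty)
    (hF : ContDiffOn ℝ 2 F S) {K : ℝ} {x : E n} (hx : x ∈ S)
    (heig : ∀ μ : ℝ, Module.End.HasEigenvalue (hessianOn S F x : E n →ₗ[ℝ] E n) μ → μ < -K)
    (v : E n) : inner ℝ (hessianOn S F x v) v ≤ -K * ‖v‖ ^ 2 := by
  have hS := uniqueDiffOn_convex hconv hint
  rcases eq_or_ne v 0 with rfl | hv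
  · simp
  have : Nontrivial (E n) := ⟨⟨v, 0, hv⟩⟩
  have hsymm : (hessianOn S F x : E n →ₗ[ℝ] E n).IsSymmetric := by
    intro v w
    rw [ContinuousLinearMap.coe_coe, real_inner_comm (hessianOn S F x w),
      inner_hessianOn hS hF hx, inner_hessianOn hS hF hx]
    refine (hF x hx).isSymmSndFDerivWithinAt (by simp) hS ?_ hx v w
    rw [hconv.closure_interior_eq_closure_of_nonempty_interior hint]
    exact subset_closure hx
  have hlt := heig _ hsymm.hasEigenvalue_iSup_of_finiteDimensional
  set T := (hessianOn S F x : E n →ₗ[ℝ] E n)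
  have hbdd : BddAbove (Set.range fun y : { y : E n // y ≠ 0 } =>
      RCLike.re (inner ℝ (T y) (y : E n)) / ‖(y : E n)‖ ^ 2) := by
    refine ⟨‖hessianOn S F x‖, ?_⟩
    rintro _ ⟨y, rfl⟩
    have hy : 0 < ‖(y : E n)‖ := norm_pos_iff.2 y.2
    simp only [RCLike.re_to_real]
    rw [div_le_iff₀ (by positivity)]
    calc inner ℝ (T y) (y : E n) ≤ ‖T y‖ * ‖(y : E n)‖ := real_inner_le_norm _ _
      _ ≤ (‖hessianOn S F x‖ * ‖(y : E n)‖) * ‖(y : E n)‖ :=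
          mul_le_mul_of_nonneg_right ((hessianOn S F x).le_opNorm _) (norm_nonneg _)
      _ = _ := by ring
  have h1 := (le_ciSup hbdd ⟨v, hv⟩).trans hlt.le
  simp only [RCLike.re_to_real] at h1
  rwa [div_le_iff₀ (by have := norm_pos_iff.2 hv; positivity)] at h1

/-- The mean value inequality along the segment from `y` to `x`, where the derivative of `⟪∇F, v⟫`
is the Hessian form bounded above. -/
theorem inner_gradientWithin_sub_le (hconv : Convex ℝ S) (hint : (interior S).Nonempty)
    (hF : ContDiffOn ℝ 2 F S) {K : ℝ}
    (heig : ∀ x ∈ S, ∀ μ : ℝ,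
      Module.End.HasEigenvalue (hessianOn S F x : E n →ₗ[ℝ] E n) μ → μ < -K)
    {x y : E n} (hx : x ∈ S) (hy : y ∈ S) :
    inner ℝ (gradientWithin F S x - gradientWithin F S y) (x - y) ≤ -K * ‖x - y‖ ^ 2 := by
  have hS := uniqueDiffOn_convex hconv hint
  set v := x - y with hv
  let γ : ℝ → E n := fun t => y + t • v
  have hγS : ∀ t ∈ Set.Icc (0 : ℝ) 1, γ t ∈ S := by
    intro t ht
    have := hconv hy hx (sub_nonneg.2 ht.2) ht.1 (by ring)
    convert this using 1
    simp only [γ, hv, smul_sub, sub_smul, one_smul]; abel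
  let φ : ℝ → ℝ := fun t => inner ℝ (gradientWithin F S (γ t)) v
  have hder : ∀ t ∈ Set.Icc (0 : ℝ) 1, HasDerivWithinAt φ
      (inner ℝ (hessianOn S F (γ t) v) v) (Set.Icc 0 1) t := by
    intro t ht
    have h1 : HasDerivWithinAt γ v (Set.Icc 0 1) t := by
      have : HasDerivAt γ ((1 : ℝ) • v) t := ((hasDerivAt_id t).smul_const v).const_add y
      simpa using this.hasDerivWithinAt
    have h2 : HasFDerivWithinAt (gradientWithin F S) (hessianOn S F (γ t)) S (γ t) :=
      (hasFDerivWithinAt_gradientWithin hS hF (hγS t ht)).differentiableWithinAt.hasFDerivWithinAt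
    have h3 := h2.comp_hasDerivWithinAt t h1 hγS
    have h4 := h3.inner ℝ (hasDerivWithinAt_const t (Set.Icc 0 1) v)
    simp only [inner_zero_right, zero_add] at h4
    exact h4
  have hcont : ContinuousOn φ (Set.Icc 0 1) := fun t ht => (hder t ht).continuousWithinAt
  have hderiv : ∀ t ∈ interior (Set.Icc (0 : ℝ) 1), HasDerivAt φ
      (inner ℝ (hessianOn S F (γ t) v) v) t := fun t ht =>
    (hder t (interior_subset ht)).hasDerivAt (mem_interior_iff_mem_nhds.1 ht)
  have := (convex_Icc (0 : ℝ) 1).image_sub_le_mul_sub_of_deriv_le hcont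
    (fun t ht => (hderiv t ht).differentiableAt.differentiableWithinAt)
    (C := -K * ‖v‖ ^ 2) (fun t ht => by
      rw [(hderiv t ht).deriv]
      exact inner_hessianOn_le hconv hint hF (hγS t (interior_subset ht))
        (heig _ (hγS t (interior_subset ht))) v)
    0 (by simp) 1 (by simp) zero_le_one
  simp only [φ, γ, zero_smul, add_zero, one_smul, sub_zero, mul_one] at this
  rw [inner_sub_left]
  rwa [show y + v = x by rw [hv]; abel] at this

end Hessian

/-! ### The gradient of the ELBO -/

namespace Model

variable {l d n r s T : ℕ} {mdl : Model l d n r s T}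

/-- The parameter enters `log q` twice, through the density and through the sample point. The joint
derivative `Q'` splits accordingly: its part in `θ` is the `C` term inside `h`, and its part in `λ`
is the term left over. -/
theorem gradientWithin_logRatio_comp (hwell : mdl.WellPosed) (hreg : mdl.Regularity) {u : E s}
    {lam : E l} (hlam : lam ∈ mdl.Λ) (hθ : DifferentiableOn ℝ (mdl.θ u) mdl.Λ)
    (hprior : 0 < mdl.prior (mdl.θ u lam) ∧ DifferentiableAt ℝ mdl.prior (mdl.θ u lam))
    (hq : 0 < mdl.q lam (mdl.θ u lam) ∧
      DifferentiableWithinAt ℝ (fun z : E l × E d => mdl.q z.1 z.2) (mdl.Λ ×ˢ Set.univ)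
        (lam, mdl.θ u lam)) :
    gradientWithin (fun v => mdl.logRatio v (mdl.θ u v)) mdl.Λ lam = mdl.h u lam -
      gradientWithin (fun v => Real.log (mdl.q v (mdl.θ u lam))) mdl.Λ lam := by
  have hS := uniqueDiffOn_convex hwell.convex hwell.interior_nonempty lam hlam
  set ϑ := mdl.θ u lam with hϑ
  set θ' := fderivWithin ℝ (mdl.θ u) mdl.Λ lam with hθ'
  have h1 : HasFDerivWithinAt (mdl.θ u) θ' mdl.Λ lam := (hθ lam hlam).hasFDerivWithinAt
  have hp : ∀ t, HasFDerivWithinAt (fun v => Real.log (mdl.p (mdl.Y t) (mdl.θ u v)))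
      (((mdl.p (mdl.Y t) ϑ)⁻¹ • fderiv ℝ (mdl.p (mdl.Y t)) ϑ).comp θ') mdl.Λ lam := by
    intro t
    have h2 : HasFDerivAt (mdl.p (mdl.Y t)) (fderiv ℝ (mdl.p (mdl.Y t)) ϑ) ϑ :=
      ((hreg.p_smooth t).differentiable (by norm_num) ϑ).hasFDerivAt
    exact (h2.log (hreg.p_pos t ϑ).ne').comp_hasFDerivWithinAt lam h1
  have hpr : HasFDerivWithinAt (fun v => Real.log (mdl.prior (mdl.θ u v)))
      ((fderiv ℝ (fun ϑ => Real.log (mdl.prior ϑ)) ϑ).comp θ') mdl.Λ lam := by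
    have h2 : HasFDerivAt (fun ϑ => Real.log (mdl.prior ϑ)) _ ϑ :=
      (hprior.2.log hprior.1.ne').hasFDerivAt
    exact h2.comp_hasFDerivWithinAt lam h1
  obtain ⟨Q', hQ⟩ : ∃ Q', HasFDerivWithinAt (fun z : E l × E d => Real.log (mdl.q z.1 z.2)) Q'
      (mdl.Λ ×ˢ Set.univ) (lam, ϑ) := ⟨_, (hq.2.log hq.1.ne').hasFDerivWithinAt⟩
  have hq1 : HasFDerivWithinAt (fun v => Real.log (mdl.q v (mdl.θ u v)))
      (Q'.comp ((ContinuousLinearMap.id ℝ (E l)).prod θ')) mdl.Λ lam :=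
    hQ.comp (f := fun v => (v, mdl.θ u v)) lam ((hasFDerivWithinAt_id lam mdl.Λ).prodMk h1)
      fun v hv => ⟨hv, trivial⟩
  have hq2 : HasFDerivWithinAt (fun v => Real.log (mdl.q v ϑ))
      (Q'.comp ((ContinuousLinearMap.id ℝ (E l)).prod 0)) mdl.Λ lam :=
    hQ.comp (f := fun v => (v, ϑ)) lam
      ((hasFDerivWithinAt_id lam mdl.Λ).prodMk (hasFDerivWithinAt_const ϑ lam mdl.Λ))
      fun v hv => ⟨hv, trivial⟩
  have hq3 : HasFDerivAt (fun ϑ => Real.log (mdl.q lam ϑ))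
      (Q'.comp ((0 : E d →L[ℝ] E l).prod (ContinuousLinearMap.id ℝ (E d)))) ϑ := by
    rw [← hasFDerivWithinAt_univ]
    exact hQ.comp (f := fun ϑ => (lam, ϑ)) ϑ
      ((hasFDerivWithinAt_const lam ϑ Set.univ).prodMk (hasFDerivWithinAt_id ϑ Set.univ))
      fun v _ => ⟨hlam, trivial⟩
  have hF := ((HasFDerivWithinAt.fun_sum (u := Finset.univ) fun t _ => hp t).add hpr).sub hq1
  refine ext_inner_right ℝ fun w => ?_
  rw [inner_sub_left, inner_gradientWithin, inner_gradientWithin, hq2.fderivWithin hS]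
  have hFd : fderivWithin ℝ (fun v => mdl.logRatio v (mdl.θ u v)) mdl.Λ lam = _ :=
    hF.fderivWithin hS
  rw [hFd, h, A, ContinuousLinearMap.adjoint_inner_left, inner_sub_left, inner_add_left,
    sum_inner, B, C, inner_gradient, inner_gradient, hq3.fderiv]
  simp only [score, inner_smul_left, inner_gradient]
  simp only [← hϑ, ← hθ']
  have hsplit : Q' (w, θ' w) = Q' (w, 0) + Q' (0, θ' w) := by
    rw [← map_add]; simp
  simp [hsplit]
  ring

theorem ae_gradientWithin_logRatio_comp (hwell : mdl.WellPosed) (hreg : mdl.Regularity) :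
    ∀ᵐ u ∂mdl.lawU, ∀ lam ∈ mdl.Λ,
      gradientWithin (fun v => mdl.logRatio v (mdl.θ u v)) mdl.Λ lam = mdl.h u lam -
        gradientWithin (fun v => Real.log (mdl.q v (mdl.θ u lam))) mdl.Λ lam := by
  filter_upwards [hreg.θ_smooth, hwell.prior_pos, hwell.q_pos] with u h1 h2 h3 lam hlam
  exact gradientWithin_logRatio_comp hwell hreg hlam h1 (h2 lam hlam) (h3 lam hlam)

/-- The term left over by the chain rule has mean zero under `q_λ`, and the re-parameterization
carries this over to the law of `u`; thus `h` is an unbiased estimator of the gradient. -/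
theorem integrable_h_and_gradientWithin_elbo (hwell : mdl.WellPosed) (hreg : mdl.Regularity)
    {lam : E l} (hlam : lam ∈ mdl.Λ) : Integrable (fun u => mdl.h u lam) mdl.lawU ∧
      gradientWithin mdl.elbo mdl.Λ lam = ∫ u, mdl.h u lam ∂mdl.lawU := by
  obtain ⟨hi, hgrad⟩ := hwell.interchange lam hlam
  obtain ⟨hqi, hq0⟩ := hwell.q_score_mean lam hlam
  have hθm : Measurable fun u => mdl.θ u lam :=
    hwell.θ_measurable.comp (measurable_id.prodMk measurable_const)
  rw [← hwell.q_density lam hlam] at hqi hq0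
  rw [integral_map hθm.aemeasurable hqi.aestronglyMeasurable] at hq0
  have hqi' := (integrable_map_measure hqi.aestronglyMeasurable hθm.aemeasurable).1 hqi
  have hae : (fun u => mdl.h u lam) =ᵐ[mdl.lawU] fun u =>
      gradientWithin (fun v => mdl.logRatio v (mdl.θ u v)) mdl.Λ lam +
        gradientWithin (fun v => Real.log (mdl.q v (mdl.θ u lam))) mdl.Λ lam := by
    filter_upwards [ae_gradientWithin_logRatio_comp hwell hreg] with u hu
    rw [hu lam hlam]; abel
  refine ⟨(hi.add hqi').congr hae.symm, ?_⟩
  rw [integral_congr_ae hae]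
  refine Eq.trans ?_ (integral_add hi hqi').symm
  simp only [Function.comp_def, hq0, add_zero, hgrad]

/-- A sample average over a single sample is the integrand itself, so the hypothesis for `M = 1`
already speaks about almost every `u`. -/
theorem ae_inner_gradientWithin_logRatio_le (hwell : mdl.WellPosed) (hreg : mdl.Regularity)
    {KL : ℝ} (hconc : mdl.StronglyConcaveSAA KL) :
    ∀ᵐ u ∂mdl.lawU, ∀ x ∈ mdl.Λ, ∀ y ∈ mdl.Λ,
      inner ℝ (gradientWithin (fun v => mdl.logRatio v (mdl.θ u v)) mdl.Λ x -
        gradientWithin (fun v => mdl.logRatio v (mdl.θ u v)) mdl.Λ y) (x - y)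
        ≤ -KL * ‖x - y‖ ^ 2 := by
  have := hwell.p0_prob
  have hmp : MeasurePreserving (MeasurableEquiv.funUnique (Fin 1) (E s)).symm mdl.lawU
      (Measure.pi fun _ : Fin 1 => mdl.lawU) :=
    (measurePreserving_funUnique mdl.lawU (Fin 1)).symm
  filter_upwards [hmp.quasiMeasurePreserving.ae (hreg.saa_smooth 1 le_rfl),
    hmp.quasiMeasurePreserving.ae (hconc 1 le_rfl)] with u h1 h2 x hx y hy
  have he : mdl.saaElbo ((MeasurableEquiv.funUnique (Fin 1) (E s)).symm u) =
      fun v => mdl.logRatio v (mdl.θ u v) := by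
    funext v
    simp [saaElbo, MeasurableEquiv.funUnique]
  rw [he] at h1 h2
  exact inner_gradientWithin_sub_le hwell.convex hwell.interior_nonempty h1 h2 hx hy

/-- Strong monotonicity with a constant independent of `u` survives integration over `u`, by the
interchange of gradient and mean. -/
theorem inner_gradientWithin_elbo_le (hwell : mdl.WellPosed) (hreg : mdl.Regularity)
    {KL : ℝ} (hconc : mdl.StronglyConcaveSAA KL) {x y : E l} (hx : x ∈ mdl.Λ) (hy : y ∈ mdl.Λ) :
    inner ℝ (gradientWithin mdl.elbo mdl.Λ x - gradientWithin mdl.elbo mdl.Λ y) (x - y)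
      ≤ -KL * ‖x - y‖ ^ 2 := by
  have := hwell.p0_prob
  obtain ⟨hix, hgx⟩ := hwell.interchange x hx
  obtain ⟨hiy, hgy⟩ := hwell.interchange y hy
  have hin : ∫ u, inner ℝ (x - y) (gradientWithin (fun v => mdl.logRatio v (mdl.θ u v)) mdl.Λ x -
      gradientWithin (fun v => mdl.logRatio v (mdl.θ u v)) mdl.Λ y) ∂mdl.lawU = _ :=
    integral_inner (hix.sub hiy) (x - y)
  rw [hgx, hgy, ← integral_sub hix hiy, real_inner_comm]
  refine hin.symm.le.trans ?_
  calc _ ≤ ∫ _u, -KL * ‖x - y‖ ^ 2 ∂mdl.lawU := by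
        refine integral_mono_ae ((hix.sub hiy).const_inner _) (integrable_const _) ?_
        filter_upwards [ae_inner_gradientWithin_logRatio_le hwell hreg hconc] with u hu
        rw [real_inner_comm]
        exact hu x hx y hy
    _ = _ := by simp

theorem inner_gradientWithin_elbo_nonpos (hwell : mdl.WellPosed) {lamBar : E l}
    (hmem : lamBar ∈ mdl.Λ) (hmax : IsMaxOn mdl.elbo mdl.Λ lamBar) {lam : E l}
    (hlam : lam ∈ mdl.Λ) :
    inner ℝ (gradientWithin mdl.elbo mdl.Λ lamBar) (lam - lamBar) ≤ 0 := by
  rw [inner_gradientWithin]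
  exact hmax.localize.fderivWithin_nonpos (sub_mem_posTangentConeAt_of_segment_subset
    (hwell.convex.segment_subset hmem hlam))

end Model


/-! ### Second moments of batch averages -/

/-- The decomposition into squared mean and variance: averaging keeps the mean and divides the
variance by `N`, and the variance is at most the second moment. -/
theorem integral_sq_add_average_le {𝒳 : Type*} [MeasurableSpace 𝒳] {μ : Measure 𝒳}
    [IsProbabilityMeasure μ] {z : 𝒳 → ℝ} (hz : MemLp z 2 μ) (w α : ℝ) {N : ℕ} (hN : 1 ≤ N) :
    Integrable (fun x : Fin N → 𝒳 => (w + α * ((N : ℝ)⁻¹ * ∑ i, z (x i))) ^ 2)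
      (Measure.pi fun _ => μ) ∧
    ∫ x : Fin N → 𝒳, (w + α * ((N : ℝ)⁻¹ * ∑ i, z (x i))) ^ 2 ∂(Measure.pi fun _ => μ) ≤
      (w + α * ∫ y, z y ∂μ) ^ 2 + α ^ 2 / N * ∫ y, z y ^ 2 ∂μ := by
  have hN0 : (0 : ℝ) < N := by exact_mod_cast hN
  have hmp : ∀ i : Fin N, MeasurePreserving (Function.eval i) (Measure.pi fun _ : Fin N => μ) μ :=
    fun i => measurePreserving_eval (fun _ : Fin N => μ) i
  have hzi : ∀ i : Fin N, MemLp (fun x : Fin N → 𝒳 => z (x i)) 2 (Measure.pi fun _ => μ) :=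
    fun i => hz.comp_measurePreserving (hmp i)
  have hS : MemLp (fun x : Fin N → 𝒳 => ∑ i, z (x i)) 2 (Measure.pi fun _ => μ) :=
    memLp_finsetSum _ fun i _ => hzi i
  have hS' : MemLp (fun x : Fin N → 𝒳 => α * (N : ℝ)⁻¹ * ∑ i, z (x i)) 2 (Measure.pi fun _ => μ) :=
    hS.const_mul _
  have hX : MemLp (fun x : Fin N → 𝒳 => w + α * (N : ℝ)⁻¹ * ∑ i, z (x i)) 2
      (Measure.pi fun _ => μ) := (memLp_const w).add hS'
  simp only [← mul_assoc]
  refine ⟨hX.integrable_sq, ?_⟩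
  have hvar := variance_eq_sub hX
  have hmean : ∫ x : Fin N → 𝒳, (w + α * (N : ℝ)⁻¹ * ∑ i, z (x i)) ∂(Measure.pi fun _ => μ) =
      w + α * ∫ y, z y ∂μ := by
    rw [integral_add (integrable_const _) (hS'.integrable one_le_two), integral_const_mul,
      integral_finsetSum _ fun i _ => (hzi i).integrable one_le_two]
    have : ∀ i : Fin N, ∫ x : Fin N → 𝒳, z (x i) ∂(Measure.pi fun _ => μ) = ∫ y, z y ∂μ := by
      intro i
      have h := integral_map (μ := Measure.pi fun _ : Fin N => μ) (hmp i).aemeasurable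
        (f := z) (by rw [(hmp i).map_eq]; exact hz.aestronglyMeasurable)
      rw [(hmp i).map_eq] at h
      exact h.symm
    simp only [this, Finset.sum_const, Finset.card_univ, Fintype.card_fin, nsmul_eq_mul]
    simp
    field_simp
  have hv : Var[fun x : Fin N → 𝒳 => w + α * (N : ℝ)⁻¹ * ∑ i, z (x i);
      Measure.pi fun _ => μ] = α ^ 2 / N * Var[z; μ] := by
    rw [variance_const_add hS'.aestronglyMeasurable, variance_const_mul]
    have := variance_sum_pi (μ := fun _ : Fin N => μ) (X := fun _ => z) fun _ => hz
    have he : (∑ i : Fin N, fun x : Fin N → 𝒳 => z (x i)) = fun x => ∑ i, z (x i) := by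
      ext; simp
    rw [he] at this
    rw [this]
    simp only [Finset.sum_const, Finset.card_univ, Fintype.card_fin, nsmul_eq_mul]
    field_simp
  rw [hv, hmean] at hvar
  have h1 : Var[z; μ] ≤ ∫ y, z y ^ 2 ∂μ := variance_le_expectation_sq hz.aestronglyMeasurable
  have h2 : α ^ 2 / N * Var[z; μ] ≤ α ^ 2 / N * ∫ y, z y ^ 2 ∂μ :=
    mul_le_mul_of_nonneg_left h1 (by positivity)
  simp only [Pi.pow_apply] at hvar
  linarith

theorem ofReal_norm_sq {V : Type*} [SeminormedAddCommGroup V] (v : V) :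
    ENNReal.ofReal (‖v‖ ^ 2) = ‖v‖ₑ ^ 2 := by
  rw [ENNReal.ofReal_pow (norm_nonneg _), ofReal_norm]

/-- The scalar case is summed over coordinates, which costs no dimensional factor. With lower
integrals the bound by `c` also supplies all the integrability. -/
theorem lintegral_enorm_sq_add_average_le {𝒳 : Type*} [MeasurableSpace 𝒳] {μ : Measure 𝒳}
    [IsProbabilityMeasure μ] {d : ℕ} {Z : 𝒳 → E d} (hZ : Measurable Z) {c : ℝ}
    (hc : ∫⁻ x, ‖Z x‖ₑ ^ 2 ∂μ ≤ ENNReal.ofReal c) (hc0 : 0 ≤ c) (w : E d) (α : ℝ) {N : ℕ}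
    (hN : 1 ≤ N) :
    ∫⁻ x : Fin N → 𝒳, ‖w + α • ((N : ℝ)⁻¹ • ∑ i, Z (x i))‖ₑ ^ 2 ∂(Measure.pi fun _ => μ) ≤
      ENNReal.ofReal (‖w + α • ∫ x, Z x ∂μ‖ ^ 2 + α ^ 2 / N * c) := by
  have hsq : Integrable (fun x => ‖Z x‖ ^ 2) μ := by
    refine ⟨(hZ.norm.pow_const 2).aestronglyMeasurable, ?_⟩
    rw [hasFiniteIntegral_iff_ofReal (Filter.Eventually.of_forall fun x => by positivity)]
    simp only [ofReal_norm_sq]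
    exact hc.trans_lt ENNReal.ofReal_lt_top
  have hL : MemLp Z 2 μ := (memLp_two_iff_integrable_sq_norm hZ.aestronglyMeasurable).2 hsq
  have hc' : ∫ x, ‖Z x‖ ^ 2 ∂μ ≤ c := by
    rw [← ENNReal.ofReal_le_ofReal_iff hc0, ofReal_integral_eq_lintegral_ofReal hsq
      (Filter.Eventually.of_forall fun x => by positivity)]
    simpa only [ofReal_norm_sq] using hc
  have hcoord : ∀ k : Fin d, MemLp (fun x => Z x k) 2 μ := fun k => by
    refine hL.mono ((EuclideanSpace.proj (𝕜 := ℝ) k).continuous.measurable.comp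
      hZ).aestronglyMeasurable (Filter.Eventually.of_forall fun x => PiLp.norm_apply_le _ _)
  have hk := fun k : Fin d => integral_sq_add_average_le (hcoord k) (w k) α hN
  have hexp : ∀ x : Fin N → 𝒳, ‖w + α • ((N : ℝ)⁻¹ • ∑ i, Z (x i))‖ ^ 2 =
      ∑ k, (w k + α * ((N : ℝ)⁻¹ * ∑ i, Z (x i) k)) ^ 2 := by
    intro x
    rw [EuclideanSpace.norm_sq_eq]
    simp
  have hint : Integrable (fun x : Fin N → 𝒳 => ‖w + α • ((N : ℝ)⁻¹ • ∑ i, Z (x i))‖ ^ 2)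
      (Measure.pi fun _ => μ) := by
    simp only [hexp]
    exact integrable_finsetSum _ fun k _ => (hk k).1
  simp only [← ofReal_norm_sq]
  rw [← ofReal_integral_eq_lintegral_ofReal hint
    (Filter.Eventually.of_forall fun x => by positivity)]
  refine ENNReal.ofReal_le_ofReal ?_
  simp only [hexp]
  rw [integral_finsetSum _ fun k _ => (hk k).1]
  refine (Finset.sum_le_sum fun k _ => (hk k).2).trans ?_
  have hmean : ∀ k, (∫ x, Z x ∂μ) k = ∫ x, Z x k ∂μ := fun k =>
    ((EuclideanSpace.proj (𝕜 := ℝ) k).integral_comp_comm (hL.integrable one_le_two)).symm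
  rw [Finset.sum_add_distrib, ← Finset.mul_sum,
    ← integral_finsetSum _ fun k _ => (hcoord k).integrable_sq, EuclideanSpace.norm_sq_eq]
  refine add_le_add (le_of_eq (Finset.sum_congr rfl fun k _ => ?_)) ?_
  · simp [hmean]
  · refine mul_le_mul_of_nonneg_left ?_ (by positivity)
    refine le_trans (le_of_eq (integral_congr_ae (Filter.Eventually.of_forall fun x => ?_))) hc'
    simp [EuclideanSpace.norm_sq_eq]

/-! ### Disintegration along the history -/

theorem measurable_measure_pi {H 𝒳 : Type*} [MeasurableSpace H] [MeasurableSpace 𝒳]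
    {κ : H → Measure 𝒳} (hκ : Measurable κ) [∀ h, IsProbabilityMeasure (κ h)] (N : ℕ) :
    Measurable fun h => Measure.pi fun _ : Fin N => κ h := by
  refine Measurable.measure_of_isPiSystem_of_isProbabilityMeasure generateFrom_pi.symm
    isPiSystem_pi ?_
  rintro _ ⟨S, hS, rfl⟩
  simp only [Measure.pi_pi]
  exact Finset.measurable_prod _ fun i _ => (Measure.measurable_coe (hS i trivial)).comp hκ

/-- The conditional probabilities are prescribed set by set, each off its own null set. Integrated
over history events they identify the joint law on rectangles with the composition product of the
law of the history and `κ`, and rectangles determine a finite measure; no regularity of the spaces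
is used. -/
theorem lintegral_comp_of_condExp {Ω H 𝒳 : Type*} [MeasurableSpace Ω] [MeasurableSpace H]
    [MeasurableSpace 𝒳] {P : Measure Ω} [IsProbabilityMeasure P] {hist : Ω → H} {X : Ω → 𝒳}
    (hhist : Measurable hist) (hX : Measurable X) {κ : H → Measure 𝒳} (hκ : Measurable κ)
    [∀ h, IsProbabilityMeasure (κ h)]
    (hlaw : ∀ S : Set 𝒳, MeasurableSet S →
      P⟦X ⁻¹' S | MeasurableSpace.comap hist inferInstance⟧ =ᵐ[P] fun ω => (κ (hist ω)).real S)
    {Ψ : H → 𝒳 → ENNReal} (hΨ : Measurable fun z : H × 𝒳 => Ψ z.1 z.2) :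
    ∫⁻ ω, Ψ (hist ω) (X ω) ∂P = ∫⁻ ω, ∫⁻ x, Ψ (hist ω) x ∂(κ (hist ω)) ∂P := by
  let κ' : Kernel H 𝒳 := ⟨κ, hκ⟩
  have : IsMarkovKernel κ' := ⟨fun h => inferInstanceAs (IsProbabilityMeasure (κ h))⟩
  have : IsProbabilityMeasure (P.map hist) := Measure.isProbabilityMeasure_map hhist.aemeasurable
  have hpair : Measurable fun ω => (hist ω, X ω) := hhist.prodMk hX
  have key : P.map (fun ω => (hist ω, X ω)) = (P.map hist) ⊗ₘ κ' := by
    refine Measure.ext_prod fun {A S} hA hS => ?_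
    rw [Measure.map_apply hpair (hA.prod hS), Measure.compProd_apply_prod hA hS,
      setLIntegral_map hA (κ'.measurable_coe hS) hhist]
    have hm : MeasurableSpace.comap hist inferInstance ≤ (inferInstance : MeasurableSpace Ω) :=
      hhist.comap_le
    have h1 := setIntegral_condExp hm (μ := P) (f := (X ⁻¹' S).indicator fun _ => (1 : ℝ))
      ((integrable_const 1).indicator (hX hS)) (s := hist ⁻¹' A) ⟨A, hA, rfl⟩
    rw [setIntegral_indicator (hX hS), setIntegral_const, smul_eq_mul, mul_one] at h1
    have h2 : ∫ ω in hist ⁻¹' A, (κ (hist ω)).real S ∂P = P.real (hist ⁻¹' A ∩ X ⁻¹' S) := by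
      rw [← h1]
      refine setIntegral_congr_ae (hhist hA) ?_
      filter_upwards [hlaw S hS] with ω h _ using h.symm
    have hSm : Measurable fun ω => κ (hist ω) S := (Measure.measurable_coe hS).comp (hκ.comp hhist)
    have h3 : ∫⁻ ω in hist ⁻¹' A, κ (hist ω) S ∂P =
        ENNReal.ofReal (∫ ω in hist ⁻¹' A, (κ (hist ω)).real S ∂P) := by
      rw [ofReal_integral_eq_lintegral_ofReal]
      · refine lintegral_congr fun ω => ?_
        rw [measureReal_def, ENNReal.ofReal_toReal (measure_ne_top _ _)]
      · refine Integrable.of_bound (C := 1) hSm.ennreal_toReal.aestronglyMeasurable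
          (Filter.Eventually.of_forall fun ω => ?_)
        rw [Real.norm_of_nonneg measureReal_nonneg]
        exact measureReal_le_one
      · exact Filter.Eventually.of_forall fun ω => measureReal_nonneg
    change _ = ∫⁻ ω in hist ⁻¹' A, κ (hist ω) S ∂P
    rw [h3, h2, measureReal_def, ENNReal.ofReal_toReal (measure_ne_top _ _)]
    rfl
  have h1 : ∫⁻ z, Ψ z.1 z.2 ∂(P.map fun ω => (hist ω, X ω)) = ∫⁻ ω, Ψ (hist ω) (X ω) ∂P :=
    lintegral_map hΨ hpair
  rw [← h1, key, Measure.lintegral_compProd hΨ, lintegral_map hΨ.lintegral_kernel_prod_right' hhist]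
  rfl


/-! ### Linear recursions with slowly varying forcing -/

/-- Bernoulli's inequality `(1 + 1/k)^e ≤ 1 + e/k` for `0 ≤ e ≤ 1`. A power of `k` thus loses at
most the factor `1 + c/k` per step, which is how the comparison lemma measures decay. -/
theorem rpow_neg_le_succ {e c : ℝ} (he : 0 ≤ e) (hec : e ≤ c) (he1 : e ≤ 1) {k : ℕ} (hk : 1 ≤ k) :
    (k : ℝ) ^ (-e) ≤ (1 + c / k) * ((k + 1 : ℕ) : ℝ) ^ (-e) := by
  have hk0 : (0 : ℝ) < k := by exact_mod_cast hk
  have hk1 : (0 : ℝ) < ((k + 1 : ℕ) : ℝ) := by positivity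
  have h1 : (1 + 1 / (k : ℝ)) ^ e ≤ 1 + e * (1 / k) :=
    rpow_one_add_le_one_add_mul_self (by linarith [one_div_pos.2 hk0]) he he1
  have h2 : ((k + 1 : ℕ) : ℝ) = k * (1 + 1 / k) := by push_cast; field_simp
  have h3 : 0 < (1 + 1 / (k : ℝ)) ^ (-e) := by positivity
  have h4 : (1 + 1 / (k : ℝ)) ^ e * (1 + 1 / (k : ℝ)) ^ (-e) = 1 := by
    rw [← Real.rpow_add (by positivity)]; simp
  have h5 : 1 + e * (1 / (k : ℝ)) ≤ 1 + c / k := by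
    rw [mul_one_div]
    gcongr
  rw [h2, Real.mul_rpow hk0.le (by positivity)]
  have h6 : 0 < (k : ℝ) ^ (-e) := by positivity
  calc (k : ℝ) ^ (-e) = (k : ℝ) ^ (-e) * ((1 + 1 / (k : ℝ)) ^ e * (1 + 1 / (k : ℝ)) ^ (-e)) := by
        rw [h4, mul_one]
    _ ≤ (k : ℝ) ^ (-e) * ((1 + c / k) * (1 + 1 / (k : ℝ)) ^ (-e)) := by
        gcongr
        exact h1.trans h5
    _ = _ := by ring

theorem tendsto_div_rpow {η₀ e : ℝ} (he : 0 < e) :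
    Filter.Tendsto (fun k : ℕ => η₀ / (k : ℝ) ^ e) Filter.atTop (nhds 0) :=
  ((tendsto_rpow_atTop he).comp tendsto_natCast_atTop_atTop).const_div_atTop η₀

/-- The relative decay `c/k` of the target must use up only a fixed fraction of the contraction `μ
η_k`. For `e < 1` this is automatic, since `1/k = o(k^{-e})`; for `e = 1` both are of order `1/k`
and the constants have to be compared. -/
theorem exists_eventually_div_le {η₀ e μ c : ℝ} (hη₀ : 0 < η₀) (hμ : 0 < μ)
    (hgain : e < 1 ∨ e = 1 ∧ c < η₀ * μ) :
    ∃ χ : ℝ, 0 < χ ∧ ∀ᶠ k : ℕ in Filter.atTop, c / k ≤ (1 - χ) * (μ * (η₀ / (k : ℝ) ^ e)) := by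
  rcases hgain with he | ⟨rfl, hg⟩
  · refine ⟨1 / 2, by norm_num, ?_⟩
    have h1 : Filter.Tendsto (fun k : ℕ => c / (k : ℝ) ^ (1 - e)) Filter.atTop (nhds 0) :=
      tendsto_div_rpow (by linarith)
    filter_upwards [h1.eventually (gt_mem_nhds (show (0 : ℝ) < μ * η₀ / 2 by positivity)),
      Filter.eventually_ge_atTop 1] with k hk hk1
    have hk0 : (0 : ℝ) < k := by exact_mod_cast hk1
    have h2 : (k : ℝ) = (k : ℝ) ^ (1 - e) * (k : ℝ) ^ e := by
      rw [← Real.rpow_add hk0]; simp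
    have h3 : 0 < (k : ℝ) ^ e := by positivity
    calc c / (k : ℝ) = c / (k : ℝ) ^ (1 - e) / (k : ℝ) ^ e := by
          rw [div_div, ← h2]
      _ ≤ μ * η₀ / 2 / (k : ℝ) ^ e := by gcongr
      _ = _ := by ring
  · refine ⟨1 - c / (η₀ * μ), by
      rw [sub_pos, div_lt_one (by positivity)]; exact hg, Filter.Eventually.of_forall fun k => ?_⟩
    rw [Real.rpow_one]
    refine le_of_eq ?_
    field_simp
    ring

/-- If `y` satisfies a linear recursion with contraction factor `1 - μ η_k` and forcing of order
`η_k w_k`, where `η_k = η₀ k^{-e}` and `w` decreases more slowly than the recursion contracts, then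
`y = O(w)`, uniformly over `w` in a class with a given lower bound. -/
theorem exists_rate_bound {η : ℕ → ℝ} {η₀ e μ c ν B₀ : ℝ} (hη₀ : 0 < η₀) (he : 0 < e)
    (hη : ∀ k : ℕ, 1 ≤ k → η k = η₀ / (k : ℝ) ^ e) (hμ : 0 < μ) (hc : 0 ≤ c)
    (hν : 0 ≤ ν) (hgain : e < 1 ∨ e = 1 ∧ c < η₀ * μ) {p v Rb : ℕ → ℝ} (hp : ∀ k, 0 ≤ p k)
    (hv : ∀ k, 0 < v k) (hB₀ : 0 ≤ B₀)
    (hpe : ∀ᶠ k in Filter.atTop, p k ≤ 1 - μ * η k) :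
    ∃ C : ℝ, 0 ≤ C ∧ ∀ w r : ℕ → ℝ, (∀ k, v k ≤ w k) → (∀ k, 0 ≤ r k) → (∀ k, r k ≤ Rb k) →
      (∀ k, 1 ≤ k → r k ≤ ν * (η k * w k)) →
      (∀ k : ℕ, 1 ≤ k → w k ≤ (1 + c / k) * w (k + 1)) →
      ∀ y : ℕ → ENNReal, y 0 ≤ ENNReal.ofReal B₀ →
        (∀ k, y (k + 1) ≤ ENNReal.ofReal (p k) * y k + ENNReal.ofReal (r k)) →
        ∀ k, y k ≤ ENNReal.ofReal (C * w k) := by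
  obtain ⟨χ, hχ, hχe⟩ := exists_eventually_div_le hη₀ hμ hgain
  have hsmall : ∀ᶠ k : ℕ in Filter.atTop, μ * η k ≤ 1 := by
    have h1 : Filter.Tendsto (fun k : ℕ => η₀ / (k : ℝ) ^ e) Filter.atTop (nhds 0) :=
      tendsto_div_rpow he
    filter_upwards [h1.eventually (gt_mem_nhds (inv_pos.2 hμ)), Filter.eventually_ge_atTop 1]
      with k hk hk1
    rw [hη k hk1]
    calc μ * (η₀ / (k : ℝ) ^ e) ≤ μ * μ⁻¹ := by gcongr
      _ = 1 := mul_inv_cancel₀ hμ.ne'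
  obtain ⟨k₀, hk₀⟩ := Filter.eventually_atTop.1
    ((hpe.and hχe).and (hsmall.and (Filter.eventually_ge_atTop (max 1 ⌈c⌉₊))))
  -- A majorant of `y` built from the bound `Rb` of the forcing only, hence the same for all `w` and
  -- `r` in the class.
  let x : ℕ → ℝ := fun k => Nat.rec B₀ (fun k x => p k * x + max (Rb k) 0) k
  have hx0 : ∀ k, 0 ≤ x k := by
    intro k
    induction k with
    | zero => exact hB₀
    | succ k ih => exact add_nonneg (mul_nonneg (hp k) ih) (le_max_right _ _)
  -- The first term closes the induction beyond `k₀`: there `(1 - μ η_k)(1 + c/k) ≤ 1 - χ μ η_k`,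
  -- and the forcing, at most `2 ν η_k w_{k+1}`, fits into the slack `χ μ η_k C w_{k+1}`. The sum
  -- handles `k ≤ k₀` through `v ≤ w`.
  let C := 2 * ν / (χ * μ) + ∑ k ∈ Finset.range (k₀ + 1), x k / v k
  have hterm : ∀ k, 0 ≤ x k / v k := fun k => div_nonneg (hx0 k) (hv k).le
  have hC1 : 2 * ν / (χ * μ) ≤ C := le_add_of_nonneg_right (Finset.sum_nonneg fun k _ => hterm k)
  have hC0 : 0 ≤ C := le_trans (by positivity) hC1
  refine ⟨C, hC0, fun w r hvw hr0 hrR hrw hw y hy0 hy => ?_⟩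
  have hw0 : ∀ k, 0 < w k := fun k => (hv k).trans_le (hvw k)
  have hyx : ∀ k, y k ≤ ENNReal.ofReal (x k) := by
    intro k
    induction k with
    | zero => exact hy0
    | succ k ih =>
      refine (hy k).trans ?_
      change _ ≤ ENNReal.ofReal (p k * x k + max (Rb k) 0)
      rw [ENNReal.ofReal_add (mul_nonneg (hp k) (hx0 k)) (le_max_right _ _),
        ENNReal.ofReal_mul (hp k)]
      gcongr
      exact (hrR k).trans (le_max_left _ _)
  have hearly : ∀ k ≤ k₀, y k ≤ ENNReal.ofReal (C * w k) := by
    intro k hk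
    refine (hyx k).trans (ENNReal.ofReal_le_ofReal ?_)
    have h1 : x k / v k ≤ C := by
      refine le_trans ?_ (le_add_of_nonneg_left (by positivity))
      exact Finset.single_le_sum (f := fun k => x k / v k) (fun k _ => hterm k)
        (Finset.mem_range.2 (by omega))
    calc x k = x k / v k * v k := (div_mul_cancel₀ _ (hv k).ne').symm
      _ ≤ C * w k := mul_le_mul h1 (hvw k) (hv k).le hC0
  intro k
  rcases le_or_gt k k₀ with hk | hk
  · exact hearly k hk
  · induction k, hk.le using Nat.le_induction with
    | base => exact hearly k₀ le_rfl
    | succ k hk' ih =>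
      have ih' : y k ≤ ENNReal.ofReal (C * w k) := by
        rcases eq_or_lt_of_le hk' with h | h
        · exact hearly k h.ge
        · exact ih h
      obtain ⟨⟨h1, h2⟩, h3, h4⟩ := hk₀ k hk'
      have hck1 : c ≤ k := Nat.ceil_le.1 ((le_max_right _ _).trans h4)
      replace h4 : 1 ≤ k := (le_max_left _ _).trans h4
      rw [← hη k h4] at h2
      refine (hy k).trans ?_
      have hCw : 0 ≤ C * w k := mul_nonneg hC0 (hw0 k).le
      have h5 : p k * (C * w k) + r k ≤ C * w (k + 1) := by
        have hηk : 0 < η k := by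
          rw [hη k h4]
          have : (0 : ℝ) < k := by exact_mod_cast h4
          positivity
        have h6 : (p k * C + ν * η k) * w k ≤ C * w (k + 1) := by
          have hck : c / (k : ℝ) ≤ 1 :=
            (div_le_one (by exact_mod_cast h4)).2 hck1
          have hck0 : 0 ≤ c / (k : ℝ) := by positivity
          have h7 : (p k * C + ν * η k) * (1 + c / k) ≤ C := by
            have h8 : p k * (1 + c / k) ≤ 1 - χ * (μ * η k) := by
              calc p k * (1 + c / k) ≤ (1 - μ * η k) * (1 + c / k) := by gcongr
                _ ≤ _ := by nlinarith [mul_nonneg (mul_pos hμ hηk).le hck0]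
            have h9 : ν * η k * (1 + c / k) ≤ χ * (μ * η k) * C := by
              calc ν * η k * (1 + c / k) ≤ ν * η k * 2 := by gcongr; linarith
                _ = χ * (μ * η k) * (2 * ν / (χ * μ)) := by field_simp
                _ ≤ _ := by gcongr
            nlinarith
          have h10 : 0 ≤ p k * C + ν * η k := by
            have := mul_nonneg (hp k) hC0
            positivity
          calc (p k * C + ν * η k) * w k
              ≤ (p k * C + ν * η k) * ((1 + c / k) * w (k + 1)) :=
                mul_le_mul_of_nonneg_left (hw k h4) h10
            _ = ((p k * C + ν * η k) * (1 + c / k)) * w (k + 1) := by ring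
            _ ≤ C * w (k + 1) := mul_le_mul_of_nonneg_right h7 (hw0 _).le
        have := hrw k h4
        nlinarith
      calc ENNReal.ofReal (p k) * y k + ENNReal.ofReal (r k)
          ≤ ENNReal.ofReal (p k) * ENNReal.ofReal (C * w k) + ENNReal.ofReal (r k) := by gcongr
        _ = ENNReal.ofReal (p k * (C * w k) + r k) := by
          rw [ENNReal.ofReal_add (mul_nonneg (hp k) hCw) (hr0 k), ENNReal.ofReal_mul (hp k)]
        _ ≤ _ := ENNReal.ofReal_le_ofReal h5

/-! ### Decay of the step sizes and of the two rates built from them. -/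

namespace StepSizes

variable {α β : ℕ → ℝ} {a b α₀ β₀ : ℝ}

theorem a_lt_one (h : StepSizes α β a b α₀ β₀) : a < 1 := h.a_lt_b.trans_le h.b_le

theorem a_pos (h : StepSizes α β a b α₀ β₀) : 0 < a := by linarith [h.half_lt]

theorem tendsto_α (h : StepSizes α β a b α₀ β₀) :
    Filter.Tendsto α Filter.atTop (nhds 0) := by
  refine (tendsto_div_rpow (η₀ := α₀) h.a_pos).congr' ?_
  filter_upwards [Filter.eventually_ge_atTop 1] with k hk using (h.α_eq k hk).symm

theorem tendsto_β (h : StepSizes α β a b α₀ β₀) :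
    Filter.Tendsto β Filter.atTop (nhds 0) := by
  refine (tendsto_div_rpow (η₀ := β₀) (h.a_pos.trans h.a_lt_b)).congr' ?_
  filter_upwards [Filter.eventually_ge_atTop 1] with k hk using (h.β_eq k hk).symm

theorem α_bdd (h : StepSizes α β a b α₀ β₀) : ∃ A : ℝ, 0 < A ∧ ∀ k, α k ≤ A := by
  refine ⟨α 0 + α₀, add_pos (h.α_pos 0) h.α₀_pos, fun k => ?_⟩
  rcases Nat.eq_zero_or_pos k with rfl | hk
  · linarith [h.α₀_pos]
  · rw [h.α_eq k hk]
    have h1 : (1 : ℝ) ≤ (k : ℝ) ^ a := Real.one_le_rpow (by exact_mod_cast hk) h.a_pos.le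
    linarith [div_le_self h.α₀_pos.le h1, h.α_pos 0]

theorem ratio_eq (h : StepSizes α β a b α₀ β₀) {k : ℕ} (hk : 1 ≤ k) :
    β k / α k = β₀ / α₀ * (k : ℝ) ^ (-(b - a)) := by
  have hk0 : (0 : ℝ) < k := by exact_mod_cast hk
  have h1 := h.α₀_pos
  rw [h.β_eq k hk, h.α_eq k hk, neg_sub, Real.rpow_sub hk0]
  have : 0 < (k : ℝ) ^ a := by positivity
  field_simp

theorem sqrt_eq (h : StepSizes α β a b α₀ β₀) {k : ℕ} (hk : 1 ≤ k) (N : ℕ) :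
    Real.sqrt (α k / N) = Real.sqrt (α₀ / N) * (k : ℝ) ^ (-(a / 2)) := by
  have hk0 : (0 : ℝ) < k := by exact_mod_cast hk
  have h1 : α k / N = (α₀ / N) * (k : ℝ) ^ (-a) := by
    rw [h.α_eq k hk, Real.rpow_neg hk0.le]; ring
  rw [h1, Real.sqrt_mul (by have := h.α₀_pos; positivity), Real.sqrt_eq_rpow ((k : ℝ) ^ (-a)),
    ← Real.rpow_mul hk0.le]
  ring_nf

theorem ratio_le_succ (h : StepSizes α β a b α₀ β₀) {c : ℝ} (hc : b - a ≤ c) {k : ℕ}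
    (hk : 1 ≤ k) : β k / α k ≤ (1 + c / k) * (β (k + 1) / α (k + 1)) := by
  rw [h.ratio_eq hk, h.ratio_eq (by omega)]
  have h1 := h.α₀_pos
  have h2 := h.β₀_pos
  have := rpow_neg_le_succ (sub_nonneg.2 h.a_lt_b.le) hc (by linarith [h.b_le, h.half_lt]) hk
  calc _ ≤ β₀ / α₀ * ((1 + c / k) * ((k + 1 : ℕ) : ℝ) ^ (-(b - a))) := by gcongr
    _ = _ := by ring

theorem sqrt_le_succ (h : StepSizes α β a b α₀ β₀) {c : ℝ} (hc : a / 2 ≤ c) {k : ℕ}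
    (hk : 1 ≤ k) (N : ℕ) :
    Real.sqrt (α k / N) ≤ (1 + c / k) * Real.sqrt (α (k + 1) / N) := by
  rw [h.sqrt_eq hk, h.sqrt_eq (by omega)]
  have := rpow_neg_le_succ (by linarith [h.a_pos]) hc (by linarith [h.a_lt_one]) hk
  calc _ ≤ Real.sqrt (α₀ / N) * ((1 + c / k) * ((k + 1 : ℕ) : ℝ) ^ (-(a / 2))) := by gcongr
    _ = _ := by ring

end StepSizes


/-- Expanding the vector in the standard basis reduces the application to finitely many products of
a measurable coordinate with the operator evaluated at a fixed vector. -/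
theorem measurable_clm_apply {Z F : Type*} [MeasurableSpace Z] [NormedAddCommGroup F]
    [NormedSpace ℝ F] [MeasurableSpace F] [BorelSpace F] [SecondCountableTopology F] {d : ℕ}
    {φ : Z → E d →L[ℝ] F} {v : Z → E d} (hφ : Measurable φ) (hv : Measurable v) :
    Measurable fun z => φ z (v z) := by
  have h : ∀ z, φ z (v z) = ∑ k, v z k • φ z (EuclideanSpace.single k 1) := by
    intro z
    conv_lhs => rw [← (EuclideanSpace.basisFun (Fin d) ℝ).sum_repr (v z)]
    simp
  simp only [h]
  refine Finset.measurable_sum _ fun k _ => ?_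
  exact ((EuclideanSpace.proj (𝕜 := ℝ) k).continuous.measurable.comp hv).smul
    (hφ.apply_continuousLinearMap _)

namespace Model

variable {l d n r s T : ℕ} {mdl : Model l d n r s T}

/-! ### Measurability -/

theorem continuous_score (hreg : mdl.Regularity) (t : Fin T) : Continuous (mdl.score t) := by
  have h1 : Continuous (gradient (mdl.p (mdl.Y t))) :=
    (InnerProductSpace.toDual ℝ (E d)).symm.continuous.comp
      ((hreg.p_smooth t).continuous_fderiv (by norm_num))
  have h2 : Continuous fun ϑ => (mdl.p (mdl.Y t) ϑ)⁻¹ :=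
    (hreg.p_smooth t).continuous.inv₀ fun ϑ => (hreg.p_pos t ϑ).ne'
  exact h2.smul h1

theorem measurable_h (hwell : mdl.WellPosed) (hreg : mdl.Regularity) (lam : E l) :
    Measurable fun u => mdl.h u lam := by
  have hpair : Measurable fun u : E s => (u, lam) := measurable_id.prodMk measurable_const
  have hA := hwell.A_measurable.comp hpair
  simp only [Function.comp_def] at hA
  have hB : Measurable fun u => mdl.B u lam := hwell.B_measurable.comp hpair
  have hC : Measurable fun u => mdl.C u lam := hwell.C_measurable.comp hpair
  have hθ : Measurable fun u => mdl.θ u lam := hwell.θ_measurable.comp hpair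
  have hs : Measurable fun u => ∑ t, mdl.score t (mdl.θ u lam) :=
    Finset.measurable_sum _ fun t _ => (continuous_score hreg t).measurable.comp hθ
  have hv := (hs.add hB).sub hC
  unfold h
  exact measurable_clm_apply hA hv

theorem measurable_lawX (hwell : mdl.WellPosed) : Measurable mdl.lawX := by
  refine Measure.measurable_of_measurable_coe _ fun S hS => ?_
  simp only [lawX, densityLaw, withDensity_apply _ hS]
  exact (hwell.f_measurable.ennreal_ofReal).comp measurable_swap |>.lintegral_prod_right'

theorem measurable_direction (hwell : mdl.WellPosed) (M : ℕ) :
    Measurable fun z : (Fin M → E s) × (E l × (Fin M → Fin T → E d)) =>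
      mdl.direction z.1 z.2.1 z.2.2 := by
  have hm : ∀ m : Fin M, Measurable fun z : (Fin M → E s) × (E l × (Fin M → Fin T → E d)) =>
      mdl.A (z.1 m) z.2.1 ((∑ t, z.2.2 m t) + mdl.B (z.1 m) z.2.1 - mdl.C (z.1 m) z.2.1) := by
    intro m
    have hpair : Measurable fun z : (Fin M → E s) × (E l × (Fin M → Fin T → E d)) =>
      (z.1 m, z.2.1) := by fun_prop
    have hA := hwell.A_measurable.comp hpair
    have hB := hwell.B_measurable.comp hpair
    have hC := hwell.C_measurable.comp hpair
    have hD : Measurable fun z : (Fin M → E s) × (E l × (Fin M → Fin T → E d)) =>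
      ∑ t, z.2.2 m t := by fun_prop
    exact measurable_clm_apply hA ((hD.add hB).sub hC)
  have hsum := Finset.measurable_sum Finset.univ fun m _ => hm m
  exact hsum.const_smul (M : ℝ)⁻¹

theorem measurable_proj (hwell : mdl.WellPosed) (hlip : mdl.LipschitzGradient) :
    Measurable (proj mdl.Λ) :=
  (continuous_proj hlip.compact (hwell.interior_nonempty.mono interior_subset)
    hwell.convex).measurable

/-- The update of `lam`. -/
def nextLam (mdl : Model l d n r s T) {M : ℕ} (βk : ℝ) (u : Fin M → E s)
    (z : E l × (Fin M → Fin T → E d)) : E l :=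
  proj mdl.Λ (z.1 + βk • mdl.direction u z.1 z.2)

/-- The update of a single block of `D`. -/
def nextBlock (mdl : Model l d n r s T) {N : ℕ} (αk : ℝ) (x : Fin N → E n) (t : Fin T) (ϑ : E d)
    (D : E d) : E d :=
  D + αk • (mdl.G1bar x t ϑ - mdl.G2bar x t ϑ • D)

theorem measurable_nextLam (hwell : mdl.WellPosed) (hlip : mdl.LipschitzGradient) {M : ℕ}
    (βk : ℝ) : Measurable fun z : (Fin M → E s) × (E l × (Fin M → Fin T → E d)) =>
      mdl.nextLam βk z.1 z.2 :=
  (measurable_proj hwell hlip).comp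
    ((by fun_prop : Measurable fun z : (Fin M → E s) × (E l × (Fin M → Fin T → E d)) =>
      z.2.1).add ((measurable_direction hwell M).const_smul βk))

theorem measurable_nextBlock (hwell : mdl.WellPosed) {N : ℕ} (αk : ℝ) (t : Fin T) :
    Measurable fun z : (Fin N → E n) × (E d × E d) => mdl.nextBlock αk z.1 t z.2.1 z.2.2 := by
  have hpair : ∀ i : Fin N, Measurable fun z : (Fin N → E n) × (E d × E d) =>
      (z.1 i, z.2.1) := fun i => by fun_prop
  have h1 : Measurable fun z : (Fin N → E n) × (E d × E d) => mdl.G1bar z.1 t z.2.1 := by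
    have := Finset.measurable_sum Finset.univ fun i _ => (hwell.G1_measurable t).comp (hpair i)
    exact this.const_smul (N : ℝ)⁻¹
  have h2 : Measurable fun z : (Fin N → E n) × (E d × E d) => mdl.G2bar z.1 t z.2.1 := by
    have := Finset.measurable_sum Finset.univ fun i _ => (hwell.G2_measurable t).comp (hpair i)
    exact this.const_mul (N : ℝ)⁻¹
  have h3 : Measurable fun z : (Fin N → E n) × (E d × E d) => z.2.2 := by fun_prop
  exact h3.add ((h1.sub (h2.smul h3)).const_smul αk)

end Model

/-! ### A run as a random sequence, and the conditional law of its batches. -/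

namespace Run

variable {l d n r s T : ℕ} {mdl : Model l d n r s T} {M N : ℕ} {α β : ℕ → ℝ} {R : ℝ}
  {Ω : Type*} [MeasurableSpace Ω] {P : Measure Ω}

/-- The vector of outer samples. -/
def outer (ρ : Run mdl M N α β R P) (ω : Ω) : Fin M → E s := fun m => ρ.u m ω

/-- The state `(lam_k, D_k)` of a run. -/
def state (ρ : Run mdl M N α β R P) (k : ℕ) (ω : Ω) : E l × (Fin M → Fin T → E d) :=
  mdl.iterates α β (fun m => ρ.u m ω) (fun k' m i => ρ.X k' m i ω)
    (ρ.lam0 ω, fun m t => ρ.D0 m t ω) k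

variable (ρ : Run mdl M N α β R P)

theorem lam_eq (k : ℕ) (ω : Ω) : ρ.lam k ω = (ρ.state k ω).1 := rfl

theorem state_succ_fst (k : ℕ) (ω : Ω) :
    (ρ.state (k + 1) ω).1 = mdl.nextLam (β k) (ρ.outer ω) (ρ.state k ω) := rfl

theorem state_succ_snd (k : ℕ) (ω : Ω) (m : Fin M) (t : Fin T) :
    (ρ.state (k + 1) ω).2 m t = mdl.nextBlock (α k) (fun i => ρ.X k m i ω) t
      (mdl.θ (ρ.u m ω) (ρ.state k ω).1) ((ρ.state k ω).2 m t) := rfl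

theorem measurable_outer : Measurable ρ.outer := measurable_pi_lambda _ ρ.u_measurable

theorem state_fst_mem (hwell : mdl.WellPosed) (hlip : mdl.LipschitzGradient) (k : ℕ) (ω : Ω) :
    (ρ.state k ω).1 ∈ mdl.Λ := by
  cases k with
  | zero => exact ρ.lam0_mem ω
  | succ k =>
    rw [state_succ_fst]
    exact (proj_spec hlip.compact (hwell.interior_nonempty.mono interior_subset) _).1

theorem measurable_state (hwell : mdl.WellPosed) (hlip : mdl.LipschitzGradient) (k : ℕ) :
    Measurable (ρ.state k) := by
  induction k with
  | zero =>
    exact ρ.lam0_measurable.prodMk (measurable_pi_lambda _ fun m =>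
      measurable_pi_lambda _ fun t => ρ.D0_measurable m t)
  | succ k ih =>
    have h1 : Measurable fun ω => (ρ.state (k + 1) ω).1 := by
      simp only [state_succ_fst]
      have h0 : Measurable fun ω => (ρ.outer ω, ρ.state k ω) := ρ.measurable_outer.prodMk ih
      have := (Model.measurable_nextLam hwell hlip (β k)).comp h0
      simpa only [Function.comp_def] using this
    have h2 : Measurable fun ω => (ρ.state (k + 1) ω).2 := by
      refine measurable_pi_lambda _ fun m => measurable_pi_lambda _ fun t => ?_
      simp only [state_succ_snd]
      have h3 : Measurable fun ω => (ρ.state k ω).2 m t := by fun_prop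
      have h4 : Measurable fun ω => mdl.θ (ρ.u m ω) (ρ.state k ω).1 :=
        Measurable.comp (g := fun z : E s × E l => mdl.θ z.1 z.2) hwell.θ_measurable
          ((ρ.u_measurable m).prodMk ih.fst)
      have h5 : Measurable fun ω => (fun i => ρ.X k m i ω) :=
        measurable_pi_lambda _ fun i => ρ.X_measurable k m i
      have := (Model.measurable_nextBlock hwell (α k) t).comp (h5.prodMk (h4.prodMk h3))
      simpa only [Function.comp_def] using this
    exact h1.prodMk h2

theorem condExp_batch (k : ℕ) (m : Fin M) {S : Set (Fin N → E n)} (hS : MeasurableSet S) :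
    P⟦(fun ω i => ρ.X k m i ω) ⁻¹' S |
      MeasurableSpace.comap (fun ω => (ρ.outer ω, fun j : Fin (k + 1) => ρ.state j ω))
        inferInstance⟧
      =ᵐ[P] fun ω => (Measure.pi fun _ : Fin N =>
        mdl.lawX (mdl.θ (ρ.u m ω) (ρ.state k ω).1)).real S :=
  ρ.X_law k m S hS

/-- Averaging over the batch, given the outer samples and the current state. -/
theorem lintegral_batch [IsProbabilityMeasure P] (hwell : mdl.WellPosed)
    (hlip : mdl.LipschitzGradient) (k : ℕ) (m : Fin M)
    {Ψ : (Fin M → E s) → E l × (Fin M → Fin T → E d) → (Fin N → E n) → ENNReal}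
    (hΨ : Measurable fun z : ((Fin M → E s) × (E l × (Fin M → Fin T → E d))) × (Fin N → E n) =>
      Ψ z.1.1 z.1.2 z.2) :
    ∫⁻ ω, Ψ (ρ.outer ω) (ρ.state k ω) (fun i => ρ.X k m i ω) ∂P =
      ∫⁻ ω, ∫⁻ x, Ψ (ρ.outer ω) (ρ.state k ω) x
        ∂(Measure.pi fun _ : Fin N => mdl.lawX (mdl.θ (ρ.u m ω) (ρ.state k ω).1)) ∂P := by
  have := hwell.f_prob
  have hhist : Measurable fun ω => (ρ.outer ω, fun j : Fin (k + 1) => ρ.state j ω) :=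
    ρ.measurable_outer.prodMk (measurable_pi_lambda _ fun j => ρ.measurable_state hwell hlip j)
  -- The history records all states up to `k`, but the batch law and the integrand read only the
  -- outer samples and the last state.
  have hsel : Measurable
      fun h : (Fin M → E s) × (Fin (k + 1) → E l × (Fin M → Fin T → E d)) =>
        (h.1 m, (h.2 (Fin.last k)).1) := by fun_prop
  have hθm := hwell.θ_measurable.comp hsel
  have hlaw := (Model.measurable_lawX hwell).comp hθm
  simp only [Function.comp_def] at hlaw
  have hκ := measurable_measure_pi hlaw N
  have hsel' : Measurable
      fun z : ((Fin M → E s) × (Fin (k + 1) → E l × (Fin M → Fin T → E d))) × (Fin N → E n) =>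
        ((z.1.1, z.1.2 (Fin.last k)), z.2) := by fun_prop
  have hΨ' := hΨ.comp hsel'
  simp only [Function.comp_def] at hΨ'
  have hX : Measurable fun ω => (fun i => ρ.X k m i ω) :=
    measurable_pi_lambda _ fun i => ρ.X_measurable k m i
  have key := lintegral_comp_of_condExp hhist hX hκ (fun S hS => ρ.condExp_batch k m hS)
    (Ψ := fun h x => Ψ h.1 (h.2 (Fin.last k)) x) hΨ'
  simpa only [Fin.val_last, outer] using key

end Run


/-! ### Conditional estimates for one update of one block. -/

/-- Jensen's inequality, by pairing `Z` with its mean. It turns the second-moment bounds on the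
unbiased estimators `G1` and `G2` into bounds on `∇_θ p` and `p`. -/
theorem norm_sq_integral_le {𝒳 : Type*} [MeasurableSpace 𝒳] {μ : Measure 𝒳}
    [IsProbabilityMeasure μ] {V : Type*} [NormedAddCommGroup V] [InnerProductSpace ℝ V]
    [CompleteSpace V] {Z : 𝒳 → V} (hZ : Integrable Z μ) {c : ℝ} (hc0 : 0 ≤ c)
    (hc : ∫⁻ x, ‖Z x‖ₑ ^ 2 ∂μ ≤ ENNReal.ofReal c) : ‖∫ x, Z x ∂μ‖ ^ 2 ≤ c := by
  have hsq : Integrable (fun x => ‖Z x‖ ^ 2) μ := by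
    refine ⟨(hZ.aestronglyMeasurable.norm.aemeasurable.pow_const 2).aestronglyMeasurable, ?_⟩
    rw [hasFiniteIntegral_iff_ofReal (Filter.Eventually.of_forall fun x => by positivity)]
    simp only [ofReal_norm_sq]
    exact hc.trans_lt ENNReal.ofReal_lt_top
  have hc' : ∫ x, ‖Z x‖ ^ 2 ∂μ ≤ c := by
    rw [← ENNReal.ofReal_le_ofReal_iff hc0, ofReal_integral_eq_lintegral_ofReal hsq
      (Filter.Eventually.of_forall fun x => by positivity)]
    simpa only [ofReal_norm_sq] using hc
  have h1 : ∫ x, inner ℝ (∫ x, Z x ∂μ) (Z x) ∂μ = ‖∫ x, Z x ∂μ‖ ^ 2 := by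
    rw [integral_inner hZ, real_inner_self_eq_norm_sq]
  have h2 : ∫ x, inner ℝ (∫ x, Z x ∂μ) (Z x) ∂μ ≤
      ∫ x, (‖∫ x, Z x ∂μ‖ ^ 2 / 2 + ‖Z x‖ ^ 2 / 2) ∂μ := by
    refine integral_mono (hZ.const_inner _) ((integrable_const _).add (hsq.div_const 2)) fun x => ?_
    have := real_inner_le_norm (∫ x, Z x ∂μ) (Z x)
    nlinarith [sq_nonneg (‖∫ x, Z x ∂μ‖ - ‖Z x‖)]
  rw [integral_add (integrable_const _) (hsq.div_const 2),
    show ∫ x, ‖Z x‖ ^ 2 / 2 ∂μ = (∫ x, ‖Z x‖ ^ 2 ∂μ) / 2 from integral_div 2 _] at h2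
  simp only [integral_const, probReal_univ, one_smul] at h2
  linarith

theorem norm_add_sq_le {V : Type*} [SeminormedAddCommGroup V] (a b : V) {x : ℝ} (hx : 0 < x) :
    ‖a + b‖ ^ 2 ≤ (1 + x) * ‖a‖ ^ 2 + (1 + 1 / x) * ‖b‖ ^ 2 := by
  have h1 := norm_add_le a b
  have h2 : ‖a + b‖ ^ 2 ≤ (‖a‖ + ‖b‖) ^ 2 := pow_le_pow_left₀ (norm_nonneg _) h1 2
  have h3 : 0 ≤ (x * ‖a‖ - ‖b‖) ^ 2 / x := by positivity
  have h4 : (x * ‖a‖ - ‖b‖) ^ 2 / x = x * ‖a‖ ^ 2 - 2 * ‖a‖ * ‖b‖ + 1 / x * ‖b‖ ^ 2 := by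
    field_simp; ring
  nlinarith

namespace Model

variable {l d n r s T : ℕ} {mdl : Model l d n r s T}

/-- The almost sure conditions on an outer sample, with explicit constants. -/
structure GoodSample (mdl : Model l d n r s T) (C₁ C₂ ε κ : ℝ) (u : E s) : Prop where
  G1_bound : ∀ lam ∈ mdl.Λ, ∫⁻ x, ∑ t, ‖mdl.G1 x (mdl.Y t) (mdl.θ u lam)‖ₑ ^ 2
    ∂(mdl.lawX (mdl.θ u lam)) ≤ ENNReal.ofReal C₁
  G2_bound : ∀ lam ∈ mdl.Λ, ∫⁻ x, ∑ t, ‖mdl.G2 x (mdl.Y t) (mdl.θ u lam)‖ₑ ^ 2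
    ∂(mdl.lawX (mdl.θ u lam)) ≤ ENNReal.ofReal C₂
  p_lower : ∀ lam ∈ mdl.Λ, ∀ t, ε ≤ mdl.p (mdl.Y t) (mdl.θ u lam)
  A_bound : ∀ lam ∈ mdl.Λ, ‖mdl.A u lam‖ ≤ κ
  ABC_bound : ∀ lam ∈ mdl.Λ, ‖mdl.A u lam (mdl.B u lam - mdl.C u lam)‖ ≤ κ
  score_lipschitz : ∀ lam ∈ mdl.Λ, ∀ lam' ∈ mdl.Λ, ∀ t,
    ‖mdl.score t (mdl.θ u lam) - mdl.score t (mdl.θ u lam')‖ ≤ κ * ‖lam - lam'‖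

theorem exists_goodSample (hreg : mdl.Regularity) :
    ∃ C₁ C₂ ε : ℝ, 0 ≤ C₁ ∧ 0 ≤ C₂ ∧ 0 < ε ∧ ε ≤ Real.sqrt C₂ ∧ ∃ κ : E s → ℝ, Measurable κ ∧
      Integrable (fun u => κ u ^ 4) mdl.lawU ∧
      ∀ᵐ u ∂mdl.lawU, mdl.GoodSample C₁ C₂ ε (κ u) u := by
  obtain ⟨C₁, hC₁, h1⟩ := hreg.G1_bound
  obtain ⟨C₂, hC₂, h2⟩ := hreg.G2_bound
  obtain ⟨ε, hε, h3⟩ := hreg.G2_lower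
  obtain ⟨κ, hκm, hκ4, h4⟩ := hreg.envelope
  -- Enlarging `C₂` secures `ε ≤ √C₂` also when there are no observations; with it, `contraction`
  -- equals `1 - α ε` as soon as `α √C₂ ≤ 1`.
  refine ⟨C₁, max C₂ (ε ^ 2), ε, hC₁.le, hC₂.le.trans (le_max_left _ _), hε,
    Real.le_sqrt_of_sq_le (le_max_right _ _), κ, hκm, hκ4, ?_⟩
  filter_upwards [h1, h2, h3, h4] with u h1 h2 h3 h4
  refine ⟨h1, fun lam hlam => (h2 lam hlam).trans (ENNReal.ofReal_le_ofReal (le_max_left _ _)),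
    fun lam hlam t => ?_, fun lam hlam => (h4 lam hlam).1,
    fun lam hlam => (h4 lam hlam).2.1, fun lam hlam => (h4 lam hlam).2.2⟩
  rw [← (hreg.G2_unbiased t _).2]
  exact h3 lam hlam t

/-- A bound of `|1 - α p|` for `p` between `ε` and `√C₂`. -/
def contraction (C₂ ε α : ℝ) : ℝ := max |1 - α * ε| |1 - α * Real.sqrt C₂|

theorem abs_one_sub_le_contraction {C₂ ε α p : ℝ} (hα : 0 < α) (h1 : ε ≤ p)
    (h2 : p ≤ Real.sqrt C₂) : |1 - α * p| ≤ contraction C₂ ε α := by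
  have h3 : α * ε ≤ α * p := by gcongr
  have h4 : α * p ≤ α * Real.sqrt C₂ := by gcongr
  rw [contraction, abs_le']
  exact ⟨le_max_of_le_left (by linarith [le_abs_self (1 - α * ε)]),
    le_max_of_le_right (by linarith [neg_abs_le (1 - α * Real.sqrt C₂)])⟩

theorem contraction_eq {C₂ ε α : ℝ} (hα : 0 < α) (h : ε ≤ Real.sqrt C₂)
    (h1 : α * Real.sqrt C₂ ≤ 1) : contraction C₂ ε α = 1 - α * ε := by
  have h3 : α * ε ≤ α * Real.sqrt C₂ := by gcongr
  rw [contraction, abs_of_nonneg (by linarith), abs_of_nonneg (by linarith)]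
  exact max_eq_left (by linarith)

namespace GoodSample

variable {C₁ C₂ ε κ : ℝ} {u : E s}

theorem κ_nonneg (h : mdl.GoodSample C₁ C₂ ε κ u) {lam : E l} (hlam : lam ∈ mdl.Λ) : 0 ≤ κ :=
  (norm_nonneg _).trans (h.A_bound lam hlam)

theorem G1_bound_single (h : mdl.GoodSample C₁ C₂ ε κ u) {lam : E l} (hlam : lam ∈ mdl.Λ)
    (t : Fin T) : ∫⁻ x, ‖mdl.G1 x (mdl.Y t) (mdl.θ u lam)‖ₑ ^ 2 ∂(mdl.lawX (mdl.θ u lam)) ≤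
      ENNReal.ofReal C₁ :=
  (lintegral_mono fun x => Finset.single_le_sum
    (f := fun t => ‖mdl.G1 x (mdl.Y t) (mdl.θ u lam)‖ₑ ^ 2) (fun _ _ => zero_le)
    (Finset.mem_univ t)).trans (h.G1_bound lam hlam)

theorem G2_bound_single (h : mdl.GoodSample C₁ C₂ ε κ u) {lam : E l} (hlam : lam ∈ mdl.Λ)
    (t : Fin T) : ∫⁻ x, ‖mdl.G2 x (mdl.Y t) (mdl.θ u lam)‖ₑ ^ 2 ∂(mdl.lawX (mdl.θ u lam)) ≤
      ENNReal.ofReal C₂ :=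
  (lintegral_mono fun x => Finset.single_le_sum
    (f := fun t => ‖mdl.G2 x (mdl.Y t) (mdl.θ u lam)‖ₑ ^ 2) (fun _ _ => zero_le)
    (Finset.mem_univ t)).trans (h.G2_bound lam hlam)

theorem norm_gradient_sq_le (h : mdl.GoodSample C₁ C₂ ε κ u) (hwell : mdl.WellPosed)
    (hreg : mdl.Regularity) (hC₁ : 0 ≤ C₁) {lam : E l} (hlam : lam ∈ mdl.Λ) (t : Fin T) :
    ‖gradient (mdl.p (mdl.Y t)) (mdl.θ u lam)‖ ^ 2 ≤ C₁ := by
  have := hwell.f_prob (mdl.θ u lam)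
  rw [← (hreg.G1_unbiased t _).2]
  exact norm_sq_integral_le (hreg.G1_unbiased t _).1 hC₁ (h.G1_bound_single hlam t)

theorem p_le (h : mdl.GoodSample C₁ C₂ ε κ u) (hwell : mdl.WellPosed)
    (hreg : mdl.Regularity) (hC₂ : 0 ≤ C₂) {lam : E l} (hlam : lam ∈ mdl.Λ) (t : Fin T) :
    mdl.p (mdl.Y t) (mdl.θ u lam) ≤ Real.sqrt C₂ := by
  have := hwell.f_prob (mdl.θ u lam)
  refine Real.le_sqrt_of_sq_le ?_
  have h1 := norm_sq_integral_le (hreg.G2_unbiased t _).1 hC₂ (h.G2_bound_single hlam t)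
  rwa [(hreg.G2_unbiased t _).2, Real.norm_eq_abs, sq_abs] at h1

theorem norm_score_le (h : mdl.GoodSample C₁ C₂ ε κ u) (hwell : mdl.WellPosed)
    (hreg : mdl.Regularity) (hC₁ : 0 ≤ C₁) (hε : 0 < ε) {lam : E l} (hlam : lam ∈ mdl.Λ)
    (t : Fin T) : ‖mdl.score t (mdl.θ u lam)‖ ≤ Real.sqrt C₁ / ε := by
  have h1 := h.p_lower lam hlam t
  have h2 := Real.le_sqrt_of_sq_le (h.norm_gradient_sq_le hwell hreg hC₁ hlam t)
  rw [score, norm_smul, norm_inv, Real.norm_of_nonneg (hε.le.trans h1), inv_mul_eq_div]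
  gcongr

theorem norm_h_le (h : mdl.GoodSample C₁ C₂ ε κ u) (hwell : mdl.WellPosed)
    (hreg : mdl.Regularity) (hC₁ : 0 ≤ C₁) (hε : 0 < ε) {lam : E l} (hlam : lam ∈ mdl.Λ) :
    ‖mdl.h u lam‖ ≤ κ * (T * (Real.sqrt C₁ / ε) + 1) := by
  have h0 := h.κ_nonneg hlam
  rw [Model.h, add_sub_assoc, map_add]
  refine (norm_add_le _ _).trans ?_
  have h1 : ‖∑ t, mdl.score t (mdl.θ u lam)‖ ≤ T * (Real.sqrt C₁ / ε) := by
    refine (norm_sum_le _ _).trans ((Finset.sum_le_sum fun t _ =>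
      h.norm_score_le hwell hreg hC₁ hε hlam t).trans ?_)
    simp
  have h2 := ((mdl.A u lam).le_opNorm (∑ t, mdl.score t (mdl.θ u lam))).trans
    (mul_le_mul (h.A_bound lam hlam) h1 (norm_nonneg _) h0)
  have h3 := h.ABC_bound lam hlam
  linarith

theorem norm_A_direction_le (h : mdl.GoodSample C₁ C₂ ε κ u) {lam : E l} (hlam : lam ∈ mdl.Λ)
    (D : Fin T → E d) :
    ‖mdl.A u lam ((∑ t, D t) + mdl.B u lam - mdl.C u lam)‖ ≤ κ * (1 + ∑ t, ‖D t‖) := by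
  have h0 := h.κ_nonneg hlam
  rw [add_sub_assoc, map_add]
  refine (norm_add_le _ _).trans ?_
  have h2 := ((mdl.A u lam).le_opNorm (∑ t, D t)).trans
    (mul_le_mul (h.A_bound lam hlam) (norm_sum_le _ _) (norm_nonneg _) h0)
  have h3 := h.ABC_bound lam hlam
  linarith

/-- The mean square of the updated block around any point, given the current state. -/
theorem lintegral_nextBlock_sub_le (h : mdl.GoodSample C₁ C₂ ε κ u) (hwell : mdl.WellPosed)
    (hreg : mdl.Regularity) (hC₁ : 0 ≤ C₁) (hC₂ : 0 ≤ C₂) {lam : E l} (hlam : lam ∈ mdl.Λ)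
    (t : Fin T) (D s' : E d) (α : ℝ) {N : ℕ} (hN : 1 ≤ N) :
    ∫⁻ x : Fin N → E n, ‖mdl.nextBlock α x t (mdl.θ u lam) D - s'‖ₑ ^ 2
        ∂(Measure.pi fun _ => mdl.lawX (mdl.θ u lam)) ≤
      ENNReal.ofReal (‖D + α • (gradient (mdl.p (mdl.Y t)) (mdl.θ u lam) -
        mdl.p (mdl.Y t) (mdl.θ u lam) • D) - s'‖ ^ 2 +
        α ^ 2 / N * (2 * (C₁ + C₂ * ‖D‖ ^ 2))) := by
  set ϑ := mdl.θ u lam with hϑ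
  have := hwell.f_prob ϑ
  let Z : E n → E d := fun x => mdl.G1 x (mdl.Y t) ϑ - mdl.G2 x (mdl.Y t) ϑ • D
  have hpair : Measurable fun x : E n => (x, ϑ) := measurable_id.prodMk measurable_const
  have hG1 : Measurable fun x => mdl.G1 x (mdl.Y t) ϑ := (hwell.G1_measurable t).comp hpair
  have hG2 : Measurable fun x => mdl.G2 x (mdl.Y t) ϑ := (hwell.G2_measurable t).comp hpair
  have hZ : Measurable Z := hG1.sub (hG2.smul_const D)
  have hZmean : ∫ x, Z x ∂(mdl.lawX ϑ) =
      gradient (mdl.p (mdl.Y t)) ϑ - mdl.p (mdl.Y t) ϑ • D := by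
    obtain ⟨h1, h2⟩ := hreg.G1_unbiased t ϑ
    obtain ⟨h3, h4⟩ := hreg.G2_unbiased t ϑ
    simp only [Z]
    rw [integral_sub h1 (h3.smul_const D), h2, integral_smul_const, h4]
  have hZsq : ∫⁻ x, ‖Z x‖ₑ ^ 2 ∂(mdl.lawX ϑ) ≤
      ENNReal.ofReal (2 * (C₁ + C₂ * ‖D‖ ^ 2)) := by
    have hpt : ∀ x, ‖Z x‖ₑ ^ 2 ≤ ENNReal.ofReal 2 * ‖mdl.G1 x (mdl.Y t) ϑ‖ₑ ^ 2 +
        ENNReal.ofReal (2 * ‖D‖ ^ 2) * ‖mdl.G2 x (mdl.Y t) ϑ‖ₑ ^ 2 := by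
      intro x
      rw [← ofReal_norm_sq, ← ofReal_norm_sq, ← ofReal_norm_sq, ← ENNReal.ofReal_mul (by norm_num),
        ← ENNReal.ofReal_mul (by positivity), ← ENNReal.ofReal_add (by positivity) (by positivity)]
      refine ENNReal.ofReal_le_ofReal ?_
      have h3 := norm_sub_le (mdl.G1 x (mdl.Y t) ϑ) (mdl.G2 x (mdl.Y t) ϑ • D)
      rw [norm_smul] at h3
      have h4 : ‖Z x‖ ^ 2 ≤ _ := pow_le_pow_left₀ (norm_nonneg _) h3 2
      nlinarith [sq_nonneg (‖mdl.G1 x (mdl.Y t) ϑ‖ - ‖mdl.G2 x (mdl.Y t) ϑ‖ * ‖D‖)]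
    calc ∫⁻ x, ‖Z x‖ₑ ^ 2 ∂(mdl.lawX ϑ)
        ≤ ∫⁻ x, (ENNReal.ofReal 2 * ‖mdl.G1 x (mdl.Y t) ϑ‖ₑ ^ 2 +
            ENNReal.ofReal (2 * ‖D‖ ^ 2) * ‖mdl.G2 x (mdl.Y t) ϑ‖ₑ ^ 2) ∂(mdl.lawX ϑ) :=
          lintegral_mono hpt
      _ = ENNReal.ofReal 2 * ∫⁻ x, ‖mdl.G1 x (mdl.Y t) ϑ‖ₑ ^ 2 ∂(mdl.lawX ϑ) +
          ENNReal.ofReal (2 * ‖D‖ ^ 2) *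
            ∫⁻ x, ‖mdl.G2 x (mdl.Y t) ϑ‖ₑ ^ 2 ∂(mdl.lawX ϑ) := by
          rw [lintegral_add_left ((hG1.enorm.pow_const 2).const_mul _),
            lintegral_const_mul _ (hG1.enorm.pow_const 2),
            lintegral_const_mul _ (hG2.enorm.pow_const 2)]
      _ ≤ ENNReal.ofReal 2 * ENNReal.ofReal C₁ + ENNReal.ofReal (2 * ‖D‖ ^ 2) * ENNReal.ofReal C₂ := by
          gcongr
          · exact h.G1_bound_single hlam t
          · exact h.G2_bound_single hlam t
      _ = ENNReal.ofReal (2 * (C₁ + C₂ * ‖D‖ ^ 2)) := by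
          rw [← ENNReal.ofReal_mul (by norm_num),
            ← ENNReal.ofReal_mul (by positivity),
            ← ENNReal.ofReal_add (by positivity) (by positivity)]
          congr 1; ring
  have hstep : ∀ x : Fin N → E n, mdl.nextBlock α x t ϑ D - s' =
      (D - s') + α • ((N : ℝ)⁻¹ • ∑ i, Z (x i)) := by
    intro x
    simp only [nextBlock, G1bar, G2bar, Z, Finset.sum_sub_distrib, ← Finset.sum_smul, smul_sub,
      smul_smul]
    abel
  simp only [hstep]
  refine (lintegral_enorm_sq_add_average_le hZ hZsq (by positivity) (D - s') α hN).trans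
    (le_of_eq ?_)
  rw [hZmean, show D - s' + α • (gradient (mdl.p (mdl.Y t)) ϑ - mdl.p (mdl.Y t) ϑ • D) =
    D + α • (gradient (mdl.p (mdl.Y t)) ϑ - mdl.p (mdl.Y t) ϑ • D) - s' by abel]

/-- The mean update is `(1 - α p) D + α ∇p`. Young's inequality with weight `α ε` spoils the
contraction only by the factor `1 + α ε` and leaves a forcing of order `α`, as the recursion
requires. -/
theorem norm_mean_block_sq_le (h : mdl.GoodSample C₁ C₂ ε κ u) (hwell : mdl.WellPosed)
    (hreg : mdl.Regularity) (hC₁ : 0 ≤ C₁) (hC₂ : 0 ≤ C₂) (hε : 0 < ε) {lam : E l}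
    (hlam : lam ∈ mdl.Λ) (t : Fin T) (D : E d) {α : ℝ} (hα : 0 < α) :
    ‖D + α • (gradient (mdl.p (mdl.Y t)) (mdl.θ u lam) - mdl.p (mdl.Y t) (mdl.θ u lam) • D)‖ ^ 2 ≤
      (1 + α * ε) * contraction C₂ ε α ^ 2 * ‖D‖ ^ 2 + (1 + 1 / (α * ε)) * (α ^ 2 * C₁) := by
  set p := mdl.p (mdl.Y t) (mdl.θ u lam)
  set g := gradient (mdl.p (mdl.Y t)) (mdl.θ u lam)
  have h1 := abs_one_sub_le_contraction hα (h.p_lower lam hlam t)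
    (h.p_le hwell hreg hC₂ hlam t)
  have h2 : D + α • (g - p • D) = (1 - α * p) • D + α • g := by
    rw [sub_smul, one_smul, smul_sub, smul_smul]; abel
  rw [h2]
  refine (norm_add_sq_le _ _ (mul_pos hα hε)).trans ?_
  rw [norm_smul, norm_smul, Real.norm_eq_abs, Real.norm_of_nonneg hα.le, mul_pow, mul_pow,
    mul_assoc (1 + α * ε)]
  have h3 : |1 - α * p| ^ 2 ≤ contraction C₂ ε α ^ 2 := pow_le_pow_left₀ (abs_nonneg _) h1 2
  have h4 := h.norm_gradient_sq_le hwell hreg hC₁ hlam t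
  have : 0 < α * ε := mul_pos hα hε
  gcongr

/-- Since `∇p = p • score`, the score is the fixed point of the mean update, and the error is
multiplied by exactly `1 - α p`. What remains is the drift of the score from `lam` to `lam'`, which
Young's inequality charges with `1 / (α ε)`. -/
theorem norm_mean_block_sub_score_sq_le (h : mdl.GoodSample C₁ C₂ ε κ u) (hwell : mdl.WellPosed)
    (hreg : mdl.Regularity) (hC₂ : 0 ≤ C₂) (hε : 0 < ε) {lam lam' : E l}
    (hlam : lam ∈ mdl.Λ) (hlam' : lam' ∈ mdl.Λ) (t : Fin T) (D : E d) {α : ℝ} (hα : 0 < α) :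
    ‖D + α • (gradient (mdl.p (mdl.Y t)) (mdl.θ u lam) - mdl.p (mdl.Y t) (mdl.θ u lam) • D) -
        mdl.score t (mdl.θ u lam')‖ ^ 2 ≤
      (1 + α * ε) * contraction C₂ ε α ^ 2 * ‖D - mdl.score t (mdl.θ u lam)‖ ^ 2 +
        (1 + 1 / (α * ε)) * (κ * ‖lam - lam'‖) ^ 2 := by
  have h1 := abs_one_sub_le_contraction hα (h.p_lower lam hlam t)
    (h.p_le hwell hreg hC₂ hlam t)
  have hg : gradient (mdl.p (mdl.Y t)) (mdl.θ u lam) =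
      mdl.p (mdl.Y t) (mdl.θ u lam) • mdl.score t (mdl.θ u lam) := by
    rw [score, smul_smul, mul_inv_cancel₀ (hreg.p_pos t _).ne', one_smul]
  rw [hg]
  set p := mdl.p (mdl.Y t) (mdl.θ u lam)
  set sc := mdl.score t (mdl.θ u lam)
  set sc' := mdl.score t (mdl.θ u lam')
  have h2 : D + α • (p • sc - p • D) - sc' = (1 - α * p) • (D - sc) + (sc - sc') := by
    rw [sub_smul, one_smul, smul_sub, smul_sub, smul_smul, smul_smul]; abel
  rw [h2]
  refine (norm_add_sq_le _ _ (mul_pos hα hε)).trans ?_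
  rw [norm_smul, Real.norm_eq_abs, mul_pow, mul_assoc (1 + α * ε)]
  have h3 : |1 - α * p| ^ 2 ≤ contraction C₂ ε α ^ 2 := pow_le_pow_left₀ (abs_nonneg _) h1 2
  have h4 := h.score_lipschitz lam hlam lam' hlam' t
  have : 0 < α * ε := mul_pos hα hε
  gcongr

end GoodSample

end Model


/-! ### Size of the search direction and of one move of the parameter. -/

theorem one_add_sum_sq_le {T : ℕ} (x : Fin T → ℝ) :
    (1 + ∑ t, x t) ^ 2 ≤ (T + 1) * (1 + ∑ t, x t ^ 2) := by
  have h1 : (∑ t, x t) ^ 2 ≤ T * ∑ t, x t ^ 2 := by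
    simpa using sq_sum_le_card_mul_sum_sq (s := Finset.univ) (f := x)
  have h2 : 2 * ∑ t, x t ≤ T + ∑ t, x t ^ 2 := by
    calc 2 * ∑ t, x t = ∑ t, 2 * x t := Finset.mul_sum _ _ _
      _ ≤ ∑ t, (1 + x t ^ 2) := Finset.sum_le_sum fun t _ => by nlinarith [sq_nonneg (x t - 1)]
      _ = T + ∑ t, x t ^ 2 := by simp [Finset.sum_add_distrib]
  nlinarith

namespace Model

variable {l d n r s T : ℕ} {mdl : Model l d n r s T}

/-- Cauchy–Schwarz over `m` and over `t`. The square goes inside the average, so the envelope of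
each sample stays attached to the blocks of that sample; this is why weighted block moments are
needed. -/
theorem norm_direction_sq_le {C₁ C₂ ε : ℝ} {κ : E s → ℝ} {M : ℕ} {u : Fin M → E s}
    (hgood : ∀ m, mdl.GoodSample C₁ C₂ ε (κ (u m)) (u m)) {lam : E l} (hlam : lam ∈ mdl.Λ)
    (D : Fin M → Fin T → E d) :
    ‖mdl.direction u lam D‖ ^ 2 ≤
      (M : ℝ)⁻¹ * ∑ m, κ (u m) ^ 2 * ((T + 1) * (1 + ∑ t, ‖D m t‖ ^ 2)) := by
  rcases Nat.eq_zero_or_pos M with rfl | hM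
  · simp [direction]
  have hM0 : (0 : ℝ) < M := by exact_mod_cast hM
  set v : Fin M → E l := fun m =>
    mdl.A (u m) lam ((∑ t, D m t) + mdl.B (u m) lam - mdl.C (u m) lam) with hv
  have h1 : ‖mdl.direction u lam D‖ ≤ (M : ℝ)⁻¹ * ∑ m, ‖v m‖ := by
    rw [direction, norm_smul, Real.norm_of_nonneg (inv_pos.2 hM0).le]
    gcongr
    exact norm_sum_le _ _
  have h2 : (∑ m, ‖v m‖) ^ 2 ≤ M * ∑ m, ‖v m‖ ^ 2 := by
    simpa using sq_sum_le_card_mul_sum_sq (s := Finset.univ) (f := fun m => ‖v m‖)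
  have h3 : ∀ m, ‖v m‖ ^ 2 ≤ κ (u m) ^ 2 * ((T + 1) * (1 + ∑ t, ‖D m t‖ ^ 2)) := by
    intro m
    calc ‖v m‖ ^ 2 ≤ (κ (u m) * (1 + ∑ t, ‖D m t‖)) ^ 2 :=
          pow_le_pow_left₀ (norm_nonneg _) ((hgood m).norm_A_direction_le hlam (D m)) 2
      _ = κ (u m) ^ 2 * (1 + ∑ t, ‖D m t‖) ^ 2 := mul_pow _ _ _
      _ ≤ _ := by gcongr; exact one_add_sum_sq_le _
  calc ‖mdl.direction u lam D‖ ^ 2 ≤ ((M : ℝ)⁻¹ * ∑ m, ‖v m‖) ^ 2 :=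
        pow_le_pow_left₀ (norm_nonneg _) h1 2
    _ = (M : ℝ)⁻¹ ^ 2 * (∑ m, ‖v m‖) ^ 2 := mul_pow _ _ _
    _ ≤ (M : ℝ)⁻¹ ^ 2 * (M * ∑ m, ‖v m‖ ^ 2) := by gcongr
    _ = (M : ℝ)⁻¹ * ∑ m, ‖v m‖ ^ 2 := by field_simp
    _ ≤ _ := by gcongr with m; exact h3 m

/-- A point of `Λ` is its own projection, so the move is a difference of two projections. -/
theorem norm_sub_nextLam_le (hwell : mdl.WellPosed) (hlip : mdl.LipschitzGradient) {M : ℕ}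
    (u : Fin M → E s) (z : E l × (Fin M → Fin T → E d)) (hz : z.1 ∈ mdl.Λ) {βk : ℝ}
    (hβ : 0 ≤ βk) : ‖z.1 - mdl.nextLam βk u z‖ ≤ βk * ‖mdl.direction u z.1 z.2‖ := by
  have hne := hwell.interior_nonempty.mono interior_subset
  have h1 := norm_proj_sub_proj_le hlip.compact hne hwell.convex z.1
    (z.1 + βk • mdl.direction u z.1 z.2)
  rw [proj_of_mem hlip.compact hwell.convex hz] at h1
  refine h1.trans (le_of_eq ?_)
  rw [sub_add_cancel_left, norm_neg, norm_smul, Real.norm_of_nonneg hβ]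

end Model

namespace Run

variable {l d n r s T : ℕ} {mdl : Model l d n r s T} {M N : ℕ} {α β : ℕ → ℝ} {R : ℝ}
  {Ω : Type*} [MeasurableSpace Ω] {P : Measure Ω}

theorem measurePreserving_u (ρ : Run mdl M N α β R P) (m : Fin M) :
    MeasurePreserving (ρ.u m) P mdl.lawU := ⟨ρ.u_measurable m, ρ.u_law m⟩

theorem ae_forall_u (ρ : Run mdl M N α β R P) {p : E s → Prop} (hp : ∀ᵐ u ∂mdl.lawU, p u) :
    ∀ᵐ ω ∂P, ∀ m, p (ρ.outer ω m) :=
  ae_all_iff.2 fun m => (ρ.measurePreserving_u m).quasiMeasurePreserving.ae hp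

theorem measurable_block (ρ : Run mdl M N α β R P) (hwell : mdl.WellPosed)
    (hlip : mdl.LipschitzGradient) (k : ℕ) (m : Fin M) (t : Fin T) :
    Measurable fun ω => (ρ.state k ω).2 m t := by
  have := ρ.measurable_state hwell hlip k
  fun_prop

end Run

/-- With `x = α ε` the left side is `(1 + x)(1 - x)² = 1 - x - x²(1 - x)`: the Young factor consumes
half of the contraction `1 - 2x + x²`. -/
theorem one_add_mul_contraction_sq_le {C₂ ε α : ℝ} (hα : 0 < α) (hε : 0 < ε)
    (h : ε ≤ Real.sqrt C₂) (h1 : α * Real.sqrt C₂ ≤ 1) :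
    (1 + α * ε) * Model.contraction C₂ ε α ^ 2 ≤ 1 - ε * α := by
  rw [Model.contraction_eq hα h h1]
  have h2 : 0 < α * ε := mul_pos hα hε
  have h3 : α * ε ≤ 1 := le_trans (by gcongr) h1
  have h4 : (1 + α * ε) * (1 - α * ε) ^ 2 = (1 - ε * α) - (α * ε) ^ 2 * (1 - α * ε) := by ring
  rw [h4]
  nlinarith [mul_nonneg (sq_nonneg (α * ε)) (sub_nonneg.2 h3)]

/-! ### The fast time scale: block moments and tracking error. -/

variable {l d n r s T : ℕ} {mdl : Model l d n r s T}

/-- The blocks `D_{k,m,t}` have bounded second moments, also when weighted by an integrable function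
of the outer samples. -/
theorem exists_block_moment_bound.{v} (hwell : mdl.WellPosed) (hlip : mdl.LipschitzGradient)
    (hreg : mdl.Regularity) {α β : ℕ → ℝ} {a b α₀ β₀ : ℝ} (hstep : StepSizes α β a b α₀ β₀)
    {C₁ C₂ ε : ℝ} {κ : E s → ℝ} (hC₁ : 0 ≤ C₁) (hC₂ : 0 ≤ C₂) (hε : 0 < ε)
    (hεC : ε ≤ Real.sqrt C₂) (hgood : ∀ᵐ u ∂mdl.lawU, mdl.GoodSample C₁ C₂ ε (κ u) u)
    (R : ℝ) {Φ : ℝ} (hΦ : 0 ≤ Φ) :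
    ∃ C : ℝ, 0 ≤ C ∧ ∀ (M N : ℕ), 1 ≤ N → ∀ (Ω : Type v) [MeasurableSpace Ω] (P : Measure Ω)
      [IsProbabilityMeasure P] (ρ : Run mdl M N α β R P) (m : Fin M) (t : Fin T)
      (φ : (Fin M → E s) → ENNReal), Measurable φ →
      ∫⁻ ω, φ (ρ.outer ω) ∂P ≤ ENNReal.ofReal Φ → ∀ k : ℕ,
        ∫⁻ ω, φ (ρ.outer ω) * ‖(ρ.state k ω).2 m t‖ₑ ^ 2 ∂P ≤ ENNReal.ofReal C := by
  obtain ⟨Amax, hAmax, hαA⟩ := hstep.α_bdd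
  -- In one step the weighted mean square of a block is multiplied by at most `p k` and increased by
  -- at most `q k` times the mass of the weight. Both contain the square of the mean update and the
  -- batch variance, the latter at its worst value `N = 1`.
  let p : ℕ → ℝ := fun k =>
    (1 + α k * ε) * Model.contraction C₂ ε (α k) ^ 2 + 2 * C₂ * α k ^ 2
  let q : ℕ → ℝ := fun k => (1 + 1 / (α k * ε)) * (α k ^ 2 * C₁) + 2 * C₁ * α k ^ 2
  have hp : ∀ k, 0 ≤ p k := fun k => by have := hstep.α_pos k; positivity
  have hq : ∀ k, 0 ≤ q k := fun k => by have := hstep.α_pos k; positivity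
  -- The variance term `2 C₂ α_k²` is absorbed by half of the remaining contraction.
  have hpe : ∀ᶠ k in Filter.atTop, p k ≤ 1 - ε / 2 * α k := by
    have h1 := (hstep.tendsto_α.mul_const (Real.sqrt C₂)).eventually
      (gt_mem_nhds (show 0 * Real.sqrt C₂ < 1 by simp))
    have h2 := (hstep.tendsto_α.const_mul (2 * C₂)).eventually
      (gt_mem_nhds (show 2 * C₂ * 0 < ε / 2 by simpa using hε))
    filter_upwards [h1, h2] with k h1 h2
    have h3 := one_add_mul_contraction_sq_le (hstep.α_pos k) hε hεC h1.le
    have h4 := mul_le_mul_of_nonneg_right h2.le (hstep.α_pos k).le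
    simp only [p]
    nlinarith
  -- Boundedness is the comparison with the constant sequence `w = 1`, which does not decay, so `c =
  -- 0`.
  obtain ⟨C, hC0, hC⟩ := exists_rate_bound (η := α) (μ := ε / 2) (c := 0)
    (ν := (C₁ / ε + 3 * C₁ * Amax) * Φ) (B₀ := R ^ 2 * Φ) (p := p) (v := fun _ => 1)
    (Rb := fun k => q k * Φ) hstep.α₀_pos hstep.a_pos hstep.α_eq (by positivity) le_rfl
    (by positivity) (Or.inl hstep.a_lt_one) hp (fun _ => one_pos) (by positivity) hpe
  refine ⟨C, hC0, fun M N hN Ω _ P _ ρ m t φ hφ hφi k => ?_⟩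
  have hmain := hC (fun _ => 1) (fun k => q k * Φ) (fun _ => le_rfl)
    (fun k => mul_nonneg (hq k) hΦ) (fun _ => le_rfl) (fun k _ => ?_) (fun k _ => by simp)
    (fun k => ∫⁻ ω, φ (ρ.outer ω) * ‖(ρ.state k ω).2 m t‖ₑ ^ 2 ∂P) ?_ ?_ k
  · simpa using hmain
  · have hα := hstep.α_pos k
    have : q k ≤ α k * (C₁ / ε + 3 * C₁ * Amax) := by
      have h1 : q k = α k * (C₁ / ε + 3 * C₁ * α k) := by simp only [q]; field_simp; ring
      rw [h1]
      have := hαA k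
      gcongr
    calc q k * Φ ≤ α k * (C₁ / ε + 3 * C₁ * Amax) * Φ := by gcongr
      _ = _ := by ring
  · have h1 : ∀ ω, φ (ρ.outer ω) * ‖(ρ.state 0 ω).2 m t‖ₑ ^ 2 ≤
        φ (ρ.outer ω) * ENNReal.ofReal (R ^ 2) := by
      intro ω
      rw [← ofReal_norm_sq]
      gcongr
      exact ρ.D0_bound m t ω
    refine (lintegral_mono h1).trans ?_
    have h2 : Measurable fun ω => φ (ρ.outer ω) := hφ.comp ρ.measurable_outer
    rw [lintegral_mul_const _ h2, mul_comm,
      ENNReal.ofReal_mul (sq_nonneg R)]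
    gcongr
  · intro k
    have hΨ : Measurable
        fun z : ((Fin M → E s) × (E l × (Fin M → Fin T → E d))) × (Fin N → E n) =>
          φ z.1.1 * ‖mdl.nextBlock (α k) z.2 t (mdl.θ (z.1.1 m) z.1.2.1) (z.1.2.2 m t)‖ₑ ^ 2 := by
      have h1 : Measurable
          fun z : ((Fin M → E s) × (E l × (Fin M → Fin T → E d))) × (Fin N → E n) =>
            (z.1.1 m, z.1.2.1) := by fun_prop
      have h2 := hwell.θ_measurable.comp h1
      have h3 : Measurable
          fun z : ((Fin M → E s) × (E l × (Fin M → Fin T → E d))) × (Fin N → E n) =>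
            z.1.2.2 m t := by fun_prop
      have h4 := (Model.measurable_nextBlock hwell (N := N) (α k) t).comp
        (measurable_snd.prodMk (h2.prodMk h3))
      simp only [Function.comp_def] at h4
      exact (hφ.comp (measurable_fst.comp measurable_fst)).mul (h4.enorm.pow_const 2)
    have hbatch := ρ.lintegral_batch hwell hlip k m (Ψ := fun u z x =>
      φ u * ‖mdl.nextBlock (α k) x t (mdl.θ (u m) z.1) (z.2 m t)‖ₑ ^ 2) hΨ
    calc ∫⁻ ω, φ (ρ.outer ω) * ‖(ρ.state (k + 1) ω).2 m t‖ₑ ^ 2 ∂P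
        = ∫⁻ ω, ∫⁻ x, φ (ρ.outer ω) * ‖mdl.nextBlock (α k) x t
            (mdl.θ (ρ.outer ω m) (ρ.state k ω).1) ((ρ.state k ω).2 m t)‖ₑ ^ 2
            ∂(Measure.pi fun _ : Fin N => mdl.lawX (mdl.θ (ρ.u m ω) (ρ.state k ω).1)) ∂P := by
          rw [← hbatch]
          rfl
      _ ≤ ∫⁻ ω, (ENNReal.ofReal (p k) * (φ (ρ.outer ω) * ‖(ρ.state k ω).2 m t‖ₑ ^ 2) +
            ENNReal.ofReal (q k) * φ (ρ.outer ω)) ∂P := by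
          refine lintegral_mono_ae ?_
          filter_upwards [ρ.ae_forall_u hgood] with ω hω
          have hlam := ρ.state_fst_mem hwell hlip k ω
          have hxm : Measurable fun x : Fin N → E n => mdl.nextBlock (α k) x t
              (mdl.θ (ρ.outer ω m) (ρ.state k ω).1) ((ρ.state k ω).2 m t) := by
            have := (Model.measurable_nextBlock hwell (N := N) (α k) t).comp
              (measurable_id.prodMk (measurable_const (a :=
                (mdl.θ (ρ.outer ω m) (ρ.state k ω).1, (ρ.state k ω).2 m t))))
            simpa only [Function.comp_def, id] using this
          -- The weight is a function of the outer samples, hence a constant for the batch integral.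
          rw [lintegral_const_mul _ (hxm.enorm.pow_const 2)]
          have h1 := (hω m).lintegral_nextBlock_sub_le hwell hreg hC₁ hC₂ hlam t
            ((ρ.state k ω).2 m t) 0 (α k) hN
          simp only [sub_zero] at h1
          have h2 := (hω m).norm_mean_block_sq_le hwell hreg hC₁ hC₂ hε hlam t
            ((ρ.state k ω).2 m t) (hstep.α_pos k)
          have h3 : α k ^ 2 / N * (2 * (C₁ + C₂ * ‖(ρ.state k ω).2 m t‖ ^ 2)) ≤
              α k ^ 2 * (2 * (C₁ + C₂ * ‖(ρ.state k ω).2 m t‖ ^ 2)) := by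
            have : (1 : ℝ) ≤ N := by exact_mod_cast hN
            gcongr
            exact div_le_self (sq_nonneg _) this
          calc _ ≤ φ (ρ.outer ω) * ENNReal.ofReal
                (p k * ‖(ρ.state k ω).2 m t‖ ^ 2 + q k) := by
                gcongr
                refine h1.trans (ENNReal.ofReal_le_ofReal ?_)
                simp only [p, q]
                linarith
            _ = _ := by
                rw [ENNReal.ofReal_add (mul_nonneg (hp k) (sq_nonneg _)) (hq k),
                  ENNReal.ofReal_mul (hp k), ofReal_norm_sq]
                ring
      _ = ENNReal.ofReal (p k) * ∫⁻ ω, φ (ρ.outer ω) * ‖(ρ.state k ω).2 m t‖ₑ ^ 2 ∂P +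
            ENNReal.ofReal (q k) * ∫⁻ ω, φ (ρ.outer ω) ∂P := by
          have h1 : Measurable fun ω => φ (ρ.outer ω) := hφ.comp ρ.measurable_outer
          have h2 := ((ρ.measurable_block hwell hlip k m t).enorm).pow_const 2
          have h3 : Measurable fun ω => φ (ρ.outer ω) * ‖(ρ.state k ω).2 m t‖ₑ ^ 2 := h1.mul h2
          rw [lintegral_add_right _ (h1.const_mul _), lintegral_const_mul _ h3,
            lintegral_const_mul _ h1]
      _ ≤ _ := by
          rw [ENNReal.ofReal_mul (hq k)]
          gcongr


namespace Run

variable {M N : ℕ} {α β : ℕ → ℝ} {R : ℝ} {Ω : Type*} [MeasurableSpace Ω] {P : Measure Ω}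

/-- The tracking error `D_{k,m,t} - ∇_θ log p(Y_t | θ_{k,m})`. -/
def err (ρ : Run mdl M N α β R P) (k : ℕ) (m : Fin M) (t : Fin T) (ω : Ω) : E d :=
  (ρ.state k ω).2 m t - mdl.score t (mdl.θ (ρ.outer ω m) (ρ.state k ω).1)

theorem measurable_err (ρ : Run mdl M N α β R P) (hwell : mdl.WellPosed)
    (hlip : mdl.LipschitzGradient) (hreg : mdl.Regularity) (k : ℕ) (m : Fin M) (t : Fin T) :
    Measurable (ρ.err k m t) := by
  have h1 : Measurable fun ω => (ρ.outer ω m, (ρ.state k ω).1) :=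
    (ρ.u_measurable m).prodMk (ρ.measurable_state hwell hlip k).fst
  have h2 := (Model.continuous_score hreg t).measurable.comp (hwell.θ_measurable.comp h1)
  simp only [Function.comp_def] at h2
  exact (ρ.measurable_block hwell hlip k m t).sub h2

/-- From `2 κ² κ'² ≤ κ⁴ + κ'⁴`; independence is not used, so `m = m'` is included. -/
theorem lintegral_sq_mul_sq_le (ρ : Run mdl M N α β R P) {κ : E s → ℝ} (hκ : Measurable κ)
    (hκ4 : Integrable (fun u => κ u ^ 4) mdl.lawU) (m m' : Fin M) :
    ∫⁻ ω, ENNReal.ofReal (κ (ρ.outer ω m) ^ 2 * κ (ρ.outer ω m') ^ 2) ∂P ≤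
      ENNReal.ofReal (∫ u, κ u ^ 4 ∂mdl.lawU) := by
  have h1 : ∀ m, ∫⁻ ω, ENNReal.ofReal (κ (ρ.outer ω m) ^ 4 / 2) ∂P =
      ENNReal.ofReal ((∫ u, κ u ^ 4 ∂mdl.lawU) / 2) := by
    intro m
    have h2 := (ρ.measurePreserving_u m).lintegral_comp
      (f := fun u => ENNReal.ofReal (κ u ^ 4 / 2)) (by fun_prop)
    refine h2.trans ?_
    rw [← integral_div, ofReal_integral_eq_lintegral_ofReal (hκ4.div_const 2)
      (Filter.Eventually.of_forall fun u => by positivity)]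
  calc ∫⁻ ω, ENNReal.ofReal (κ (ρ.outer ω m) ^ 2 * κ (ρ.outer ω m') ^ 2) ∂P
      ≤ ∫⁻ ω, (ENNReal.ofReal (κ (ρ.outer ω m) ^ 4 / 2) +
          ENNReal.ofReal (κ (ρ.outer ω m') ^ 4 / 2)) ∂P := by
        refine lintegral_mono fun ω => ?_
        rw [← ENNReal.ofReal_add (by positivity) (by positivity)]
        refine ENNReal.ofReal_le_ofReal ?_
        nlinarith [sq_nonneg (κ (ρ.outer ω m) ^ 2 - κ (ρ.outer ω m') ^ 2)]
    _ = ENNReal.ofReal (∫ u, κ u ^ 4 ∂mdl.lawU) := by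
        have h3 : Measurable fun ω => ENNReal.ofReal (κ (ρ.outer ω m) ^ 4 / 2) := by
          have : Measurable fun ω => κ (ρ.outer ω m) := hκ.comp (ρ.u_measurable m)
          exact ((this.pow_const 4).div_const 2).ennreal_ofReal
        have h0 : 0 ≤ ∫ u, κ u ^ 4 ∂mdl.lawU := integral_nonneg fun u => by positivity
        rw [lintegral_add_left h3, h1, h1, ← ENNReal.ofReal_add (by positivity) (by positivity),
          add_halves]

end Run

/-- The mean square of the tracking error, up to a constant. -/
theorem exists_err_sq_bound.{v} (hwell : mdl.WellPosed) (hlip : mdl.LipschitzGradient)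
    (hreg : mdl.Regularity) {α β : ℕ → ℝ} {a b α₀ β₀ : ℝ} (hstep : StepSizes α β a b α₀ β₀)
    {C₁ C₂ ε : ℝ} {κ : E s → ℝ} (hC₁ : 0 ≤ C₁) (hC₂ : 0 ≤ C₂) (hε : 0 < ε)
    (hεC : ε ≤ Real.sqrt C₂) (hκ : Measurable κ)
    (hκ4 : Integrable (fun u => κ u ^ 4) mdl.lawU)
    (hgood : ∀ᵐ u ∂mdl.lawU, mdl.GoodSample C₁ C₂ ε (κ u) u) (R : ℝ) :
    ∃ C : ℝ, 0 ≤ C ∧ ∀ (M N : ℕ), 1 ≤ N → ∀ (Ω : Type v) [MeasurableSpace Ω] (P : Measure Ω)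
      [IsProbabilityMeasure P] (ρ : Run mdl M N α β R P) (m : Fin M) (t : Fin T) (k : ℕ),
        ∫⁻ ω, ‖ρ.err k m t ω‖ₑ ^ 2 ∂P ≤
          ENNReal.ofReal (C * (β k / α k + Real.sqrt (α k / N)) ^ 2) := by
  obtain ⟨Amax, hAmax, hαA⟩ := hstep.α_bdd
  set K4 := ∫ u, κ u ^ 4 ∂mdl.lawU with hK4
  have hK40 : 0 ≤ K4 := integral_nonneg fun u => by positivity
  -- Two kinds of weight occur: products of squared envelopes, of mass at most `K4`, in the drift of
  -- the parameter, and the weight `1` in the batch variance.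
  obtain ⟨CD, hCD0, hCD⟩ := exists_block_moment_bound.{v} hwell hlip hreg hstep hC₁ hC₂ hε hεC
    hgood R hK40
  obtain ⟨CE, hCE0, hCE⟩ := exists_block_moment_bound.{v} hwell hlip hreg hstep hC₁ hC₂ hε hεC
    hgood R zero_le_one
  let p : ℕ → ℝ := fun k => (1 + α k * ε) * Model.contraction C₂ ε (α k) ^ 2
  let Q : ℝ := (T + 1) * (K4 + T * CD)
  let V : ℝ := 2 * (C₁ + C₂ * CE)
  have hQ : 0 ≤ Q := by positivity
  have hV : 0 ≤ V := by positivity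
  let q : ℕ → ℕ → ℝ := fun N k =>
    (1 + 1 / (α k * ε)) * β k ^ 2 * Q + α k ^ 2 / N * V
  have hp : ∀ k, 0 ≤ p k := fun k => by have := hstep.α_pos k; positivity
  have hq : ∀ N k, 0 ≤ q N k := fun N k => by have := hstep.α_pos k; positivity
  have hpe : ∀ᶠ k in Filter.atTop, p k ≤ 1 - ε * α k := by
    have h1 := (hstep.tendsto_α.mul_const (Real.sqrt C₂)).eventually
      (gt_mem_nhds (show 0 * Real.sqrt C₂ < 1 by simp))
    filter_upwards [h1] with k h1
    exact one_add_mul_contraction_sq_le (hstep.α_pos k) hε hεC h1.le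
  -- Both `β_k / α_k` and `√(α_k / N)` lose at most the factor `1 + 1/(2k)` per step, and `(1 +
  -- 1/(2k))² ≤ 1 + 5/(4k)`. Since `a < 1`, any `c` would be admissible. The bounds `v` (drop the
  -- batch term) and `Rb` (take `N = 1`) make `C` independent of `N`.
  obtain ⟨C, hC0, hC⟩ := exists_rate_bound (η := α) (μ := ε) (c := 5 / 4)
    (ν := (Amax + 1 / ε) * Q + V) (B₀ := (R + Real.sqrt C₁ / ε) ^ 2) (p := p)
    (v := fun k => (β k / α k) ^ 2)
    (Rb := fun k => q 1 k) hstep.α₀_pos hstep.a_pos hstep.α_eq hε (by norm_num)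
    (by positivity) (Or.inl hstep.a_lt_one) hp
    (fun k => by have := hstep.α_pos k; have := hstep.β_pos k; positivity) (by positivity) hpe
  refine ⟨C, hC0, fun M N hN Ω _ P _ ρ m t k => ?_⟩
  have hN0 : (1 : ℝ) ≤ N := by exact_mod_cast hN
  refine hC (fun k => (β k / α k + Real.sqrt (α k / N)) ^ 2) (q N) ?_ (hq N) ?_ ?_ ?_
    (fun k => ∫⁻ ω, ‖ρ.err k m t ω‖ₑ ^ 2 ∂P) ?_ ?_ k
  · intro k
    have := hstep.α_pos k
    have := hstep.β_pos k
    have := Real.sqrt_nonneg (α k / N)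
    exact pow_le_pow_left₀ (by positivity) (by linarith) 2
  · intro k
    have h1 : α k ^ 2 / N ≤ α k ^ 2 / (1 : ℕ) := by
      rw [Nat.cast_one, div_one]; exact div_le_self (sq_nonneg _) hN0
    have := mul_le_mul_of_nonneg_right h1 hV
    simp only [q]
    linarith
  · intro k _
    have hα := hstep.α_pos k
    have hβ := hstep.β_pos k
    have hs : Real.sqrt (α k / N) ^ 2 = α k / N := Real.sq_sqrt (by positivity)
    have hs0 := Real.sqrt_nonneg (α k / N)
    -- Per unit of `α_k` the forcing is of order `(β_k / α_k)²` from the drift and `α_k / N` from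
    -- the batch.
    have h1 : q N k = α k * ((α k + 1 / ε) * Q * (β k / α k) ^ 2 +
        V * Real.sqrt (α k / N) ^ 2) := by
      rw [hs]; simp only [q]; field_simp
    have h2 : (β k / α k) ^ 2 ≤ (β k / α k + Real.sqrt (α k / N)) ^ 2 :=
      pow_le_pow_left₀ (by positivity) (by linarith) 2
    have h3 : Real.sqrt (α k / N) ^ 2 ≤ (β k / α k + Real.sqrt (α k / N)) ^ 2 :=
      pow_le_pow_left₀ hs0 (by have : 0 < β k / α k := by positivity
                               linarith) 2
    rw [h1]
    calc α k * ((α k + 1 / ε) * Q * (β k / α k) ^ 2 + V * Real.sqrt (α k / N) ^ 2)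
        ≤ α k * ((Amax + 1 / ε) * Q * (β k / α k + Real.sqrt (α k / N)) ^ 2 +
          V * (β k / α k + Real.sqrt (α k / N)) ^ 2) := by
          have := hαA k
          gcongr
      _ = _ := by ring
  · intro k hk
    have hk0 : (1 : ℝ) ≤ k := by exact_mod_cast hk
    have h1 := hstep.ratio_le_succ (c := 1 / 2) (by linarith [hstep.half_lt, hstep.b_le]) hk
    have h2 := hstep.sqrt_le_succ (c := 1 / 2) (by linarith [hstep.a_lt_one]) hk N
    have hα := hstep.α_pos k
    have hβ := hstep.β_pos k
    have hs0 := Real.sqrt_nonneg (α k / N)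
    have h3 : β k / α k + Real.sqrt (α k / N) ≤
        (1 + 1 / 2 / k) * (β (k + 1) / α (k + 1) + Real.sqrt (α (k + 1) / N)) := by
      rw [mul_add]; exact add_le_add h1 h2
    calc _ ≤ ((1 + 1 / 2 / k) *
          (β (k + 1) / α (k + 1) + Real.sqrt (α (k + 1) / N))) ^ 2 :=
          pow_le_pow_left₀ (by positivity) h3 2
      _ = (1 + 1 / 2 / (k : ℝ)) ^ 2 *
          (β (k + 1) / α (k + 1) + Real.sqrt (α (k + 1) / N)) ^ 2 := mul_pow _ _ _
      _ ≤ _ := by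
          refine mul_le_mul_of_nonneg_right ?_ (sq_nonneg _)
          have h4 : 1 / (k : ℝ) ≤ 1 := (div_le_one (by linarith)).2 hk0
          have h5 : 0 < 1 / (k : ℝ) := by positivity
          have h6 : (1 + 1 / 2 / (k : ℝ)) ^ 2 =
            1 + 1 / k + 1 / 4 * (1 / k * (1 / k)) := by ring
          have h7 : 1 + 5 / 4 / (k : ℝ) = 1 + 1 / k + 1 / 4 * (1 / k) := by ring
          rw [h6, h7]
          nlinarith
  · have h1 : ∀ᵐ ω ∂P, ‖ρ.err 0 m t ω‖ₑ ^ 2 ≤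
        ENNReal.ofReal ((R + Real.sqrt C₁ / ε) ^ 2) := by
      filter_upwards [ρ.ae_forall_u hgood] with ω hω
      rw [← ofReal_norm_sq]
      refine ENNReal.ofReal_le_ofReal (pow_le_pow_left₀ (norm_nonneg _) ?_ 2)
      exact (norm_sub_le _ _).trans (add_le_add (ρ.D0_bound m t ω)
        ((hω m).norm_score_le hwell hreg hC₁ hε (ρ.lam0_mem ω) t))
    refine (lintegral_mono_ae h1).trans ?_
    simp
  · intro k
    have hα := hstep.α_pos k
    have hβ := hstep.β_pos k
    -- `λ_{k+1}` is computed from `D_k` and not from the batch of step `k`. The score at the new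
    -- parameter is therefore fixed by the history, and the batch noise is centred with respect to
    -- this moving target.
    let s' : (Fin M → E s) → E l × (Fin M → Fin T → E d) → E d := fun u z =>
      mdl.score t (mdl.θ (u m) (mdl.nextLam (β k) u z))
    have hs'm : Measurable fun z : (Fin M → E s) × (E l × (Fin M → Fin T → E d)) =>
        s' z.1 z.2 := by
      have h1 : Measurable fun z : (Fin M → E s) × (E l × (Fin M → Fin T → E d)) => z.1 m := by
        fun_prop
      have h2 := hwell.θ_measurable.comp
        (h1.prodMk (Model.measurable_nextLam (M := M) hwell hlip (β k)))
      have h3 := (Model.continuous_score hreg t).measurable.comp h2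
      simpa only [Function.comp_def] using h3
    have hΨ : Measurable
        fun z : ((Fin M → E s) × (E l × (Fin M → Fin T → E d))) × (Fin N → E n) =>
          ‖mdl.nextBlock (α k) z.2 t (mdl.θ (z.1.1 m) z.1.2.1) (z.1.2.2 m t)
            - s' z.1.1 z.1.2‖ₑ ^ 2 := by
      have h1 : Measurable
          fun z : ((Fin M → E s) × (E l × (Fin M → Fin T → E d))) × (Fin N → E n) =>
            (z.1.1 m, z.1.2.1) := by fun_prop
      have h2 := hwell.θ_measurable.comp h1
      have h3 : Measurable
          fun z : ((Fin M → E s) × (E l × (Fin M → Fin T → E d))) × (Fin N → E n) =>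
            z.1.2.2 m t := by fun_prop
      have h4 := (Model.measurable_nextBlock hwell (N := N) (α k) t).comp
        (measurable_snd.prodMk (h2.prodMk h3))
      have h5 : Measurable
          fun z : ((Fin M → E s) × (E l × (Fin M → Fin T → E d))) × (Fin N → E n) =>
            s' z.1.1 z.1.2 := hs'm.comp measurable_fst
      simp only [Function.comp_def] at h4
      exact (h4.sub h5).enorm.pow_const 2
    have hbatch := ρ.lintegral_batch hwell hlip k m (Ψ := fun u z x =>
      ‖mdl.nextBlock (α k) x t (mdl.θ (u m) z.1) (z.2 m t) - s' u z‖ₑ ^ 2) hΨ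
    let φ : Fin M → (Fin M → E s) → ENNReal := fun m' u =>
      ENNReal.ofReal (κ (u m) ^ 2 * κ (u m') ^ 2)
    have hφm : ∀ m', Measurable (φ m') := fun m' => by
      have h1 : Measurable fun u : Fin M → E s => κ (u m) := hκ.comp (measurable_pi_apply m)
      have h2 : Measurable fun u : Fin M → E s => κ (u m') := hκ.comp (measurable_pi_apply m')
      exact ((h1.pow_const 2).mul (h2.pow_const 2)).ennreal_ofReal
    have hφi : ∀ m', ∫⁻ ω, φ m' (ρ.outer ω) ∂P ≤ ENNReal.ofReal K4 := fun m' =>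
      ρ.lintegral_sq_mul_sq_le hκ hκ4 m m'
    have hφo : ∀ m', Measurable fun ω => φ m' (ρ.outer ω) := fun m' =>
      (hφm m').comp ρ.measurable_outer
    have hDm : ∀ m' t', Measurable fun ω => ‖(ρ.state k ω).2 m' t'‖ₑ ^ 2 := fun m' t' =>
      ((ρ.measurable_block hwell hlip k m' t').enorm).pow_const 2
    have hφD : ∀ m' t', ∫⁻ ω, φ m' (ρ.outer ω) * ‖(ρ.state k ω).2 m' t'‖ₑ ^ 2 ∂P ≤
        ENNReal.ofReal CD := fun m' t' => hCD M N hN Ω P ρ m' t' (φ m') (hφm m') (hφi m') k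
    have hD : ∫⁻ ω, ‖(ρ.state k ω).2 m t‖ₑ ^ 2 ∂P ≤ ENNReal.ofReal CE := by
      simpa using hCE M N hN Ω P ρ m t (fun _ => 1) measurable_const (by simp) k
    let c₁ : ℝ := (1 + 1 / (α k * ε)) * β k ^ 2 * ((M : ℝ)⁻¹ * (T + 1))
    let c₂ : ℝ := α k ^ 2 / N * 2
    have hc₁ : 0 ≤ c₁ := by positivity
    have hc₂ : 0 ≤ c₂ := by positivity
    let S : Ω → ENNReal := fun ω => ∑ m', (φ m' (ρ.outer ω) +
      ∑ t', φ m' (ρ.outer ω) * ‖(ρ.state k ω).2 m' t'‖ₑ ^ 2)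
    have hφDm : ∀ m' t', Measurable fun ω =>
        φ m' (ρ.outer ω) * ‖(ρ.state k ω).2 m' t'‖ₑ ^ 2 := fun m' t' => (hφo m').mul (hDm m' t')
    have hφDsum : ∀ m', Measurable fun ω =>
        ∑ t', φ m' (ρ.outer ω) * ‖(ρ.state k ω).2 m' t'‖ₑ ^ 2 := fun m' =>
      Finset.measurable_sum _ fun t' _ => hφDm m' t'
    have hsm : ∀ m', Measurable fun ω => φ m' (ρ.outer ω) +
        ∑ t', φ m' (ρ.outer ω) * ‖(ρ.state k ω).2 m' t'‖ₑ ^ 2 := fun m' =>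
      (hφo m').add (hφDsum m')
    have hSm : Measurable S := Finset.measurable_sum _ fun m' _ => hsm m'
    have hSi : ∫⁻ ω, S ω ∂P ≤ ENNReal.ofReal (M * (K4 + T * CD)) := by
      simp only [S]
      rw [lintegral_finsetSum _ fun m' _ => hsm m']
      calc _ ≤ ∑ _m' : Fin M, ENNReal.ofReal (K4 + T * CD) := by
            refine Finset.sum_le_sum fun m' _ => ?_
            rw [lintegral_add_left (hφo m'), lintegral_finsetSum _ fun t' _ => hφDm m' t',
              ENNReal.ofReal_add hK40 (by positivity), ENNReal.ofReal_mul (by positivity),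
              ENNReal.ofReal_natCast]
            refine add_le_add (hφi m') ((Finset.sum_le_sum fun t' _ => hφD m' t').trans ?_)
            simp
        _ = _ := by
            rw [ENNReal.ofReal_mul (by positivity), ENNReal.ofReal_natCast]
            simp
    calc ∫⁻ ω, ‖ρ.err (k + 1) m t ω‖ₑ ^ 2 ∂P
        = ∫⁻ ω, ∫⁻ x, ‖mdl.nextBlock (α k) x t
            (mdl.θ (ρ.outer ω m) (ρ.state k ω).1) ((ρ.state k ω).2 m t) -
              s' (ρ.outer ω) (ρ.state k ω)‖ₑ ^ 2
            ∂(Measure.pi fun _ : Fin N => mdl.lawX (mdl.θ (ρ.u m ω) (ρ.state k ω).1)) ∂P := by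
          rw [← hbatch]
          rfl
      _ ≤ ∫⁻ ω, (ENNReal.ofReal (p k) * ‖ρ.err k m t ω‖ₑ ^ 2 + (ENNReal.ofReal c₁ * S ω +
            ENNReal.ofReal c₂ * (ENNReal.ofReal C₁ +
              ENNReal.ofReal C₂ * ‖(ρ.state k ω).2 m t‖ₑ ^ 2))) ∂P := by
          refine lintegral_mono_ae ?_
          filter_upwards [ρ.ae_forall_u hgood] with ω hω
          have hlam := ρ.state_fst_mem hwell hlip k ω
          have hlam' := ρ.state_fst_mem hwell hlip (k + 1) ω
          rw [ρ.state_succ_fst] at hlam'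
          have h1 := (hω m).lintegral_nextBlock_sub_le hwell hreg hC₁ hC₂ hlam t
            ((ρ.state k ω).2 m t) (s' (ρ.outer ω) (ρ.state k ω)) (α k) hN
          have h2 := (hω m).norm_mean_block_sub_score_sq_le hwell hreg hC₂ hε hlam hlam' t
            ((ρ.state k ω).2 m t) hα
          have h3 : (κ (ρ.outer ω m) *
              ‖(ρ.state k ω).1 - mdl.nextLam (β k) (ρ.outer ω) (ρ.state k ω)‖) ^ 2 ≤
              κ (ρ.outer ω m) ^ 2 * (β k ^ 2 * ((M : ℝ)⁻¹ * ∑ m', κ (ρ.outer ω m') ^ 2 *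
                ((T + 1) * (1 + ∑ t', ‖(ρ.state k ω).2 m' t'‖ ^ 2)))) := by
            rw [mul_pow]
            refine mul_le_mul_of_nonneg_left ?_ (sq_nonneg _)
            calc _ ≤ (β k * ‖mdl.direction (ρ.outer ω) (ρ.state k ω).1 (ρ.state k ω).2‖) ^ 2 :=
                  pow_le_pow_left₀ (norm_nonneg _)
                    (Model.norm_sub_nextLam_le hwell hlip _ _ hlam hβ.le) 2
              _ = β k ^ 2 * ‖mdl.direction (ρ.outer ω) (ρ.state k ω).1 (ρ.state k ω).2‖ ^ 2 :=
                  mul_pow _ _ _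
              _ ≤ _ := by
                  gcongr
                  exact Model.norm_direction_sq_le hω hlam _
          have h4 : κ (ρ.outer ω m) ^ 2 * (β k ^ 2 * ((M : ℝ)⁻¹ * ∑ m', κ (ρ.outer ω m') ^ 2 *
                ((T + 1) * (1 + ∑ t', ‖(ρ.state k ω).2 m' t'‖ ^ 2)))) =
              β k ^ 2 * ((M : ℝ)⁻¹ * (T + 1)) * ∑ m', (κ (ρ.outer ω m) ^ 2 * κ (ρ.outer ω m') ^ 2 +
                ∑ t', κ (ρ.outer ω m) ^ 2 * κ (ρ.outer ω m') ^ 2 *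
                  ‖(ρ.state k ω).2 m' t'‖ ^ 2) := by
            simp only [← Finset.mul_sum, ← mul_one_add]
            simp only [Finset.mul_sum]
            refine Finset.sum_congr rfl fun m' _ => ?_
            ring
          rw [h4] at h3
          have h5 : S ω = ENNReal.ofReal (∑ m', (κ (ρ.outer ω m) ^ 2 * κ (ρ.outer ω m') ^ 2 +
                ∑ t', κ (ρ.outer ω m) ^ 2 * κ (ρ.outer ω m') ^ 2 *
                  ‖(ρ.state k ω).2 m' t'‖ ^ 2)) := by
            rw [ENNReal.ofReal_sum_of_nonneg fun m' _ => by positivity]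
            refine Finset.sum_congr rfl fun m' _ => ?_
            rw [ENNReal.ofReal_add (by positivity) (by positivity),
              ENNReal.ofReal_sum_of_nonneg fun t' _ => by positivity]
            simp only [φ]
            congr 1
            refine Finset.sum_congr rfl fun t' _ => ?_
            rw [← ofReal_norm_sq, ← ENNReal.ofReal_mul (by positivity)]
          set Sr := ∑ m', (κ (ρ.outer ω m) ^ 2 * κ (ρ.outer ω m') ^ 2 +
                ∑ t', κ (ρ.outer ω m) ^ 2 * κ (ρ.outer ω m') ^ 2 *
                  ‖(ρ.state k ω).2 m' t'‖ ^ 2) with hSr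
          have hSr0 : 0 ≤ Sr := by positivity
          have h6 := mul_le_mul_of_nonneg_left h3
            (show 0 ≤ 1 + 1 / (α k * ε) by positivity)
          rw [h5, ← ofReal_norm_sq, ← ofReal_norm_sq, ← ENNReal.ofReal_mul (hp k),
            ← ENNReal.ofReal_mul hc₁, ← ENNReal.ofReal_mul hC₂,
            ← ENNReal.ofReal_add hC₁ (by positivity), ← ENNReal.ofReal_mul hc₂,
            ← ENNReal.ofReal_add (by positivity) (by positivity),
            ← ENNReal.ofReal_add (mul_nonneg (hp k) (sq_nonneg _)) (by positivity)]
          refine h1.trans (ENNReal.ofReal_le_ofReal ?_)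
          simp only [p, c₁, c₂, Run.err, s']
          linarith
      _ = ENNReal.ofReal (p k) * ∫⁻ ω, ‖ρ.err k m t ω‖ₑ ^ 2 ∂P +
            (ENNReal.ofReal c₁ * ∫⁻ ω, S ω ∂P + ENNReal.ofReal c₂ * (ENNReal.ofReal C₁ +
              ENNReal.ofReal C₂ * ∫⁻ ω, ‖(ρ.state k ω).2 m t‖ₑ ^ 2 ∂P)) := by
          have h1 := ((ρ.measurable_err hwell hlip hreg k m t).enorm).pow_const 2
          rw [lintegral_add_left (h1.const_mul _), lintegral_const_mul _ h1,
            lintegral_add_left (hSm.const_mul _), lintegral_const_mul _ hSm,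
            lintegral_const_mul _ (((hDm m t).const_mul _).const_add _),
            lintegral_add_left measurable_const, lintegral_const_mul _ (hDm m t),
            lintegral_const, measure_univ, mul_one]
      _ ≤ ENNReal.ofReal (p k) * ∫⁻ ω, ‖ρ.err k m t ω‖ₑ ^ 2 ∂P +
            (ENNReal.ofReal c₁ * ENNReal.ofReal (M * (K4 + T * CD)) +
              ENNReal.ofReal c₂ * (ENNReal.ofReal C₁ +
              ENNReal.ofReal C₂ * ENNReal.ofReal CE)) := by gcongr
      _ = _ := by
          have hM0 : (0 : ℝ) < M := by exact_mod_cast m.pos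
          rw [← ENNReal.ofReal_mul hc₁, ← ENNReal.ofReal_mul hC₂,
            ← ENNReal.ofReal_add hC₁ (by positivity), ← ENNReal.ofReal_mul hc₂,
            ← ENNReal.ofReal_add (by positivity) (by positivity)]
          congr 2
          simp only [c₁, c₂, q, Q, V]
          field_simp


/-! ### Sampling error of the gradient, and one projected step. -/

theorem norm_le_sum_abs {n : ℕ} (x : E n) : ‖x‖ ≤ ∑ i, |x i| := by
  rw [EuclideanSpace.norm_eq]
  refine Real.sqrt_le_iff.2 ⟨Finset.sum_nonneg fun i _ => abs_nonneg _, ?_⟩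
  exact Finset.sum_sq_le_sq_sum_of_nonneg fun i _ => abs_nonneg _

theorem abs_coord_le_norm {n : ℕ} (x : E n) (i : Fin n) : |x i| ≤ ‖x‖ := by
  simpa using PiLp.norm_apply_le x i

theorem integral_coord {𝒳 : Type*} [MeasurableSpace 𝒳] {μ : Measure 𝒳} {n : ℕ} {F : 𝒳 → E n}
    (hF : Integrable F μ) (i : Fin n) : (∫ x, F x ∂μ) i = ∫ x, F x i ∂μ :=
  ((EuclideanSpace.proj i : E n →L[ℝ] ℝ).integral_comp_comm hF).symm

theorem integrable_sq_of_pow_four {𝒳 : Type*} [MeasurableSpace 𝒳] {μ : Measure 𝒳}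
    [IsFiniteMeasure μ] {F : 𝒳 → ℝ} (hF : Measurable F) (hF4 : Integrable (fun x => F x ^ 4) μ) :
    Integrable (fun x => F x ^ 2) μ := by
  refine ((integrable_const (1 : ℝ)).add hF4).mono' (hF.pow_const 2).aestronglyMeasurable
    (Filter.Eventually.of_forall fun x => ?_)
  rw [Real.norm_of_nonneg (sq_nonneg _)]
  simp only [Pi.add_apply]
  nlinarith [sq_nonneg (F x ^ 2 - 1), sq_nonneg (F x)]

namespace Model

/-- The sample average of `h` is uniformly close to the gradient of the ELBO. -/
theorem exists_gradient_deviation_bound.{v} (hwell : mdl.WellPosed)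
    (hlip : mdl.LipschitzGradient) (hreg : mdl.Regularity) :
    ∃ C : ℝ, 0 ≤ C ∧ ∀ (Ω : Type v) [MeasurableSpace Ω] (P : Measure Ω) [IsProbabilityMeasure P]
      (M : ℕ) (u : Fin M → Ω → E s), 1 ≤ M → (∀ m, Measurable (u m)) → iIndepFun u P →
      (∀ m, P.map (u m) = mdl.lawU) → ∃ W : Ω → ENNReal, AEMeasurable W P ∧
        (∀ᵐ ω ∂P, ∀ lam ∈ mdl.Λ, ‖(M : ℝ)⁻¹ • ∑ m, mdl.h (u m ω) lam -
          gradientWithin mdl.elbo mdl.Λ lam‖ₑ ≤ W ω) ∧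
        ∫⁻ ω, W ω ∂P ≤ ENNReal.ofReal (C / Real.sqrt M) := by
  have := hwell.p0_prob
  obtain ⟨C₁, C₂, ε, hC₁, hC₂, hε, hεC, κ, hκ, hκ4, hgood⟩ := exists_goodSample hreg
  obtain ⟨mf, hmf, hmf2, hmfL⟩ := hlip.lipschitz
  have hκ2 := integrable_sq_of_pow_four hκ hκ4
  -- Chaining is done for each scalar coordinate of `h`, and the constants add up. The bound of `h`
  -- by a multiple of `κ` comes from the scores being at most `√C₁ / ε`.
  have key : ∀ i : Fin l, _ := fun i =>
    exists_uniform_deviation_bound.{v} (μ := mdl.lawU) hlip.compact.isBounded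
      (g := fun u lam => mdl.h u lam i) (lip := mf)
      (b₀ := fun u => κ u * (T * (Real.sqrt C₁ / ε) + 1))
      (fun lam _ => by
        have := measurable_h hwell hreg lam
        fun_prop) hmf hmf2
      (by simpa only [mul_pow] using hκ2.mul_const _)
      (by
        filter_upwards [hmfL] with u hu x hx y hy
        exact (abs_coord_le_norm (mdl.h u x - mdl.h u y) i).trans (hu x hx y hy))
      (by
        filter_upwards [hgood] with u hu x hx
        exact (abs_coord_le_norm _ i).trans (hu.norm_h_le hwell hreg hC₁ hε hx))
  choose C hC0 hC using key
  refine ⟨∑ i, C i, Finset.sum_nonneg fun i _ => hC0 i, ?_⟩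
  intro Ω _ P _ M u hM hu hind hlaw
  choose W hWm hW hWi using fun i => hC i Ω P M u hM hu hind hlaw
  refine ⟨fun ω => ∑ i, W i ω, Finset.aemeasurable_fun_sum _ fun i _ => hWm i, ?_, ?_⟩
  · filter_upwards [ae_all_iff.2 hW] with ω hω lam hlam
    obtain ⟨hi, hg⟩ := integrable_h_and_gradientWithin_elbo hwell hreg hlam
    rw [hg, ← ofReal_norm]
    calc _ ≤ ENNReal.ofReal (∑ i, |(M : ℝ)⁻¹ * ∑ m, mdl.h (u m ω) lam i -
            ∫ v, mdl.h v lam i ∂mdl.lawU|) := by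
          refine ENNReal.ofReal_le_ofReal ((norm_le_sum_abs _).trans (le_of_eq ?_))
          refine Finset.sum_congr rfl fun i _ => ?_
          rw [PiLp.sub_apply, integral_coord hi, PiLp.smul_apply, smul_eq_mul]
          simp
      _ = ∑ i, ENNReal.ofReal |(M : ℝ)⁻¹ * ∑ m, mdl.h (u m ω) lam i -
            ∫ v, mdl.h v lam i ∂mdl.lawU| :=
          ENNReal.ofReal_sum_of_nonneg fun i _ => abs_nonneg _
      _ ≤ _ := Finset.sum_le_sum fun i _ => hω i lam hlam
  · rw [lintegral_finsetSum' _ fun i _ => hWm i, Finset.sum_div,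
      ENNReal.ofReal_sum_of_nonneg fun i _ => by have := hC0 i; positivity]
    exact Finset.sum_le_sum fun i _ => hWi i

/-- The gradient is the mean of `h`, so the mean of the Lipschitz constants of `h(u; ·)` serves. -/
theorem exists_lipschitz_gradient (hwell : mdl.WellPosed)
    (hlip : mdl.LipschitzGradient) (hreg : mdl.Regularity) :
    ∃ K : ℝ, ∀ x ∈ mdl.Λ, ∀ y ∈ mdl.Λ, ‖gradientWithin mdl.elbo mdl.Λ x -
      gradientWithin mdl.elbo mdl.Λ y‖ ≤ K * ‖x - y‖ := by
  have := hwell.p0_prob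
  obtain ⟨mf, hmf, hmf2, hmfL⟩ := hlip.lipschitz
  have hmi : Integrable mf mdl.lawU :=
    ((memLp_two_iff_integrable_sq hmf.aestronglyMeasurable).2 hmf2).integrable (by norm_num)
  refine ⟨∫ u, mf u ∂mdl.lawU, fun x hx y hy => ?_⟩
  obtain ⟨hix, hgx⟩ := integrable_h_and_gradientWithin_elbo hwell hreg hx
  obtain ⟨hiy, hgy⟩ := integrable_h_and_gradientWithin_elbo hwell hreg hy
  rw [hgx, hgy, ← integral_sub hix hiy, ← integral_mul_const]
  refine norm_integral_le_of_norm_le (hmi.mul_const _) ?_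
  filter_upwards [hmfL] with u hu using hu x hx y hy

/-- One projected step contracts towards the maximizer, up to the error of the direction. -/
theorem norm_nextLam_sub_le (hwell : mdl.WellPosed) (hlip : mdl.LipschitzGradient)
    (hreg : mdl.Regularity) {KL : ℝ} (hconc : mdl.StronglyConcaveSAA KL) {lamBar : E l}
    (hmem : lamBar ∈ mdl.Λ) (hmax : IsMaxOn mdl.elbo mdl.Λ lamBar) {K : ℝ}
    (hK : ∀ x ∈ mdl.Λ, ∀ y ∈ mdl.Λ, ‖gradientWithin mdl.elbo mdl.Λ x -
      gradientWithin mdl.elbo mdl.Λ y‖ ≤ K * ‖x - y‖) {βk : ℝ} (hβ : 0 ≤ βk) {M : ℕ}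
    (u : Fin M → E s) {z : E l × (Fin M → Fin T → E d)} (hz : z.1 ∈ mdl.Λ) :
    ‖mdl.nextLam βk u z - lamBar‖ ≤ |1 - βk * KL + βk ^ 2 * K ^ 2 / 2| * ‖z.1 - lamBar‖ +
      βk * ‖mdl.direction u z.1 z.2 - gradientWithin mdl.elbo mdl.Λ z.1‖ := by
  set G := gradientWithin mdl.elbo mdl.Λ with hG
  have hne : mdl.Λ.Nonempty := ⟨lamBar, hmem⟩
  -- First-order optimality on a convex set says exactly this, for every step size and also at a
  -- boundary maximizer, where the gradient need not vanish.
  have hfix : proj mdl.Λ (lamBar + βk • G lamBar) = lamBar := by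
    refine proj_eq_of_inner_le hlip.compact hwell.convex hmem fun w hw => ?_
    rw [add_sub_cancel_left, inner_smul_left]
    exact mul_nonpos_of_nonneg_of_nonpos hβ
      (inner_gradientWithin_elbo_nonpos hwell hmem hmax hw)
  have h1 := norm_proj_sub_proj_le hlip.compact hne hwell.convex
    (z.1 + βk • mdl.direction u z.1 z.2) (lamBar + βk • G lamBar)
  rw [hfix] at h1
  have h2 : z.1 + βk • mdl.direction u z.1 z.2 - (lamBar + βk • G lamBar) =
      ((z.1 - lamBar) + βk • (G z.1 - G lamBar)) + βk • (mdl.direction u z.1 z.2 - G z.1) := by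
    module
  -- With `y = β K_L - β² K² / 2`, monotonicity and the Lipschitz bound give the factor `1 - 2y` for
  -- the square, and `1 - 2y ≤ (1 - y)²` avoids a square root in the contraction factor.
  have h3 : ‖(z.1 - lamBar) + βk • (G z.1 - G lamBar)‖ ^ 2 ≤
      ((1 - βk * KL + βk ^ 2 * K ^ 2 / 2) * ‖z.1 - lamBar‖) ^ 2 := by
    have h4 := inner_gradientWithin_elbo_le hwell hreg hconc hz hmem
    have h5 : ‖G z.1 - G lamBar‖ ^ 2 ≤ K ^ 2 * ‖z.1 - lamBar‖ ^ 2 := by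
      rw [← mul_pow]
      exact pow_le_pow_left₀ (norm_nonneg _) (hK _ hz _ hmem) 2
    rw [norm_add_sq_real, inner_smul_right, real_inner_comm, norm_smul, mul_pow,
      Real.norm_eq_abs, sq_abs]
    have h6 := mul_le_mul_of_nonneg_left h4 hβ
    have h7 := mul_le_mul_of_nonneg_left h5 (sq_nonneg βk)
    have h8 : 0 ≤ (βk * KL - βk ^ 2 * K ^ 2 / 2) ^ 2 * ‖z.1 - lamBar‖ ^ 2 := by positivity
    nlinarith
  calc ‖mdl.nextLam βk u z - lamBar‖
      ≤ ‖(z.1 - lamBar) + βk • (G z.1 - G lamBar)‖ +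
        ‖βk • (mdl.direction u z.1 z.2 - G z.1)‖ := by
        rw [h2] at h1
        exact h1.trans (norm_add_le _ _)
    _ ≤ _ := by
        rw [norm_smul, Real.norm_of_nonneg hβ]
        gcongr
        have := sq_le_sq.1 h3
        rwa [abs_norm, abs_mul, abs_norm] at this

/-- The error of the direction splits into a sampling error and a tracking error. -/
theorem norm_direction_sub_le {C₁ C₂ ε : ℝ} {κ : E s → ℝ} {M : ℕ} {u : Fin M → E s}
    (hgood : ∀ m, mdl.GoodSample C₁ C₂ ε (κ (u m)) (u m)) {lam : E l} (hlam : lam ∈ mdl.Λ)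
    (D : Fin M → Fin T → E d) (G : E l) :
    ‖mdl.direction u lam D - G‖ ≤ ‖(M : ℝ)⁻¹ • ∑ m, mdl.h (u m) lam - G‖ +
      (M : ℝ)⁻¹ * ∑ m, ∑ t, κ (u m) * ‖D m t - mdl.score t (mdl.θ (u m) lam)‖ := by
  have h1 : mdl.direction u lam D - G = ((M : ℝ)⁻¹ • ∑ m, mdl.h (u m) lam - G) +
      (M : ℝ)⁻¹ • ∑ m, mdl.A (u m) lam (∑ t, (D m t - mdl.score t (mdl.θ (u m) lam))) := by
    rw [sub_add_eq_add_sub, ← smul_add, ← Finset.sum_add_distrib, direction]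
    congr 2
    refine Finset.sum_congr rfl fun m _ => ?_
    rw [h, ← map_add, Finset.sum_sub_distrib]
    congr 1
    abel
  rw [h1]
  refine (norm_add_le _ _).trans ?_
  gcongr
  rw [norm_smul, Real.norm_of_nonneg (by positivity)]
  gcongr
  refine (norm_sum_le _ _).trans (Finset.sum_le_sum fun m _ => ?_)
  rw [← Finset.mul_sum]
  exact ((mdl.A (u m) lam).le_opNorm _).trans (mul_le_mul ((hgood m).A_bound lam hlam)
    (norm_sum_le _ _) (norm_nonneg _) ((hgood m).κ_nonneg hlam))

end Model


/-! ### The slow time scale: comparison with the target rate. -/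

/-- The quadratic term is `β_k` times a null sequence, so any gap between `μ` and `KL` absorbs it.
-/
theorem eventually_abs_one_sub_add_le {β : ℕ → ℝ} (hβ : ∀ k, 0 < β k)
    (hβ0 : Filter.Tendsto β Filter.atTop (nhds 0)) {KL K μ : ℝ} (hμ : μ < KL) :
    ∀ᶠ k in Filter.atTop, |1 - β k * KL + β k ^ 2 * K ^ 2 / 2| ≤ 1 - μ * β k := by
  have h1 : Filter.Tendsto (fun k => β k * KL) Filter.atTop (nhds 0) := by
    simpa using hβ0.mul_const KL
  have h2 : Filter.Tendsto (fun k => β k * (K ^ 2 / 2)) Filter.atTop (nhds 0) := by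
    simpa using hβ0.mul_const (K ^ 2 / 2)
  filter_upwards [h1.eventually_le_const one_pos, h2.eventually_le_const (sub_pos.2 hμ)]
    with k h3 h4
  have h5 : 0 ≤ β k ^ 2 * K ^ 2 / 2 := by positivity
  rw [abs_of_nonneg (by linarith)]
  nlinarith [mul_le_mul_of_nonneg_left h4 (hβ k).le]

namespace StepSizes

variable {α β : ℕ → ℝ} {a b α₀ β₀ : ℝ}

/-- The slow recursion, for a comparison sequence `w` of the order of the rate. -/
theorem exists_slow_bound_of_comparison (h : StepSizes α β a b α₀ β₀) {KL c ν K B₀ : ℝ}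
    (hKL : 0 < KL) (hc : 0 ≤ c) (hgain : b < 1 ∨ b = 1 ∧ c < β₀ * KL) (hν : 0 ≤ ν) (hK : 0 ≤ K)
    (hB₀ : 0 ≤ B₀) {p : ℕ → ℝ} (hp : ∀ k, 0 ≤ p k)
    (hpe : ∀ μ < KL, ∀ᶠ k in Filter.atTop, p k ≤ 1 - μ * β k) {w : ℕ → ℕ → ℕ → ℝ}
    (hw1 : ∀ M N k : ℕ, β k / α k ≤ w M N k)
    (hw2 : ∀ M N k : ℕ, w M N k ≤ β k / α k + Real.sqrt (α k / N) + Real.sqrt (1 / M))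
    (hw3 : ∀ M N k : ℕ, 1 ≤ N → 1 ≤ k →
      β k / α k + Real.sqrt (α k / N) + Real.sqrt (1 / M) ≤ K * w M N k)
    (hw4 : ∀ M N k : ℕ, 1 ≤ k → w M N k ≤ (1 + c / k) * w M N (k + 1)) :
    ∃ C, ∀ M N : ℕ, 1 ≤ M → 1 ≤ N → ∀ y : ℕ → ENNReal, y 0 ≤ ENNReal.ofReal B₀ →
      (∀ k, y (k + 1) ≤ ENNReal.ofReal (p k) * y k + ENNReal.ofReal
        (β k * (ν * (β k / α k + Real.sqrt (α k / N) + Real.sqrt (1 / M))))) →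
      ∀ k, y k ≤ ENNReal.ofReal
        (C * (β k / α k + Real.sqrt (α k / N) + Real.sqrt (1 / M))) := by
  -- The contraction rate must lie below `KL`, to absorb the quadratic term of the step, and for `b
  -- = 1` above `c / β₀`; the strict gain condition leaves room for a midpoint.
  obtain ⟨μ, hμ0, hμ, hμc⟩ : ∃ μ, 0 < μ ∧ μ < KL ∧ (b < 1 ∨ b = 1 ∧ c < β₀ * μ) := by
    rcases hgain with hb | ⟨hb, hcK⟩
    · exact ⟨KL / 2, by positivity, by linarith, Or.inl hb⟩
    · have h1 := h.β₀_pos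
      have h2 : c / β₀ < KL := by rwa [div_lt_iff₀' h1]
      have h3 : 0 ≤ c / β₀ := by positivity
      refine ⟨(c / β₀ + KL) / 2, by linarith, by linarith, Or.inr ⟨hb, ?_⟩⟩
      rw [← div_lt_iff₀' h1]
      linarith
  have hα := h.α_pos
  have hβ := h.β_pos
  -- The sequences `v` and `Rb` bound target and forcing for all `M, N ≥ 1` at once, which makes `C`
  -- uniform.
  obtain ⟨C, hC, hrate⟩ := exists_rate_bound (η := β) (p := p) (v := fun k => β k / α k)
    (Rb := fun k => β k * (ν * (β k / α k + Real.sqrt (α k) + 1)))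
    h.β₀_pos (h.a_pos.trans h.a_lt_b) h.β_eq hμ0 hc (mul_nonneg hν hK) hμc hp
    (fun k => div_pos (hβ k) (hα k)) hB₀ (hpe μ hμ)
  refine ⟨C, fun M N hM hN y hy0 hy k => ?_⟩
  have hM' : (1 : ℝ) ≤ M := by exact_mod_cast hM
  have hN' : (1 : ℝ) ≤ N := by exact_mod_cast hN
  have hs : ∀ k, 0 ≤ β k / α k + Real.sqrt (α k / N) + Real.sqrt (1 / M) := fun k => by
    have := hα k; have := hβ k; positivity
  refine (hrate (w M N) _ (hw1 M N) (fun k => mul_nonneg (hβ k).le (mul_nonneg hν (hs k)))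
    (fun k => ?_) (fun k hk => ?_) (hw4 M N) y hy0 hy k).trans
    (ENNReal.ofReal_le_ofReal (mul_le_mul_of_nonneg_left (hw2 M N k) hC))
  · have h1 : Real.sqrt (α k / N) ≤ Real.sqrt (α k) :=
      Real.sqrt_le_sqrt (div_le_self (hα k).le hN')
    have h2 : Real.sqrt (1 / M) ≤ 1 :=
      Real.sqrt_le_one.2 (by rw [one_div]; exact inv_le_one_of_one_le₀ hM')
    have := hβ k
    gcongr
  · calc _ ≤ β k * (ν * (K * w M N k)) :=
          mul_le_mul_of_nonneg_left (mul_le_mul_of_nonneg_left (hw3 M N k hN hk) hν) (hβ k).le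
      _ = _ := by ring

/-- For `b < 1` every polynomial rate is slow enough. For `b = 1` the recursion follows `k^{-c}`
only if `c < β₀ K_L`. This is assumed for the exponent `1 - a` of `β_k / α_k`, but may fail for the
exponent `a / 2` of `√(α_k / N)`. If it fails, then `1 - a < β₀ K_L ≤ a / 2`, so `√(α_k / N)` is at
most a constant times `β_k / α_k` uniformly in `N`, and it can be dropped from the comparison
sequence. -/
theorem exists_slow_bound (h : StepSizes α β a b α₀ β₀) {KL ν B₀ : ℝ} (hKL : 0 < KL)
    (hgain : b = 1 → 1 - a < β₀ * KL) (hν : 0 ≤ ν) (hB₀ : 0 ≤ B₀) {p : ℕ → ℝ}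
    (hp : ∀ k, 0 ≤ p k) (hpe : ∀ μ < KL, ∀ᶠ k in Filter.atTop, p k ≤ 1 - μ * β k) :
    ∃ C, ∀ M N : ℕ, 1 ≤ M → 1 ≤ N → ∀ y : ℕ → ENNReal, y 0 ≤ ENNReal.ofReal B₀ →
      (∀ k, y (k + 1) ≤ ENNReal.ofReal (p k) * y k + ENNReal.ofReal
        (β k * (ν * (β k / α k + Real.sqrt (α k / N) + Real.sqrt (1 / M))))) →
      ∀ k, y k ≤ ENNReal.ofReal
        (C * (β k / α k + Real.sqrt (α k / N) + Real.sqrt (1 / M))) := by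
  have hα := h.α_pos
  have hβ := h.β_pos
  have ha := h.half_lt
  have ha1 := h.a_lt_one
  have hconst : ∀ {c : ℝ} (M k : ℕ), 0 ≤ c →
      Real.sqrt (1 / M) ≤ (1 + c / k) * Real.sqrt (1 / M) := fun {c} M k hc => by
    have : 0 ≤ c / k := by positivity
    nlinarith [Real.sqrt_nonneg (1 / (M : ℝ))]
  have hfull : ∀ c, 0 ≤ c → b - a ≤ c → a / 2 ≤ c → (b < 1 ∨ b = 1 ∧ c < β₀ * KL) → _ :=
    fun c hc h1 h2 hg => h.exists_slow_bound_of_comparison (B₀ := B₀) hKL hc hg hν zero_le_one hB₀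
      hp hpe (w := fun M N k => β k / α k + Real.sqrt (α k / N) + Real.sqrt (1 / M))
      (fun M N k => by
        have := Real.sqrt_nonneg (α k / N)
        have := Real.sqrt_nonneg (1 / (M : ℝ))
        linarith) (fun M N k => le_rfl) (fun M N k _ _ => (one_mul _).ge)
      (fun M N k hk => by
        have := h.ratio_le_succ h1 hk
        have := h.sqrt_le_succ h2 hk N
        have := hconst M k hc
        simp only [mul_add]
        linarith)
  rcases h.b_le.lt_or_eq with hb | hb
  · exact hfull (1 / 2) (by norm_num) (by linarith) (by linarith) (Or.inl hb)
  · have hg := hgain hb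
    by_cases hcase : a / 2 < β₀ * KL
    · exact hfull (max (1 - a) (a / 2)) (le_max_of_le_left (by linarith))
        (le_max_of_le_left (by linarith)) (le_max_right _ _) (Or.inr ⟨hb, max_lt hg hcase⟩)
    · have h1 := h.α₀_pos
      have h2 := h.β₀_pos
      refine h.exists_slow_bound_of_comparison (c := 1 - a)
        (K := 1 + Real.sqrt α₀ * (α₀ / β₀)) hKL (by linarith) (Or.inr ⟨hb, hg⟩) hν
        (by positivity) hB₀ hp hpe (w := fun M N k => β k / α k + Real.sqrt (1 / M))
        (fun M N k => by linarith [Real.sqrt_nonneg (1 / (M : ℝ))])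
        (fun M N k => by linarith [Real.sqrt_nonneg (α k / N)])
        (fun M N k hN hk => ?_) (fun M N k hk => ?_)
      · have hk1 : (1 : ℝ) ≤ k := by exact_mod_cast hk
        have hN' : (1 : ℝ) ≤ N := by exact_mod_cast hN
        have h3 : Real.sqrt (α k / N) ≤ Real.sqrt α₀ * (α₀ / β₀) * (β k / α k) := by
          rw [h.sqrt_eq hk, h.ratio_eq hk]
          calc _ ≤ Real.sqrt α₀ * (k : ℝ) ^ (-(b - a)) := by
                gcongr
                · exact div_le_self h1.le hN'
                · linarith
            _ = _ := by field_simp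
        have h4 : 0 ≤ Real.sqrt α₀ * (α₀ / β₀) * Real.sqrt (1 / M) := by positivity
        simp only [one_add_mul, mul_add]
        linarith
      · have := h.ratio_le_succ (c := 1 - a) (by linarith) hk
        have := hconst M k (show 0 ≤ 1 - a by linarith)
        simp only [mul_add]
        linarith

end StepSizes


/-! ### The slow time scale: the recursion for the distance to the maximizer. -/

namespace Run

variable {M N : ℕ} {α β : ℕ → ℝ} {R : ℝ} {Ω : Type*} [MeasurableSpace Ω] {P : Measure Ω}

/-- The mean of a tracking error weighted by the envelope. -/
theorem lintegral_envelope_mul_err_le (ρ : Run mdl M N α β R P) (hwell : mdl.WellPosed)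
    (hlip : mdl.LipschitzGradient) (hreg : mdl.Regularity) {κ : E s → ℝ}
    (hκ : Measurable κ) (hκ2 : Integrable (fun u => κ u ^ 2) mdl.lawU) {C x : ℝ} (hC : 0 ≤ C)
    (hx : 0 < x) (m : Fin M) (t : Fin T) (k : ℕ)
    (herr : ∫⁻ ω, ‖ρ.err k m t ω‖ₑ ^ 2 ∂P ≤ ENNReal.ofReal (C * x ^ 2)) :
    ∫⁻ ω, ENNReal.ofReal (κ (ρ.outer ω m) * ‖ρ.err k m t ω‖) ∂P ≤
      ENNReal.ofReal ((∫ u, κ u ^ 2 ∂mdl.lawU + C) * x) := by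
  have h0 : 0 ≤ ∫ u, κ u ^ 2 ∂mdl.lawU := integral_nonneg fun u => sq_nonneg _
  have hm1 : Measurable fun ω => ENNReal.ofReal (κ (ρ.outer ω m) ^ 2) :=
    ((hκ.comp (ρ.u_measurable m)).pow_const 2).ennreal_ofReal
  have h1 : ∫⁻ ω, ENNReal.ofReal (κ (ρ.outer ω m) ^ 2) ∂P =
      ENNReal.ofReal (∫ u, κ u ^ 2 ∂mdl.lawU) := by
    refine ((ρ.measurePreserving_u m).lintegral_comp
      (f := fun u => ENNReal.ofReal (κ u ^ 2)) (hκ.pow_const 2).ennreal_ofReal).trans ?_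
    rw [ofReal_integral_eq_lintegral_ofReal hκ2 (Filter.Eventually.of_forall fun u => sq_nonneg _)]
  have hm2 := ((ρ.measurable_err hwell hlip hreg k m t).enorm).pow_const 2
  calc ∫⁻ ω, ENNReal.ofReal (κ (ρ.outer ω m) * ‖ρ.err k m t ω‖) ∂P
      ≤ ∫⁻ ω, (ENNReal.ofReal x * ENNReal.ofReal (κ (ρ.outer ω m) ^ 2) +
          ENNReal.ofReal x⁻¹ * ‖ρ.err k m t ω‖ₑ ^ 2) ∂P := by
        refine lintegral_mono fun ω => ?_
        rw [← ofReal_norm_sq, ← ENNReal.ofReal_mul hx.le, ← ENNReal.ofReal_mul (by positivity),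
          ← ENNReal.ofReal_add (by positivity) (by positivity)]
        refine ENNReal.ofReal_le_ofReal ?_
        -- Young's inequality weighted by the tracking rate `x` itself: a second moment of order
        -- `x²` divided by `x` is of order `x`, and so is `x` times the second moment of `κ`.
        have h2 : 0 ≤ x⁻¹ * (x * κ (ρ.outer ω m) - ‖ρ.err k m t ω‖) ^ 2 := by positivity
        have h3 : x⁻¹ * (x * κ (ρ.outer ω m) - ‖ρ.err k m t ω‖) ^ 2 =
            x * κ (ρ.outer ω m) ^ 2 - 2 * (κ (ρ.outer ω m) * ‖ρ.err k m t ω‖) +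
              x⁻¹ * ‖ρ.err k m t ω‖ ^ 2 := by field_simp; ring
        have h4 : 0 ≤ x * κ (ρ.outer ω m) ^ 2 + x⁻¹ * ‖ρ.err k m t ω‖ ^ 2 := by positivity
        linarith
    _ = ENNReal.ofReal x * ENNReal.ofReal (∫ u, κ u ^ 2 ∂mdl.lawU) +
          ENNReal.ofReal x⁻¹ * ∫⁻ ω, ‖ρ.err k m t ω‖ₑ ^ 2 ∂P := by
        rw [lintegral_add_left (hm1.const_mul _), lintegral_const_mul _ hm1,
          lintegral_const_mul _ hm2, h1]
    _ ≤ ENNReal.ofReal x * ENNReal.ofReal (∫ u, κ u ^ 2 ∂mdl.lawU) +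
          ENNReal.ofReal x⁻¹ * ENNReal.ofReal (C * x ^ 2) := by gcongr
    _ = _ := by
        rw [← ENNReal.ofReal_mul hx.le, ← ENNReal.ofReal_mul (by positivity),
          ← ENNReal.ofReal_add (by positivity) (by positivity)]
        congr 1
        field_simp

end Run

/-- The recursion for the mean distance to the maximizer. -/
theorem exists_slow_recursion.{v} (hwell : mdl.WellPosed) (hlip : mdl.LipschitzGradient)
    (hreg : mdl.Regularity) {KL : ℝ} (hconc : mdl.StronglyConcaveSAA KL)
    {α β : ℕ → ℝ} {a b α₀ β₀ : ℝ} (hstep : StepSizes α β a b α₀ β₀) {lamBar : E l}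
    (hmem : lamBar ∈ mdl.Λ) (hmax : IsMaxOn mdl.elbo mdl.Λ lamBar) (R : ℝ) {K : ℝ}
    (hK : ∀ x ∈ mdl.Λ, ∀ y ∈ mdl.Λ, ‖gradientWithin mdl.elbo mdl.Λ x -
      gradientWithin mdl.elbo mdl.Λ y‖ ≤ K * ‖x - y‖) :
    ∃ ν : ℝ, 0 ≤ ν ∧ ∀ M N : ℕ, 1 ≤ M → 1 ≤ N → ∀ (Ω : Type v) [MeasurableSpace Ω]
      (P : Measure Ω) [IsProbabilityMeasure P] (ρ : Run mdl M N α β R P) (k : ℕ),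
        ∫⁻ ω, ‖(ρ.state (k + 1) ω).1 - lamBar‖ₑ ∂P ≤
          ENNReal.ofReal |1 - β k * KL + β k ^ 2 * K ^ 2 / 2| *
            ∫⁻ ω, ‖(ρ.state k ω).1 - lamBar‖ₑ ∂P + ENNReal.ofReal
              (β k * (ν * (β k / α k + Real.sqrt (α k / N) + Real.sqrt (1 / M)))) := by
  have := hwell.p0_prob
  obtain ⟨C₁, C₂, ε, hC₁, hC₂, hε, hεC, κ, hκ, hκ4, hgood⟩ := Model.exists_goodSample hreg
  obtain ⟨CW, hCW, hdev⟩ := Model.exists_gradient_deviation_bound.{v} hwell hlip hreg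
  obtain ⟨CE, hCE, herr⟩ := exists_err_sq_bound.{v} hwell hlip hreg hstep hC₁ hC₂ hε hεC hκ hκ4
    hgood R
  have hκ2 := integrable_sq_of_pow_four hκ hκ4
  set K2 := ∫ u, κ u ^ 2 ∂mdl.lawU with hK2
  have hK20 : 0 ≤ K2 := integral_nonneg fun u => sq_nonneg _
  refine ⟨CW + T * (K2 + CE), by positivity, ?_⟩
  intro M N hM hN Ω _ P _ ρ k
  -- `λ_k` depends on all the outer samples, so at `λ_k` the summands of the average are not
  -- independent. The majorant `W` over all of `Λ`, the same for every `k`, takes their place.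
  obtain ⟨W, hWm, hW, hWi⟩ := hdev Ω P M ρ.u hM ρ.u_measurable ρ.u_indep ρ.u_law
  have hα := hstep.α_pos k
  have hβ := hstep.β_pos k
  have hM0 : (0 : ℝ) < M := by exact_mod_cast hM
  set p := |1 - β k * KL + β k ^ 2 * K ^ 2 / 2| with hp
  set x := β k / α k + Real.sqrt (α k / N) with hx
  have hx0 : 0 < x := by positivity
  have hstm : Measurable fun ω => ‖(ρ.state k ω).1 - lamBar‖ₑ := by
    have := (ρ.measurable_state hwell hlip k).fst
    exact (this.sub_const lamBar).enorm
  have herrm : ∀ m t, Measurable fun ω =>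
      ENNReal.ofReal (κ (ρ.outer ω m) * ‖ρ.err k m t ω‖) := fun m t =>
    ((hκ.comp (ρ.u_measurable m)).mul
      (ρ.measurable_err hwell hlip hreg k m t).norm).ennreal_ofReal
  let S : Ω → ENNReal := fun ω => ∑ m, ∑ t, ENNReal.ofReal (κ (ρ.outer ω m) * ‖ρ.err k m t ω‖)
  have hSm : Measurable S :=
    Finset.measurable_sum _ fun m _ => Finset.measurable_sum _ fun t _ => herrm m t
  have hSi : ∫⁻ ω, S ω ∂P ≤ ENNReal.ofReal (M * (T * ((K2 + CE) * x))) := by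
    simp only [S]
    rw [lintegral_finsetSum _ fun m _ => Finset.measurable_sum _ fun t _ => herrm m t]
    simp only [lintegral_finsetSum _ fun t _ => herrm _ t]
    calc _ ≤ ∑ _m : Fin M, ∑ _t : Fin T, ENNReal.ofReal ((K2 + CE) * x) :=
          Finset.sum_le_sum fun m _ => Finset.sum_le_sum fun t _ =>
            ρ.lintegral_envelope_mul_err_le hwell hlip hreg hκ hκ2 hCE hx0 m t k
              (herr M N hN Ω P ρ m t k)
      _ = _ := by
          rw [ENNReal.ofReal_mul hM0.le, ENNReal.ofReal_mul (Nat.cast_nonneg T)]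
          simp
  calc ∫⁻ ω, ‖(ρ.state (k + 1) ω).1 - lamBar‖ₑ ∂P
      ≤ ∫⁻ ω, (ENNReal.ofReal p * ‖(ρ.state k ω).1 - lamBar‖ₑ +
          (ENNReal.ofReal (β k * (M : ℝ)⁻¹) * S ω + ENNReal.ofReal (β k) * W ω)) ∂P := by
        refine lintegral_mono_ae ?_
        filter_upwards [ρ.ae_forall_u hgood, hW] with ω hω hWω
        have hlam := ρ.state_fst_mem hwell hlip k ω
        have h1 := Model.norm_nextLam_sub_le hwell hlip hreg hconc hmem hmax hK hβ.le
          (ρ.outer ω) hlam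
        have h2 := Model.norm_direction_sub_le hω hlam (ρ.state k ω).2
          (gradientWithin mdl.elbo mdl.Λ (ρ.state k ω).1)
        have h3 : S ω = ENNReal.ofReal (∑ m, ∑ t, κ (ρ.outer ω m) * ‖ρ.err k m t ω‖) := by
          have h4 : ∀ m t, 0 ≤ κ (ρ.outer ω m) * ‖ρ.err k m t ω‖ := fun m t =>
            mul_nonneg ((hω m).κ_nonneg hlam) (norm_nonneg _)
          rw [ENNReal.ofReal_sum_of_nonneg fun m _ => Finset.sum_nonneg fun t _ => h4 m t]
          exact Finset.sum_congr rfl fun m _ =>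
            (ENNReal.ofReal_sum_of_nonneg fun t _ => h4 m t).symm
        have h5 : 0 ≤ ∑ m, ∑ t, κ (ρ.outer ω m) * ‖ρ.err k m t ω‖ :=
          Finset.sum_nonneg fun m _ => Finset.sum_nonneg fun t _ =>
            mul_nonneg ((hω m).κ_nonneg hlam) (norm_nonneg _)
        have h6 : ENNReal.ofReal (β k) * ‖(M : ℝ)⁻¹ • ∑ m, mdl.h (ρ.outer ω m) (ρ.state k ω).1 -
            gradientWithin mdl.elbo mdl.Λ (ρ.state k ω).1‖ₑ ≤ ENNReal.ofReal (β k) * W ω :=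
          mul_le_mul_right (hWω _ hlam) _
        refine le_trans ?_ (add_le_add_right (add_le_add_right h6 _) _)
        rw [h3, ← ofReal_norm, ← ofReal_norm, ← ofReal_norm, ρ.state_succ_fst,
          ← ENNReal.ofReal_mul (abs_nonneg _), ← ENNReal.ofReal_mul (by positivity),
          ← ENNReal.ofReal_mul hβ.le, ← ENNReal.ofReal_add (by positivity) (by positivity),
          ← ENNReal.ofReal_add (by positivity) (by positivity)]
        refine ENNReal.ofReal_le_ofReal (h1.trans ?_)
        have h7 := mul_le_mul_of_nonneg_left h2 hβ.le
        simp only [Run.err] at h7 ⊢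
        linarith
    _ = ENNReal.ofReal p * ∫⁻ ω, ‖(ρ.state k ω).1 - lamBar‖ₑ ∂P +
          (ENNReal.ofReal (β k * (M : ℝ)⁻¹) * ∫⁻ ω, S ω ∂P +
            ENNReal.ofReal (β k) * ∫⁻ ω, W ω ∂P) := by
        rw [lintegral_add_left (hstm.const_mul _), lintegral_const_mul _ hstm,
          lintegral_add_left (hSm.const_mul _), lintegral_const_mul _ hSm,
          lintegral_const_mul'' _ hWm]
    _ ≤ ENNReal.ofReal p * ∫⁻ ω, ‖(ρ.state k ω).1 - lamBar‖ₑ ∂P +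
          (ENNReal.ofReal (β k * (M : ℝ)⁻¹) * ENNReal.ofReal (M * (T * ((K2 + CE) * x))) +
            ENNReal.ofReal (β k) * ENNReal.ofReal (CW / Real.sqrt M)) := by gcongr
    _ ≤ _ := by
        rw [← ENNReal.ofReal_mul (by positivity), ← ENNReal.ofReal_mul hβ.le,
          ← ENNReal.ofReal_add (by positivity) (by positivity)]
        refine add_le_add_right (ENNReal.ofReal_le_ofReal ?_) _
        have h1 : β k * (M : ℝ)⁻¹ * (M * (T * ((K2 + CE) * x))) =
            β k * (T * (K2 + CE) * x) := by field_simp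
        have h2 : CW / Real.sqrt M = CW * Real.sqrt (1 / M) := by
          rw [Real.sqrt_div zero_le_one, Real.sqrt_one, mul_one_div]
        rw [h1, h2, ← mul_add]
        refine mul_le_mul_of_nonneg_left ?_ hβ.le
        have h3 : 0 ≤ CW * x := by positivity
        have h4 : 0 ≤ T * (K2 + CE) * Real.sqrt (1 / M) := by positivity
        linarith

end NMTS
end

/-! ### Conclusion. -/

theorem mainTheorem2 {l d n r s T : ℕ} (mdl : NMTS.Model l d n r s T)
    (hwell : mdl.WellPosed) (hlip : mdl.LipschitzGradient) (hreg : mdl.Regularity)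
    (KL : ℝ) (hKL : 0 < KL) (hconc : mdl.StronglyConcaveSAA KL)
    (α β : ℕ → ℝ) (a b α₀ β₀ : ℝ) (hstep : NMTS.StepSizes α β a b α₀ β₀)
    (hgain : b = 1 → 1 - a < β₀ * KL)
    (lamBar : NMTS.E l) (hmem : lamBar ∈ mdl.Λ) (hmax : IsMaxOn mdl.elbo mdl.Λ lamBar)
    (R : ℝ) :
    ∃ C : ℝ, ∀ M N : ℕ, 1 ≤ M → 1 ≤ N →
      ∀ (Ω : Type*) [MeasurableSpace Ω] (P : Measure Ω) [IsProbabilityMeasure P]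
        (ρ : NMTS.Run mdl M N α β R P) (k : ℕ),
        Integrable (fun ω => ‖ρ.lam k ω - lamBar‖) P ∧
        ∫ ω, ‖ρ.lam k ω - lamBar‖ ∂P ≤
          C * (β k / α k + Real.sqrt (α k / N) + Real.sqrt (1 / M)) := by
  obtain ⟨K, hK⟩ := NMTS.Model.exists_lipschitz_gradient hwell hlip hreg
  obtain ⟨ν, hν, hrec⟩ := NMTS.exists_slow_recursion hwell hlip hreg hconc hstep hmem hmax R hK
  -- The iterates never leave the bounded set `Λ`; this gives both integrability and the initial
  -- value of the recursion.
  obtain ⟨B, hB⟩ := hlip.compact.isBounded.exists_norm_le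
  have hdist : ∀ lam ∈ mdl.Λ, ‖lam - lamBar‖ ≤ B + B := fun lam hlam =>
    (norm_sub_le _ _).trans (add_le_add (hB _ hlam) (hB _ hmem))
  have hB0 : 0 ≤ B + B := (norm_nonneg _).trans (hdist _ hmem)
  obtain ⟨C, hC⟩ := hstep.exists_slow_bound hKL hgain hν hB0
    (p := fun k => |1 - β k * KL + β k ^ 2 * K ^ 2 / 2|) (fun k => abs_nonneg _)
    fun μ hμ => NMTS.eventually_abs_one_sub_add_le hstep.β_pos hstep.tendsto_β hμ
  -- A non-negative constant is needed to return from `ENNReal.ofReal` to an inequality of reals.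
  refine ⟨max C 0, fun M N hM hN Ω _ P _ ρ k => ?_⟩
  have hm : Measurable fun ω => ‖(ρ.state k ω).1 - lamBar‖ :=
    ((ρ.measurable_state hwell hlip k).fst.sub_const lamBar).norm
  have hle : ∀ j ω, ‖(ρ.state j ω).1 - lamBar‖ ≤ B + B := fun j ω =>
    hdist _ (ρ.state_fst_mem hwell hlip j ω)
  have hint : Integrable (fun ω => ‖(ρ.state k ω).1 - lamBar‖) P :=
    (integrable_const (B + B)).mono' hm.aestronglyMeasurable
      (Filter.Eventually.of_forall fun ω => by simpa using hle k ω)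
  simp only [NMTS.Run.lam_eq]
  refine ⟨hint, ?_⟩
  have hα := hstep.α_pos k
  have hβ := hstep.β_pos k
  have h1 := hC M N hM hN (fun j => ∫⁻ ω, ‖(ρ.state j ω).1 - lamBar‖ₑ ∂P) (by
    calc ∫⁻ ω, ‖(ρ.state 0 ω).1 - lamBar‖ₑ ∂P ≤ ∫⁻ _ω, ENNReal.ofReal (B + B) ∂P := by
          refine lintegral_mono fun ω => ?_
          rw [← ofReal_norm]
          exact ENNReal.ofReal_le_ofReal (hle 0 ω)
      _ = ENNReal.ofReal (B + B) := by simp) (hrec M N hM hN Ω P ρ) k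
  have h2 : ENNReal.ofReal (C * (β k / α k + Real.sqrt (α k / N) + Real.sqrt (1 / M))) ≤
      ENNReal.ofReal (max C 0 * (β k / α k + Real.sqrt (α k / N) + Real.sqrt (1 / M))) :=
    ENNReal.ofReal_le_ofReal (mul_le_mul_of_nonneg_right (le_max_left _ _) (by positivity))
  rw [← ENNReal.ofReal_le_ofReal_iff (mul_nonneg (le_max_right _ _) (by positivity)),
    ofReal_integral_eq_lintegral_ofReal hint (Filter.Eventually.of_forall fun ω => norm_nonneg _)]
  simpa only [ofReal_norm] using h1.trans h2
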